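/- Fix an integer $N\ge 0$ and a real number $\epsilon\neq 0$. Let $\mathcal Z_N=\mathbb C[\Gamma]/(\Gamma^N)$ be the algebra of $N\times N$ matrices generated by $\Gamma=(\delta_{i,j+1})_{ij}$. All functions are $\mathcal Z_N$-valued, smooth in the real variables $x$ and $s_0$, and formal power series in $t_j$ $(j\ge 0)$ and $s_j$ $(j\ge 1)$. Put $(\Lambda g)(x)=g(x+\epsilon)$, $\partial=\partial/\partial x$, $c_j=\sum_{i=1}^j\frac1i$. For $X=\sum_n X_n\Lambda^n$ write $X_+=\sum_{n\ge 0}X_n\Lambda^n$ and $X_-=\sum_{n<0}X_n\Lambda^n$. **Hierarchy.** A pair $S=1+\sum_{k\ge1}\omega_k\Lambda^{-k}$, $\bar S=\sum_{k\ge0}\bar\omega_k\Lambda^{k}$ ($\bar S$ invertible) is a pair of dressing operators of the extended $Z_N$-Toda hierarchy (EZTH) if $\mathcal L:=S\Lambda S^{-1}=\bar S\Lambda^{-1}\bar S^{-1}$ and, for all $j\ge0$, $$\epsilon\partial_{t_j}S=-(B_j)_-S,\quad \epsilon\partial_{t_j}\bar S=(B_j)_+\bar S,\quad \epsilon\partial_{s_j}S=-(D_j)_-S,\quad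 \epsilon\partial_{s_j}\bar S=(D_j)_+\bar S,$$ where $B_j=\frac{\mathcal L^{j+1}}{(j+1)!}$, $D_j=\frac{2\mathcal L^j}{j!}(\log\mathcal L-c_j)$, $\log\mathcal L=\frac12\left(S\,\epsilon\partial\, S^{-1}-\bar S\,\epsilon\partial\,\bar S^{-1}\right)$. **Tau-functions.** Let $\tau(s_0,t,s)$ be invertible and $\mathcal Z_N$-valued, and let $t\pm[z]$ denote $(t_j\pm\epsilon\, j!\,z^{j+1})_{j\ge0}$. Then $\tau$ is a tau-function of the EZTH if there are dressing operators $S,\bar S$ such that the left symbols of $S,\bar S$ (coefficients to the left of the powers of $\Lambda$, and $\Lambda$ replaced by $\lambda$) are $$\frac{\tau(s_0+x-\frac\epsilon2,\,t-[\lambda^{-1}],\,s)}{\tau(s_0+x-\frac\epsilon2,t,s)},\qquad \frac{\tau(s_0+x+\frac\epsilon2,\,t+[\lambda],\,s)}{\tau(s_0+x-\frac\epsilon2,t,s)},$$ and the right symbols of $S^{-1},\bar S^{-1}$ (coefficients to the right of the powers of $\Lambda$) are $$\frac{\tau(s_0+x+\frac\epsilon2,\,t+[\lambda^{-1}],\,s)}{\tau(s_0+x+\frac\epsilon2,t,s)},\qquad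 \frac{\tau(s_0+x-\frac\epsilon2,\,t-[\lambda],\,s)}{\tau(s_0+x+\frac\epsilon2,t,s)}.$$ **Vertex operators.** With $[z]_\partial=\epsilon\sum_{j\ge0}j!\,z^{j+1}\partial_{t_j}$ put $$\Gamma^{\pm a}=\exp\Big(\pm\frac1\epsilon\sum_{j\ge0}\Big(\frac{t_j}{2}\frac{\lambda^{j+1}}{(j+1)!}+s_j\frac{\lambda^j}{j!}(\log\lambda-c_j)\Big)\Big)\exp\Big(\mp\frac\epsilon2\partial_{s_0}\mp[\lambda^{-1}]_\partial\Big),$$ $$\Gamma^{\pm b}=\exp\Big(\pm\frac1\epsilon\sum_{j\ge0}\Big(\frac{t_j}{2}\frac{\lambda^{-j-1}}{(j+1)!}-s_j\frac{\lambda^{-j}}{j!}(\log\lambda+c_j)\Big)\Big)\exp\Big(\mp\frac\epsilon2\partial_{s_0}\mp[\lambda]_\partial\Big),$$ $$\Gamma_a^{\#}\otimes\Gamma_a=e^{x\partial_{s_0}}\exp\Big(\sum_{j>0}\frac{\lambda^j}{j!}(s_j-s_j')\,\partial\Big)e^{x\partial_{s_0'}},\qquad \Gamma_b^{\#}\otimes\Gamma_b=e^{x\partial_{s_0}}\exp\Big(\sum_{j>0}\frac{\lambda^{-j}}{j!}(s_j-s_j')\,\partial\Big)e^{x\partial_{s_0'}},$$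 where the second tensor factor is written in the variables $t',s'$. Applied to $\tau\otimes\tau$, the composites with $\Gamma^{\pm a}\otimes\Gamma^{\mp a}$ and $\Gamma^{\mp b}\otimes\Gamma^{\pm b}$ are differential operators in $x$. Their coefficients are power series in $t,t',s,s'$ whose coefficients are expanded as Laurent series at $\lambda=\infty$ for type $a$ and at $\lambda=0$ for type $b$. At $s_0-s_0'=l\epsilon$, $l\in\mathbb Z$, the logarithms combine to $e^{\pm l\log\lambda}=\lambda^{\pm l}$, so the series are single-valued. Let $\mathrm{Res}_\lambda\sum_n\alpha_n\lambda^n=\alpha_{-1}$. **Theorem.** An invertible $\mathcal Z_N$-valued $\tau$ is a tau-function of the EZTH if and only if it satisfies the Hirota quadratic equations $$\mathrm{Res}_\lambda\,\lambda^{r-1}\big(\Gamma_a^{\#}\otimes\Gamma_a\big)\big(\Gamma^{a}\otimes\Gamma^{-a}\big)(\tau\otimes\tau)=\mathrm{Res}_\lambda\,\lambda^{-r-1}\big(\Gamma_b^{\#}\otimes\Gamma_b\big)\big(\Gamma^{-b}\otimes\Gamma^{b}\big)(\tau\otimes\tau)$$ computed at $s_0-s_0'=l\epsilon$, for all $l\in\mathbb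 Z$ and all integers $r\ge0$. Moreover, $\tau$ satisfies these equations if and only if $$\frac{d\lambda}{\lambda}\big(\Gamma_a^{\#}\otimes\Gamma_a\big)\big(\Gamma^{a}\otimes\Gamma^{-a}-\Gamma^{-a}\otimes\Gamma^{a}\big)(\tau\otimes\tau)$$ computed at $s_0-s_0'=l\epsilon$ is regular in $\lambda$ (contains no negative powers of $\lambda$) for every $l\in\mathbb Z$; for $N=1$ these are Milanov's Hirota quadratic equations of the extended Toda hierarchy. -/

import Mathlib

/-! # The extended `Z_N`-Toda hierarchy, its tau-functions and its Hirota quadratic equations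

The variables `t_j` (`j ≥ 0`) and `s_j` (`j ≥ 1`) are formal; the spatial variable `x` and the
variable `s_0`, in which finite shifts by multiples of the step `ε` are taken, are real variables,
on which everything depends smoothly. -/

noncomputable section

namespace EZTH

open scoped ContDiff

/-! ## The algebra `Z_N` and smooth `Z_N`-valued functions -/

/-- The nilpotent matrix `Γ = (δ_{i,j+1})_{ij}`. -/
def Gam (N : ℕ) : Matrix (Fin N) (Fin N) ℂ :=
  Matrix.of fun i j => if (i : ℕ) = (j : ℕ) + 1 then 1 else 0

/-- The commutative algebra `Z_N = ℂ[Γ]/(Γ^N)`, realised as the algebra of matrices generated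
by `Γ`. -/
def ZN (N : ℕ) : Subalgebra ℂ (Matrix (Fin N) (Fin N) ℂ) := Algebra.adjoin ℂ {Gam N}

theorem ZN_comm {N : ℕ} {a b : Matrix (Fin N) (Fin N) ℂ} (ha : a ∈ ZN N) (hb : b ∈ ZN N) :
    a * b = b * a := by
  have h : IsMulCommutative (Algebra.adjoin ℂ {Gam N}) := inferInstance
  exact congrArg Subtype.val (h.is_comm.comm ⟨a, ha⟩ ⟨b, hb⟩)

/-- The algebra of smooth functions `V → Z_N`. -/
def smoothZN (N : ℕ) (V : Type) [NormedAddCommGroup V] [NormedSpace ℝ V] :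
    Subalgebra ℂ (V → Matrix (Fin N) (Fin N) ℂ) where
  carrier := {f | (∀ x, f x ∈ ZN N) ∧ ∀ i j, ContDiff ℝ ∞ fun x => f x i j}
  mul_mem' := by
    rintro f g ⟨hf, hf'⟩ ⟨hg, hg'⟩
    refine ⟨fun x => (ZN N).mul_mem (hf x) (hg x), fun i j => ?_⟩
    simp only [Pi.mul_apply, Matrix.mul_apply]
    exact ContDiff.sum fun k _ => (hf' i k).mul (hg' k j)
  add_mem' := by
    rintro f g ⟨hf, hf'⟩ ⟨hg, hg'⟩
    refine ⟨fun x => (ZN N).add_mem (hf x) (hg x), fun i j => ?_⟩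
    exact (hf' i j).add (hg' i j)
  algebraMap_mem' := by
    intro c
    exact ⟨fun x => (ZN N).algebraMap_mem c, fun i j => contDiff_const⟩

/-- Smooth functions `V → Z_N`. -/
def Fn (N : ℕ) (V : Type) [NormedAddCommGroup V] [NormedSpace ℝ V] : Type := smoothZN N V

section Functions

variable {N : ℕ} {V W : Type} [NormedAddCommGroup V] [NormedSpace ℝ V]
  [NormedAddCommGroup W] [NormedSpace ℝ W]

instance : CommRing (Fn N V) :=
  { (inferInstance : Ring (smoothZN N V)) with
    mul_comm := fun f g => Subtype.ext (funext fun x => ZN_comm (f.2.1 x) (g.2.1 x)) }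

instance : Algebra ℂ (Fn N V) := inferInstanceAs (Algebra ℂ (smoothZN N V))

/-- Composition `f ↦ f ∘ g` with a smooth map `g`. -/
def pull (g : V → W) (hg : ContDiff ℝ ∞ g) : Fn N W →+* Fn N V where
  toFun f := ⟨fun v => f.1 (g v), fun v => f.2.1 (g v), fun i j => (f.2.2 i j).comp hg⟩
  map_one' := rfl
  map_mul' _ _ := rfl
  map_zero' := rfl
  map_add' _ _ := rfl

/-- A smooth scalar function `φ`, regarded as the function `φ · 1` with values in `Z_N`. -/
def scalarFn (φ : V → ℂ) (hφ : ContDiff ℝ ∞ φ) : Fn N V :=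
  ⟨fun v => algebraMap ℂ _ (φ v), fun v => (ZN N).algebraMap_mem (φ v), fun i j => by
    by_cases h : i = j
    · simpa [Matrix.algebraMap_matrix_apply, h] using hφ
    · simpa [Matrix.algebraMap_matrix_apply, h] using contDiff_const⟩

/-- The entrywise derivative of a `Z_N`-valued function takes values in `Z_N`. -/
theorem fderiv_mem_ZN (f : Fn N V) (v x : V) :
    (Matrix.of fun i j => fderiv ℝ (fun y => f.1 y i j) x v) ∈ ZN N := by
  by_contra h
  obtain ⟨φ, hφ, hle⟩ := Submodule.exists_le_ker_of_notMem (p := Subalgebra.toSubmodule (ZN N)) h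
  apply hφ
  have key : ∀ M : Matrix (Fin N) (Fin N) ℂ,
      φ M = ∑ i, ∑ j, M i j * φ (Matrix.single i j 1) := by
    intro M
    conv_lhs => rw [Matrix.matrix_eq_sum_single M]
    simp only [map_sum]
    refine Finset.sum_congr rfl fun i _ => Finset.sum_congr rfl fun j _ => ?_
    rw [← smul_eq_mul, ← map_smul, Matrix.smul_single, smul_eq_mul, mul_one]
  have h0 : ∀ y, ∑ i, ∑ j, f.1 y i j * φ (Matrix.single i j 1) = 0 := fun y => by
    rw [← key]; exact hle (f.2.1 y)
  have hd : ∀ i j, HasFDerivAt (fun y => f.1 y i j) (fderiv ℝ (fun y => f.1 y i j) x) x :=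
    fun i j => ((f.2.2 i j).differentiable (by simp) x).hasFDerivAt
  have h1 : HasFDerivAt (fun y => ∑ i, ∑ j, f.1 y i j * φ (Matrix.single i j 1)) _ x :=
    HasFDerivAt.fun_sum fun i _ => HasFDerivAt.fun_sum fun j _ =>
      (hd i j).mul_const (φ (Matrix.single i j 1))
  have h2 : HasFDerivAt (fun y => ∑ i, ∑ j, f.1 y i j * φ (Matrix.single i j 1))
      (0 : V →L[ℝ] ℂ) x := by
    simp only [h0]; exact hasFDerivAt_const 0 x
  have h3 := congrArg (fun L => L v) (h1.unique h2)
  rw [key]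
  simpa [mul_comm] using h3

/-- The derivative of a smooth `Z_N`-valued function in the direction `v`. -/
def der (v : V) : Fn N V →+ Fn N V where
  toFun f := ⟨fun x => Matrix.of fun i j => fderiv ℝ (fun y => f.1 y i j) x v,
    fun x => fderiv_mem_ZN f v x, fun i j => by
      simpa using ((f.2.2 i j).fderiv_right (m := ∞) (by simp)).clm_apply contDiff_const⟩
  map_zero' := by
    apply Subtype.ext; funext x; ext i j
    change fderiv ℝ (fun _ : V => (0 : ℂ)) x v = 0
    simp
  map_add' f g := by
    apply Subtype.ext; funext x; ext i j
    have hf := (f.2.2 i j).differentiable (by simp) x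
    have hg := (g.2.2 i j).differentiable (by simp) x
    have h := fderiv_fun_add hf hg
    exact congrArg (fun L => L v) h

end Functions

/-! ## Formal times -/

/-- The formal time variables: `Time.t j` is `t_j` (`j ≥ 0`) and `Time.s j` is `s_{j+1}`. -/
inductive Time : Type
  | t (j : ℕ)
  | s (j : ℕ)

/-- Apply an additive map to all coefficients of a power series. -/
def mapCoeff {σ A B : Type} [Semiring A] [Semiring B] (φ : A →+ B) (F : MvPowerSeries σ A) :
    MvPowerSeries σ B := fun α => φ (MvPowerSeries.coeff α F)

/-- The harmonic numbers `c_j = 1 + 1/2 + ⋯ + 1/j`. -/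
def c (j : ℕ) : ℂ := ∑ i ∈ Finset.range j, 1 / ((i : ℂ) + 1)

/-- The coefficientwise scalar multiplication on Laurent series. -/
instance instAlgebraLaurent {A : Type} [CommRing A] [Algebra ℂ A] : Algebra ℂ (LaurentSeries A) :=
  HahnSeries.instAlgebra

section Miwa

variable {A : Type} [CommRing A] [Algebra ℂ A]

/-- The operator `[z]_∂ = ε ∑_{j ≥ 0} j! z^{j+1} ∂_{t_j}` on power series in `z`. -/
def miwaD (ε : ℝ) (F : PowerSeries (MvPowerSeries Time A)) : PowerSeries (MvPowerSeries Time A) :=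
  PowerSeries.mk fun k => ∑ j ∈ Finset.range k,
    ((ε : ℂ) * (j.factorial : ℂ)) •
      MvPowerSeries.pderiv A (Time.t j) (PowerSeries.coeff (k - 1 - j) F)

/-- `exp(σ [z]_∂) f`, that is `f` with `t_j` replaced by `t_j + σ ε j! z^{j+1}` for all `j`, as a
power series in `z`. As `[z]_∂` raises the order in `z`, only `m ≤ k` matters for the coefficient
of `z^k` of `∑_m σ^m [z]_∂^m f / m!`. -/
def miwa (ε : ℝ) (σ : ℤ) (f : MvPowerSeries Time A) : PowerSeries (MvPowerSeries Time A) :=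
  PowerSeries.mk fun k => ∑ m ∈ Finset.range (k + 1),
    ((σ : ℂ) ^ m / (m.factorial : ℂ)) • PowerSeries.coeff k ((miwaD ε)^[m] (PowerSeries.C f))

end Miwa

/-! ## Difference-differential operators and the hierarchy

The points of `ℝ × ℝ` are the pairs `(x, s_0)`. -/

/-- Functions of `x`, `s_0` and the formal times. -/
abbrev Coef (N : ℕ) : Type := MvPowerSeries Time (Fn N (ℝ × ℝ))

section Operators

variable {N : ℕ}

/-- The shift `(Λ^k g)(x) = g(x + k ε)`. -/
def shift (ε : ℝ) (k : ℤ) : Coef N →+* Coef N :=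
  MvPowerSeries.map (pull (fun p : ℝ × ℝ => (p.1 + (k : ℝ) * ε, p.2)) (by fun_prop))

/-- The derivation `∂ = ∂/∂x`. -/
def dx : Coef N → Coef N := mapCoeff (der ((1 : ℝ), (0 : ℝ)))

/-- The derivation `∂/∂t_j`. -/
def dt (j : ℕ) : Coef N → Coef N := fun f => MvPowerSeries.pderiv _ (Time.t j) f

/-- The derivation `∂/∂s_j`. -/
def ds : ℕ → Coef N → Coef N
  | 0 => mapCoeff (der ((0 : ℝ), (1 : ℝ)))
  | j + 1 => fun f => MvPowerSeries.pderiv _ (Time.s j) f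

/-- Formal operators `∑_{n ∈ ℤ} ∑_k f_{n,k} ∂^k Λ^n`, where the sum over `k` is finite for every
`n`; the value at `n` is the polynomial `∑_k f_{n,k} X^k`. -/
abbrev Op (N : ℕ) : Type := ℤ → Polynomial (Coef N)

/-- Composition of operators,
`f ∂^k Λ^i ∘ g ∂^m Λ^j = f ∑_p (k choose p) Λ^i(∂^p g) ∂^{k-p+m} Λ^{i+j}`, extended bilinearly.
It is used only for factors for which the sum over `i` is finite. -/
def comp (ε : ℝ) (F G : Op N) : Op N := fun n => ∑ᶠ i : ℤ,
  (F i).sum fun k f => (G (n - i)).sum fun m g => ∑ p ∈ Finset.range (k + 1),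
    Polynomial.monomial (k - p + m) ((k.choose p : Coef N) * f * shift ε i (dx^[p] g))

/-- The operator `f ∂^k Λ^n`. -/
def term (f : Coef N) (k : ℕ) (n : ℤ) : Op N :=
  fun i => if i = n then Polynomial.monomial k f else 0

/-- The identity operator. -/
def one : Op N := term 1 0 0

/-- Powers of an operator. -/
def power (ε : ℝ) (F : Op N) : ℕ → Op N
  | 0 => one
  | n + 1 => comp ε (power ε F n) F

/-- Multiplication by a complex number. -/
def smulOp (a : ℂ) (F : Op N) : Op N :=
  fun n => Polynomial.C (MvPowerSeries.C (algebraMap ℂ (Fn N (ℝ × ℝ)) a)) * F n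

/-- The projection to non-negative powers of `Λ`. -/
def plus (F : Op N) : Op N := fun n => if 0 ≤ n then F n else 0

/-- The projection to negative powers of `Λ`. -/
def minus (F : Op N) : Op N := fun n => if n < 0 then F n else 0

/-- Apply a derivation with respect to a time variable to all coefficients. -/
def mapOp (d : Coef N → Coef N) (F : Op N) : Op N :=
  fun n => (F n).sum fun k f => Polynomial.monomial k (d f)

/-- The operator contains no `∂`. -/
def DiffFree (F : Op N) : Prop := ∀ n, (F n).natDegree = 0

/-- `G_{c-}`: the operators `1 + ∑_{n < 0} g_n Λ^n`. -/
def InGminus (F : Op N) : Prop := DiffFree F ∧ F 0 = 1 ∧ ∀ n, 0 < n → F n = 0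

/-- The operators `∑_{n ≥ 0} g_n Λ^n`. -/
def NonNeg (F : Op N) : Prop := DiffFree F ∧ ∀ n, n < 0 → F n = 0

/-- `G` is the two-sided inverse of `F`. -/
def IsInverse (ε : ℝ) (F G : Op N) : Prop := comp ε F G = one ∧ comp ε G F = one

/-- The Lax operator `L = S Λ S⁻¹`. -/
def lax (ε : ℝ) (S Sinv : Op N) : Op N := comp ε (comp ε S (term 1 0 1)) Sinv

/-- `log_+ L = S ∘ ε∂ ∘ S⁻¹`. -/
def logPlus (ε : ℝ) (S Sinv : Op N) : Op N :=
  comp ε (comp ε S (smulOp (ε : ℂ) (term 1 1 0))) Sinv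

/-- `log_- L = - S̄ ∘ ε∂ ∘ S̄⁻¹`. -/
def logMinus (ε : ℝ) (Sb Sbinv : Op N) : Op N :=
  -comp ε (comp ε Sb (smulOp (ε : ℂ) (term 1 1 0))) Sbinv

/-- `log L = (log_+ L + log_- L) / 2`. -/
def logLax (ε : ℝ) (S Sinv Sb Sbinv : Op N) : Op N :=
  smulOp (1 / 2) (logPlus ε S Sinv + logMinus ε Sb Sbinv)

/-- `B_j = L^{j+1} / (j+1)!`. -/
def opB (ε : ℝ) (S Sinv : Op N) (j : ℕ) : Op N :=
  smulOp (1 / ((j + 1).factorial : ℂ)) (power ε (lax ε S Sinv) (j + 1))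

/-- `D_j = (2 L^j / j!) (log L - c_j)`. -/
def opD (ε : ℝ) (S Sinv Sb Sbinv : Op N) (j : ℕ) : Op N :=
  smulOp (2 / (j.factorial : ℂ))
    (comp ε (power ε (lax ε S Sinv) j) (logLax ε S Sinv Sb Sbinv - smulOp (c j) one))

/-- `S`, `S̄`, with inverses `Sinv`, `Sbinv`, are dressing operators of the extended `Z_N`-Toda
hierarchy. -/
structure IsDressing (ε : ℝ) (S Sinv Sb Sbinv : Op N) : Prop where
  S_mem : InGminus S
  Sinv_mem : InGminus Sinv
  Sb_mem : NonNeg Sb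
  Sbinv_mem : NonNeg Sbinv
  S_inv : IsInverse ε S Sinv
  Sb_inv : IsInverse ε Sb Sbinv
  lax_eq : lax ε S Sinv = comp ε (comp ε Sb (term 1 0 (-1))) Sbinv
  t_S : ∀ j, smulOp (ε : ℂ) (mapOp (dt j) S) = -comp ε (minus (opB ε S Sinv j)) S
  t_Sb : ∀ j, smulOp (ε : ℂ) (mapOp (dt j) Sb) = comp ε (plus (opB ε S Sinv j)) Sb
  s_S : ∀ j, smulOp (ε : ℂ) (mapOp (ds j) S) = -comp ε (minus (opD ε S Sinv Sb Sbinv j)) S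
  s_Sb : ∀ j, smulOp (ε : ℂ) (mapOp (ds j) Sb) = comp ε (plus (opD ε S Sinv Sb Sbinv j)) Sb

/-- The operator `∑_k a_k Λ^{-k}` with left symbol `∑_k a_k λ^{-k}`. The argument is the symbol as a
power series in `λ⁻¹`. -/
def leftMinus (a : PowerSeries (Coef N)) : Op N :=
  fun n => if n ≤ 0 then Polynomial.C (PowerSeries.coeff n.natAbs a) else 0

/-- The operator `∑_k Λ^{-k} a_k` with right symbol `∑_k a_k λ^{-k}`. -/
def rightMinus (ε : ℝ) (a : PowerSeries (Coef N)) : Op N :=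
  fun n => if n ≤ 0 then Polynomial.C (shift ε n (PowerSeries.coeff n.natAbs a)) else 0

/-- The operator `∑_k a_k Λ^k` with left symbol `∑_k a_k λ^k`. -/
def leftPlus (a : PowerSeries (Coef N)) : Op N :=
  fun n => if 0 ≤ n then Polynomial.C (PowerSeries.coeff n.natAbs a) else 0

/-- The operator `∑_k Λ^k a_k` with right symbol `∑_k a_k λ^k`. -/
def rightPlus (ε : ℝ) (a : PowerSeries (Coef N)) : Op N :=
  fun n => if 0 ≤ n then Polynomial.C (shift ε n (PowerSeries.coeff n.natAbs a)) else 0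

/-! ## Tau-functions -/

/-- A `Z_N`-valued function of `s_0` and the formal times. -/
abbrev TauSpace (N : ℕ) : Type := MvPowerSeries Time (Fn N ℝ)

/-- `f(s_0 + x + a, t, s)` as a function of `x` and `s_0`. -/
def atSum (a : ℝ) : TauSpace N →+* Coef N :=
  MvPowerSeries.map (pull (fun p : ℝ × ℝ => p.2 + p.1 + a) (by fun_prop))

/-- The quotient `τ(s_0 + x + a, t_j + σ ε j! z^{j+1}, s) / τ(s_0 + x + b, t, s)`, as a power series
in `z`. -/
def tauQuot (ε : ℝ) (τ : (TauSpace N)ˣ) (σ : ℤ) (a b : ℝ) : PowerSeries (Coef N) :=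
  miwa ε σ (atSum a (τ : TauSpace N)) * PowerSeries.C (atSum b ((τ⁻¹ : (TauSpace N)ˣ) : TauSpace N))

/-- `τ` is a tau-function of the extended `Z_N`-Toda hierarchy: there are dressing operators
`S`, `S̄` such that the left symbols of `S`, `S̄` and the right symbols of their inverses are
given by `τ`. -/
def IsTauFunction (ε : ℝ) (τ : (TauSpace N)ˣ) : Prop :=
  ∃ S Sinv Sb Sbinv : Op N, IsDressing ε S Sinv Sb Sbinv ∧
    S = leftMinus (tauQuot ε τ (-1) (-ε / 2) (-ε / 2)) ∧
    Sinv = rightMinus ε (tauQuot ε τ 1 (ε / 2) (ε / 2)) ∧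
    Sb = leftPlus (tauQuot ε τ 1 (ε / 2) (-ε / 2)) ∧
    Sbinv = rightPlus ε (tauQuot ε τ (-1) (-ε / 2) (ε / 2))

end Operators

/-! ## Formal exponentials -/

section Exponentials

variable {σ A : Type} [CommRing A] [Algebra ℂ A]

/-- `exp F = ∑_m F^m / m!`, for a power series `F` without constant term (only `m ≤ |α|`
contributes to the coefficient at the exponent `α`). -/
def expS (F : MvPowerSeries σ A) : MvPowerSeries σ A := fun α =>
  ∑ m ∈ Finset.range (α.degree + 1), ((1 : ℂ) / (m.factorial : ℂ)) • MvPowerSeries.coeff α (F ^ m)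

/-- `∑_m δ^m d^m(B) / m!`, for `δ` without constant term: the translate `exp(δ d) B`. -/
def translate (d : MvPowerSeries σ A → MvPowerSeries σ A) (δ B : MvPowerSeries σ A) :
    MvPowerSeries σ A := fun α =>
  ∑ m ∈ Finset.range (α.degree + 1),
    ((1 : ℂ) / (m.factorial : ℂ)) • MvPowerSeries.coeff α (δ ^ m * d^[m] B)

/-- The linear form `∑_v a_v v` in the (possibly infinitely many) variables `v`. -/
def linForm (a : σ → A) : MvPowerSeries σ A := fun α =>
  if α.degree = 1 then ∑ v ∈ α.support, a v else 0

end Exponentials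

/-! ## Vertex operators

There are two types of vertex operators, `a` and `b`. Series of type `a` are expanded at `λ = ∞`,
series of type `b` at `λ = 0`. They are written as Laurent series in the local parameter
`z`, which is `λ⁻¹` for type `a` and `λ` for type `b`. The logarithm `log λ` is an additional
formal variable. -/

/-- The types of vertex operators. -/
inductive Kind : Type
  | a
  | b

/-- The sign `κ` with `λ = z^{-κ}`. -/
def Kind.sgn : Kind → ℤ
  | .a => 1
  | .b => -1

/-- `λ^m` as a Laurent series in the local parameter. -/
def lamPow {A : Type} [CommRing A] (p : Kind) (m : ℤ) : LaurentSeries A :=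
  HahnSeries.single (-(p.sgn * m)) 1

/-- `Res_λ ∑_n α_n λ^n = α_{-1}`, applied to all coefficients of a power series. -/
def resLam {σ A : Type} [CommRing A] (p : Kind) (F : MvPowerSeries σ (LaurentSeries A)) :
    MvPowerSeries σ A := fun α => (MvPowerSeries.coeff α F).coeff p.sgn

/-- Apply an additive map to all coefficients of a power series over Laurent series. -/
def mapBase {σ A B : Type} [CommRing A] [CommRing B] (φ : A →+ B)
    (F : MvPowerSeries σ (LaurentSeries A)) : MvPowerSeries σ (LaurentSeries B) :=
  fun α => (MvPowerSeries.coeff α F).map φ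

/-- Regard a power series in `z`, with coefficients power series in the times, as a power series in
the times with coefficients Laurent series in `z`. -/
def toLaurent {σ A : Type} [CommRing A] (F : PowerSeries (MvPowerSeries σ A)) :
    MvPowerSeries σ (LaurentSeries A) := fun α =>
  HahnSeries.ofPowerSeries ℤ A (PowerSeries.mk fun k => MvPowerSeries.coeff α (PowerSeries.coeff k F))

/-- The variables of one tensor factor: the times (`some v`) and `log λ` (`none`). -/
abbrev Var1 : Type := Option Time

/-- The variables of the tensor product: the times of the first and of the second factor (primed in
the usual notation), `log λ`, and the symbol of the derivation `∂ = ∂/∂x`. -/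
inductive Var2 : Type
  | fst (v : Time)
  | snd (v : Time)
  | log
  | del

/-- The inclusion of the variables of the first factor. -/
def inFst : Var1 → Var2
  | some v => Var2.fst v
  | none => Var2.log

/-- The inclusion of the variables of the second factor. -/
def inSnd : Var1 → Var2
  | some v => Var2.snd v
  | none => Var2.log

instance : Filter.TendstoCofinite inFst :=
  Filter.tendstoCofinite_of_injective (by
    rintro (_ | v) (_ | w) h <;> simp_all [inFst])

instance : Filter.TendstoCofinite inSnd :=
  Filter.tendstoCofinite_of_injective (by
    rintro (_ | v) (_ | w) h <;> simp_all [inSnd])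

instance : Filter.TendstoCofinite (some : Time → Var1) :=
  Filter.tendstoCofinite_of_injective (Option.some_injective _)

section Vertex

variable {N : ℕ}

/-- `∑_{j ≥ 1} s_j u_j`. -/
def sForm {A : Type} [CommRing A] [Algebra ℂ A] (u : ℕ → A) : MvPowerSeries Var1 A :=
  linForm fun v => match v with
    | some (Time.s j) => u (j + 1)
    | _ => 0

/-- `∑_{j ≥ 0} t_j u_j`. -/
def tForm {A : Type} [CommRing A] [Algebra ℂ A] (u : ℕ → A) : MvPowerSeries Var1 A :=
  linForm fun v => match v with
    | some (Time.t j) => u j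
    | _ => 0

/-- The power `z^{-j} / j!`, which is `λ^j / j!` for type `a` and `λ^{-j} / j!` for type `b`. -/
def divPow {A : Type} [CommRing A] [Algebra ℂ A] (p : Kind) (j : ℕ) : LaurentSeries A :=
  ((1 : ℂ) / (j.factorial : ℂ)) • lamPow p (p.sgn * j)

/-- `κ log λ`, that is `log λ` for type `a` and `- log λ` for type `b`. -/
def logVar (p : Kind) : MvPowerSeries Var1 (LaurentSeries (Fn N ℝ)) :=
  (p.sgn : ℂ) • MvPowerSeries.X none

/-- The exponent of the vertex operators. For type `a` it is
`(1/ε) (∑_{j ≥ 0} (1/2) t_j λ^{j+1}/(j+1)! + ∑_{j ≥ 0} s_j (λ^j/j!) (log λ - c_j))`,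
for type `b` it is
`(1/ε) (∑_{j ≥ 0} (1/2) t_j λ^{-j-1}/(j+1)! - ∑_{j ≥ 0} s_j (λ^{-j}/j!) (log λ + c_j))`. -/
def vertexExponent (ε : ℝ) (p : Kind) : MvPowerSeries Var1 (LaurentSeries (Fn N ℝ)) :=
  ((1 : ℂ) / (ε : ℂ)) •
    (tForm (fun j => ((1 : ℂ) / 2) • (divPow p (j + 1) : LaurentSeries (Fn N ℝ)))
      + MvPowerSeries.C (HahnSeries.C (scalarFn (fun y : ℝ => (y : ℂ))
          Complex.ofRealCLM.contDiff)) * logVar p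
      + (sForm (fun j => divPow p j) * logVar p - sForm (fun j => c j • divPow p j)))

/-- The vertex operators `Γ^{σ a}`, `Γ^{σ b}` (`σ = ± 1`), applied to `τ`: multiplication by
`exp(σ · exponent)` after `exp(-σ ((ε/2) ∂_{s_0} + [z]_∂))`. -/
def vertex (ε : ℝ) (p : Kind) (σ : ℤ) (τ : TauSpace N) :
    MvPowerSeries Var1 (LaurentSeries (Fn N ℝ)) :=
  expS ((σ : ℂ) • vertexExponent ε p) *
    MvPowerSeries.rename (some : Time → Var1) (toLaurent (miwa ε (-σ)
      (MvPowerSeries.map (pull (fun y : ℝ => y - (σ : ℝ) * (ε / 2)) (by fun_prop)) τ)))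

/-- Series for the tensor product: power series in the variables `Var2`, over Laurent series in the
local parameter, over functions of `(x, s_0, s_0')`. They are the normally ordered symbols of
differential operators in `x` (derivations on the right). -/
abbrev TensorSpace (N : ℕ) : Type :=
  MvPowerSeries Var2 (LaurentSeries (Fn N (ℝ × ℝ × ℝ)))

/-- `exp(x ∂_{s_0})` on the first tensor factor. -/
def firstFactor (f : MvPowerSeries Var1 (LaurentSeries (Fn N ℝ))) : TensorSpace N :=
  MvPowerSeries.rename inFst
    (mapBase (pull (fun q : ℝ × ℝ × ℝ => q.2.1 + q.1) (by fun_prop)).toAddMonoidHom f)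

/-- `exp(x ∂_{s_0'})` on the second tensor factor. -/
def secondFactor (g : MvPowerSeries Var1 (LaurentSeries (Fn N ℝ))) : TensorSpace N :=
  MvPowerSeries.rename inSnd
    (mapBase (pull (fun q : ℝ × ℝ × ℝ => q.2.2 + q.1) (by fun_prop)).toAddMonoidHom g)

/-- `δ = ∑_{j > 0} (λ^j/j!) (s_j - s_j')` for type `a` and `δ = ∑_{j > 0} (λ^{-j}/j!) (s_j - s_j')`
for type `b`. -/
def delta (p : Kind) : TensorSpace N :=
  MvPowerSeries.rename inFst (sForm fun j => divPow p j)
    - MvPowerSeries.rename inSnd (sForm fun j => divPow p j)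

/-- The derivation `∂ = ∂/∂x`. -/
def dxT : TensorSpace N → TensorSpace N := mapBase (der ((1 : ℝ), (0 : ℝ), (0 : ℝ)))

/-- `(Γ^# ⊗ Γ)(f ⊗ g)`, where `Γ^# ⊗ Γ = exp(x ∂_{s_0}) exp(δ ∂) exp(x ∂_{s_0'})`: the symbol of the
differential operator `f(s_0 + x) ∘ exp(δ ∂) ∘ g(s_0' + x)`. Here `exp(δ ∂) ∘ G` is
`(∑_m δ^m ∂^m(G) / m!) exp(δ ∂)` by the Leibniz rule. -/
def sharp (p : Kind) (f g : MvPowerSeries Var1 (LaurentSeries (Fn N ℝ))) : TensorSpace N :=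
  firstFactor f *
    (translate dxT (delta p) (secondFactor g) * expS (delta p * MvPowerSeries.X Var2.del))

/-- `(Γ^# ⊗ Γ)(Γ^σ ⊗ Γ^{-σ})(τ ⊗ τ)` of type `p`, computed at `s_0 - s_0' = l ε`, as a
single-valued function of `λ`. The factor `λ^{± s_0/ε} λ^{∓ s_0'/ε}` contained in it, which is
`exp(± l log λ)` at `s_0 - s_0' = l ε`, is replaced by the integral power `λ^{± l}`. -/
def hirota (ε : ℝ) (p : Kind) (σ l : ℤ) (τ : TauSpace N) :
    MvPowerSeries Var2 (LaurentSeries (Fn N (ℝ × ℝ))) :=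
  MvPowerSeries.C (lamPow p (p.sgn * σ * l)) *
    expS (-((p.sgn * σ * l : ℤ) : ℂ) • MvPowerSeries.X Var2.log) *
    mapBase (pull (fun q : ℝ × ℝ => (q.1, q.2, q.2 - (l : ℝ) * ε)) (by fun_prop)).toAddMonoidHom
      (sharp p (vertex ε p σ τ) (vertex ε p (-σ) τ))

/-- The Hirota quadratic equations of the extended `Z_N`-Toda hierarchy:
`Res_λ λ^{r-1} (Γ_a^# ⊗ Γ_a)(Γ^a ⊗ Γ^{-a})(τ ⊗ τ) = Res_λ λ^{-r-1} (Γ_b^# ⊗ Γ_b)(Γ^{-b} ⊗ Γ^b)(τ ⊗ τ)`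
at `s_0 - s_0' = l ε`, for all integers `l` and all `r ≥ 0`. -/
def HirotaEquations (ε : ℝ) (τ : TauSpace N) : Prop :=
  ∀ (l : ℤ) (r : ℕ),
    resLam Kind.a (MvPowerSeries.C (lamPow Kind.a ((r : ℤ) - 1)) * hirota ε Kind.a 1 l τ) =
      resLam Kind.b (MvPowerSeries.C (lamPow Kind.b (-(r : ℤ) - 1)) * hirota ε Kind.b (-1) l τ)

/-- The equations `(dλ/λ) (Γ_a^# ⊗ Γ_a)(Γ^a ⊗ Γ^{-a} - Γ^{-a} ⊗ Γ^a)(τ ⊗ τ)` regular in `λ`, computed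
at `s_0 - s_0' = l ε`, for all integers `l`: no negative powers of `λ` occur, that is, no
coefficient at `z^n = λ^{-n}` with `n > 0` remains after multiplication with `λ⁻¹`. -/
def HirotaRegular (ε : ℝ) (τ : TauSpace N) : Prop :=
  ∀ (l : ℤ) (α : Var2 →₀ ℕ) (n : ℤ), 0 < n →
    (MvPowerSeries.coeff α (MvPowerSeries.C (lamPow Kind.a (-1)) *
      (hirota ε Kind.a 1 l τ - hirota ε Kind.a (-1) l τ))).coeff n = 0

end Vertex

end EZTH

end

noncomputable section

namespace EZTH

open scoped ContDiff

set_option linter.unusedSectionVars false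

/-! ## Exponentials of operators that raise the order -/

section ExpCalculus

variable {σ A : Type} [CommRing A] [Algebra ℂ A]

/-! Write `z` for the local parameter (`λ⁻¹` for type a, `λ` for type b). The proof turns the Hirota
expressions into products of wave operators.

Normal form. The operator `exp(δ ∂)` moves past the exponential of the second vertex operator by
replacing `∂` with `∂` plus a constant multiple of `log λ`. This produces a factor that cancels all
terms `s_j log λ` with `j ≥ 1`. The terms with `s_0` and `s_0'` combine to `l log λ` and cancel
against the factor compensating the power of `λ`. What remains (`hirota_eq`) depends on the sign `σ`
but not on the type. Hence both systems of equations say the same thing: for all `r ≥ 0` the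
coefficients of `z^r` for `σ = 1` and `σ = -1` agree. This settles the second equivalence.

Taylor expansion. Two series in `t, t', s, s'` agree once all their derivatives in the unprimed
times agree on the diagonal (`eq_iff_diag_fstDerivs`). On the diagonal, the `z^r`-coefficient of a
product of a left and a right symbol is a coefficient of the operator `A Λ^{σ r} B`. Differentiating
in an unprimed time replaces `A` by `waveDer v A`, the derivative of `A W` divided by `W`, where `W`
is the formal exponential of the flows (`zCoeff_diag_fstDerivs_hirotaForm`). Put `f = τ(s_0 + x -
ε/2)` and `g = τ(s_0 + x + ε/2)`. The Hirota equations at all `l` become equalities between the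
operators `∂_L (f S W) · W⁻¹ Λ^r S⁻¹ g` and their counterparts `∂_L (f S̄ W̄) · W̄⁻¹ Λ^{-r} S̄⁻¹ g`,
for all lists `L` of times and all `r ≥ 0`; the value of `l` selects the coefficient of `Λ^{-l}`.

Hierarchy. These bilinear identities are equivalent to the hierarchy (`isDressing_iff_bilinear`).
Without derivatives, `r = 0` equates a series `1 + O(Λ⁻¹)` with one in non-negative powers of `Λ`,
so both are `1` and the given right symbols are those of inverses; `r = 1` is the equality of the
two forms of the Lax operator. One derivative with `r = 0` is the evolution equation: the generators
`B_j`, `D_j` are differences of the flow conjugated by `S` and by `S̄`, and projecting to negative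
and non-negative powers separates the equations for `S` and `S̄`. The `s_0`-equation is automatic,
as everything depends on `s_0 + x` only. Conversely, the evolution equations give `∂_L (f S W) = Q S
W` and `∂_L (f S̄ W̄) = Q S̄ W̄` with the same `Q`, and the equality of the Lax operators gives all
identities. -/

theorem coeff_complex_smul (a : ℂ) (α : σ →₀ ℕ) (F : MvPowerSeries σ A) :
    MvPowerSeries.coeff α (a • F) = a • MvPowerSeries.coeff α F :=
  (MvPowerSeries.coeff (R := A) α).map_smul_of_tower a F

/-- The power series all of whose terms have degree at least `n`. -/
def orderGE (σ A : Type) [CommRing A] [Algebra ℂ A] (n : ℕ) :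
    Submodule ℂ (MvPowerSeries σ A) where
  carrier := {F | ∀ α : σ →₀ ℕ, α.degree < n → MvPowerSeries.coeff α F = 0}
  zero_mem' α _ := by simp
  add_mem' {F G} hF hG α h := by rw [map_add, hF α h, hG α h, add_zero]
  smul_mem' a F hF α h := by rw [coeff_complex_smul, hF α h, smul_zero]

theorem orderGE_zero : orderGE σ A 0 = ⊤ := by
  rw [eq_top_iff]
  intro F _ α h
  omega

theorem orderGE_anti {m n : ℕ} (h : m ≤ n) : orderGE σ A n ≤ orderGE σ A m :=
  fun _ hF α hα => hF α (by omega)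

theorem mul_mem_orderGE {m n : ℕ} {F G : MvPowerSeries σ A} (hF : F ∈ orderGE σ A m)
    (hG : G ∈ orderGE σ A n) : F * G ∈ orderGE σ A (m + n) := by
  classical
  intro α hα
  rw [MvPowerSeries.coeff_mul]
  refine Finset.sum_eq_zero fun p hp => ?_
  have h : p.1.degree + p.2.degree = α.degree := by
    rw [← map_add, Finset.HasAntidiagonal.mem_antidiagonal.mp hp]
  by_cases h1 : p.1.degree < m
  · rw [hF _ h1, zero_mul]
  · rw [hG _ (by omega), mul_zero]

/-- The order filtration is separated. Identities between infinite exponentials can therefore be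
checked modulo each order, where only finite sums occur. -/
theorem eq_of_forall_smodEq {F G : MvPowerSeries σ A}
    (h : ∀ M, F ≡ G [SMOD orderGE σ A M]) : F = G := by
  ext α
  have := SModEq.sub_mem.mp (h (α.degree + 1)) α (by omega)
  rwa [map_sub, sub_eq_zero] at this

/-- The operator raises the order. -/
def Raises (Φ : Module.End ℂ (MvPowerSeries σ A)) : Prop :=
  ∀ n F, F ∈ orderGE σ A n → Φ F ∈ orderGE σ A (n + 1)

theorem Raises.add {Φ Ψ : Module.End ℂ (MvPowerSeries σ A)} (hΦ : Raises Φ) (hΨ : Raises Ψ) :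
    Raises (Φ + Ψ) := fun n F hF => add_mem (hΦ n F hF) (hΨ n F hF)

theorem Raises.pow_mem {Φ : Module.End ℂ (MvPowerSeries σ A)} (hΦ : Raises Φ) (m n : ℕ)
    {F : MvPowerSeries σ A} (hF : F ∈ orderGE σ A n) : (Φ ^ m) F ∈ orderGE σ A (n + m) := by
  induction m with
  | zero => simpa using hF
  | succ m ih =>
    rw [pow_succ', Module.End.mul_apply]
    exact hΦ _ _ ih

/-- `∑_m Φ^m / m!` for an operator `Φ` that raises the order. -/
def expOp (Φ : Module.End ℂ (MvPowerSeries σ A)) (B : MvPowerSeries σ A) : MvPowerSeries σ A :=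
  fun α => ∑ m ∈ Finset.range (α.degree + 1),
    ((1 : ℂ) / (m.factorial : ℂ)) • MvPowerSeries.coeff α ((Φ ^ m) B)

/-- The partial sums of `expOp`. -/
def expPartial (Φ : Module.End ℂ (MvPowerSeries σ A)) (M : ℕ) :
    Module.End ℂ (MvPowerSeries σ A) :=
  ∑ m ∈ Finset.range M, ((1 : ℂ) / (m.factorial : ℂ)) • Φ ^ m

theorem expPartial_apply (Φ : Module.End ℂ (MvPowerSeries σ A)) (M : ℕ) (B : MvPowerSeries σ A) :
    expPartial Φ M B = ∑ m ∈ Finset.range M, ((1 : ℂ) / (m.factorial : ℂ)) • (Φ ^ m) B := by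
  simp [expPartial, LinearMap.sum_apply]

/-- The summand `Φ^m B / m!` has order at least `m`, so truncating the exponential at `M` terms is
harmless modulo order `M`. -/
theorem expOp_smodEq {Φ : Module.End ℂ (MvPowerSeries σ A)} (hΦ : Raises Φ) (M : ℕ)
    (B : MvPowerSeries σ A) : expOp Φ B ≡ expPartial Φ M B [SMOD orderGE σ A M] := by
  rw [SModEq.sub_mem]
  intro α hα
  rw [map_sub, sub_eq_zero, expPartial_apply, map_sum]
  simp only [coeff_complex_smul]
  refine Finset.sum_subset (Finset.range_mono hα) fun m _ hm => ?_
  rw [Finset.mem_range] at hm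
  have : (Φ ^ m) B ∈ orderGE σ A (0 + m) := hΦ.pow_mem m 0 (by rw [orderGE_zero]; trivial)
  rw [this α (by omega), smul_zero]

theorem expPartial_congr {Φ : Module.End ℂ (MvPowerSeries σ A)} (hΦ : Raises Φ) (M n : ℕ)
    {F G : MvPowerSeries σ A} (h : F ≡ G [SMOD orderGE σ A n]) :
    expPartial Φ M F ≡ expPartial Φ M G [SMOD orderGE σ A n] := by
  rw [SModEq.sub_mem, ← map_sub, expPartial_apply]
  exact sum_mem fun m _ => Submodule.smul_mem _ _
    (orderGE_anti (by omega) (hΦ.pow_mem m n (SModEq.sub_mem.mp h)))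

/-- Modulo order `M`, the product of the truncated exponentials is a sum over a square of exponents,
and the binomial theorem writes the truncated exponential of the sum over the triangle below the
antidiagonal. The other pairs contribute only terms of order at least `M`. -/
theorem expOp_add {Φ Ψ : Module.End ℂ (MvPowerSeries σ A)} (hΦ : Raises Φ) (hΨ : Raises Ψ)
    (hc : Commute Φ Ψ) (B : MvPowerSeries σ A) :
    expOp (Φ + Ψ) B = expOp Φ (expOp Ψ B) := by
  refine eq_of_forall_smodEq fun M => ?_
  refine (expOp_smodEq (hΦ.add hΨ) M B).trans (SModEq.trans ?_ (expOp_smodEq hΦ M _).symm)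
  refine SModEq.trans ?_ (expPartial_congr hΦ M M (expOp_smodEq hΨ M B)).symm
  have h1 : expPartial Φ M (expPartial Ψ M B) = ∑ p ∈ Finset.range M ×ˢ Finset.range M,
      ((1 : ℂ) / (p.1.factorial : ℂ) * (1 / (p.2.factorial : ℂ))) • (Φ ^ p.1) ((Ψ ^ p.2) B) := by
    rw [expPartial_apply, Finset.sum_product]
    refine Finset.sum_congr rfl fun i _ => ?_
    rw [expPartial_apply, map_sum, Finset.smul_sum]
    refine Finset.sum_congr rfl fun j _ => ?_
    rw [map_smul, smul_smul]
  have h2 : expPartial (Φ + Ψ) M B =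
      ∑ p ∈ (Finset.range M ×ˢ Finset.range M).filter (fun p => p.1 + p.2 < M),
      ((1 : ℂ) / (p.1.factorial : ℂ) * (1 / (p.2.factorial : ℂ))) • (Φ ^ p.1) ((Ψ ^ p.2) B) := by
    rw [expPartial_apply]
    have : ∀ m, ((1 : ℂ) / (m.factorial : ℂ)) • ((Φ + Ψ) ^ m) B =
        ∑ p ∈ Finset.HasAntidiagonal.antidiagonal m,
          ((1 : ℂ) / (p.1.factorial : ℂ) * (1 / (p.2.factorial : ℂ))) •
            (Φ ^ p.1) ((Ψ ^ p.2) B) := by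
      intro m
      rw [hc.add_pow', LinearMap.sum_apply, Finset.smul_sum]
      refine Finset.sum_congr rfl fun p hp => ?_
      rw [LinearMap.smul_apply, Module.End.mul_apply, ← Nat.cast_smul_eq_nsmul ℂ, smul_smul]
      congr 1
      have hp' := Finset.HasAntidiagonal.mem_antidiagonal.mp hp
      subst hp'
      rw [Nat.cast_add_choose]
      have h0 : ((p.1 + p.2).factorial : ℂ) ≠ 0 := by exact_mod_cast Nat.factorial_ne_zero _
      have h1 : (p.1.factorial : ℂ) ≠ 0 := by exact_mod_cast Nat.factorial_ne_zero _
      have h2 : (p.2.factorial : ℂ) ≠ 0 := by exact_mod_cast Nat.factorial_ne_zero _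
      field_simp
    simp only [this]
    rw [Finset.sum_sigma']
    refine Finset.sum_bij' (fun x _ => x.2) (fun p _ => ⟨p.1 + p.2, p⟩) ?_ ?_ ?_ ?_ ?_
    · rintro ⟨m, p⟩ h
      simp only [Finset.mem_sigma, Finset.mem_range, Finset.HasAntidiagonal.mem_antidiagonal] at h
      simp only [Finset.mem_filter, Finset.mem_product, Finset.mem_range]
      omega
    · rintro p h
      simp only [Finset.mem_filter, Finset.mem_product, Finset.mem_range] at h
      simp [h.2]
    · rintro ⟨m, p⟩ h
      simp only [Finset.mem_sigma, Finset.mem_range, Finset.HasAntidiagonal.mem_antidiagonal] at h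
      obtain ⟨h, rfl⟩ := h
      rfl
    · intros; rfl
    · intros; rfl
  rw [h1, h2, ← Finset.sum_filter_add_sum_filter_not (Finset.range M ×ˢ Finset.range M)
    (fun p => p.1 + p.2 < M), SModEq.sub_mem, sub_add_cancel_left, neg_mem_iff]
  refine sum_mem fun p hp => Submodule.smul_mem _ _ ?_
  have hB : B ∈ orderGE σ A 0 := by rw [orderGE_zero]; trivial
  rw [Finset.mem_filter] at hp
  exact orderGE_anti (by omega) (hΦ.pow_mem p.1 _ (hΨ.pow_mem p.2 0 hB))

/-- The derivative of an exponential, for an operator whose commutator with the exponent commutes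
with the exponent. -/
theorem lin_expOp {Φ Ψ d : Module.End ℂ (MvPowerSeries σ A)} (hΦ : Raises Φ)
    (hd : ∀ n F, F ∈ orderGE σ A (n + 1) → d F ∈ orderGE σ A n)
    (hΨ : ∀ n F, F ∈ orderGE σ A n → Ψ F ∈ orderGE σ A n)
    (hc : d * Φ = Φ * d + Ψ) (hcomm : Commute Φ Ψ) (B : MvPowerSeries σ A) :
    d (expOp Φ B) = expOp Φ (d B) + Ψ (expOp Φ B) := by
  -- `Ψ` is the commutator of `d` and `Φ` and commutes with `Φ`, so the usual power rule holds.
  have hpow : ∀ m : ℕ, d * Φ ^ (m + 1) = Φ ^ (m + 1) * d + (m + 1 : ℂ) • (Ψ * Φ ^ m) := by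
    intro m
    induction m with
    | zero => simp [hc]
    | succ m ih =>
      have h : Φ ^ (m + 1) * Ψ = Ψ * Φ ^ (m + 1) := (hcomm.pow_left (m + 1)).eq
      calc d * Φ ^ (m + 1 + 1) = (d * Φ ^ (m + 1)) * Φ := by rw [pow_succ _ (m + 1), mul_assoc]
        _ = Φ ^ (m + 1) * (Φ * d) + Φ ^ (m + 1) * Ψ + (m + 1 : ℂ) • (Ψ * Φ ^ (m + 1)) := by
          rw [ih, add_mul, mul_assoc, hc, mul_add, smul_mul_assoc, mul_assoc, ← pow_succ]
        _ = _ := by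
          rw [h, ← mul_assoc, ← pow_succ]
          push_cast
          simp only [add_smul, one_smul]
          abel
  refine eq_of_forall_smodEq fun M => ?_
  -- One more term is kept, because `d` may lower the order by one.
  have h1 : d (expOp Φ B) ≡ d (expPartial Φ (M + 1) B) [SMOD orderGE σ A M] := by
    rw [SModEq.sub_mem, ← map_sub]
    exact hd M _ (SModEq.sub_mem.mp (expOp_smodEq hΦ (M + 1) B))
  have h2 : Ψ (expOp Φ B) ≡ Ψ (expPartial Φ M B) [SMOD orderGE σ A M] := by
    rw [SModEq.sub_mem, ← map_sub]
    exact hΨ M _ (SModEq.sub_mem.mp (expOp_smodEq hΦ M B))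
  have h3 : expOp Φ (d B) ≡ expPartial Φ (M + 1) (d B) [SMOD orderGE σ A M] :=
    (expOp_smodEq hΦ (M + 1) (d B)).mono (orderGE_anti (by omega))
  have h4 : d (expPartial Φ (M + 1) B) = expPartial Φ (M + 1) (d B) + Ψ (expPartial Φ M B) := by
    simp only [expPartial_apply, map_sum, map_smul]
    rw [Finset.sum_range_succ', Finset.sum_range_succ' _ M]
    have : ∀ m, (1 / ((m + 1).factorial : ℂ)) • d ((Φ ^ (m + 1)) B) =
        (1 / ((m + 1).factorial : ℂ)) • (Φ ^ (m + 1)) (d B) +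
          (1 / (m.factorial : ℂ)) • Ψ ((Φ ^ m) B) := by
      intro m
      have := congrArg (fun L => L B) (hpow m)
      simp only [Module.End.mul_apply, LinearMap.add_apply, LinearMap.smul_apply] at this
      rw [this, smul_add, smul_smul]
      congr 2
      have h1 : (m.factorial : ℂ) ≠ 0 := by exact_mod_cast Nat.factorial_ne_zero _
      have h2 : (m + 1 : ℂ) ≠ 0 := by exact_mod_cast Nat.succ_ne_zero m
      rw [Nat.factorial_succ]
      push_cast
      field_simp
    simp only [this, Finset.sum_add_distrib]
    simp only [pow_zero, Module.End.one_apply]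
    abel
  refine h1.trans ?_
  rw [h4]
  exact (h3.add h2).symm

/-- Multiplication by a power series. -/
def mulOp (F : MvPowerSeries σ A) : Module.End ℂ (MvPowerSeries σ A) := LinearMap.mulLeft ℂ F

@[simp]
theorem mulOp_apply (F G : MvPowerSeries σ A) : mulOp F G = F * G := rfl

theorem mulOp_add (F G : MvPowerSeries σ A) : mulOp (F + G) = mulOp F + mulOp G :=
  LinearMap.ext fun H => by simp [add_mul]

theorem commute_mulOp (F G : MvPowerSeries σ A) : Commute (mulOp F) (mulOp G) :=
  LinearMap.ext fun H => by simp [Module.End.mul_apply, mul_left_comm]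

theorem mulOp_pow_apply (F G : MvPowerSeries σ A) (m : ℕ) : (mulOp F ^ m) G = F ^ m * G := by
  induction m with
  | zero => simp
  | succ m ih => rw [pow_succ', Module.End.mul_apply, ih, mulOp_apply, pow_succ', mul_assoc]

theorem raises_mulOp {F : MvPowerSeries σ A} (hF : F ∈ orderGE σ A 1) : Raises (mulOp F) :=
  fun n G hG => by rw [add_comm]; exact mul_mem_orderGE hF hG

theorem expS_eq_expOp (F : MvPowerSeries σ A) : expS F = expOp (mulOp F) 1 := by
  funext α
  simp [expS, expOp, mulOp_pow_apply]

theorem expOp_mulOp {F : MvPowerSeries σ A} (hF : F ∈ orderGE σ A 1) (B : MvPowerSeries σ A) :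
    expOp (mulOp F) B = expS F * B := by
  refine eq_of_forall_smodEq fun M => (expOp_smodEq (raises_mulOp hF) M B).trans ?_
  have h := expOp_smodEq (raises_mulOp hF) M 1
  have h2 : expPartial (mulOp F) M B = expPartial (mulOp F) M 1 * B := by
    simp only [expPartial_apply, mulOp_pow_apply, Finset.sum_mul, mul_one, smul_mul_assoc]
  rw [h2, expS_eq_expOp, SModEq.sub_mem, ← sub_mul]
  simpa using mul_mem_orderGE (SModEq.sub_mem.mp h.symm)
    (show B ∈ orderGE σ A 0 by rw [orderGE_zero]; trivial)

theorem expS_add {F G : MvPowerSeries σ A} (hF : F ∈ orderGE σ A 1) (hG : G ∈ orderGE σ A 1) :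
    expS (F + G) = expS F * expS G := by
  rw [expS_eq_expOp (F + G), mulOp_add,
    expOp_add (raises_mulOp hF) (raises_mulOp hG) (commute_mulOp F G), expOp_mulOp hF,
    expS_eq_expOp G]

theorem expS_zero : expS (0 : MvPowerSeries σ A) = 1 := by
  have h : (0 : MvPowerSeries σ A) ∈ orderGE σ A 1 := zero_mem _
  have h1 := expOp_smodEq (raises_mulOp h)
  refine eq_of_forall_smodEq fun M => ?_
  rw [expS_eq_expOp]
  refine (((h1 (M + 1) 1).mono (orderGE_anti (by omega))).trans ?_)
  rw [expPartial_apply, Finset.sum_range_succ']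
  simp [mulOp_pow_apply]

variable {σ' A' : Type} [CommRing A'] [Algebra ℂ A']

/-- Additive maps that preserve the degree commute with exponentials. -/
theorem map_expOp (φ : MvPowerSeries σ A →ₗ[ℂ] MvPowerSeries σ' A')
    (hφ : ∀ n F, F ∈ orderGE σ A n → φ F ∈ orderGE σ' A' n)
    {Φ : Module.End ℂ (MvPowerSeries σ A)} (hΦ : Raises Φ)
    {Ψ : Module.End ℂ (MvPowerSeries σ' A')} (hΨ : Raises Ψ)
    (h : ∀ F, φ (Φ F) = Ψ (φ F)) (B : MvPowerSeries σ A) :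
    φ (expOp Φ B) = expOp Ψ (φ B) := by
  have hpow : ∀ m, φ ((Φ ^ m) B) = (Ψ ^ m) (φ B) := by
    intro m
    induction m with
    | zero => simp
    | succ m ih => rw [pow_succ', Module.End.mul_apply, h, ih, pow_succ', Module.End.mul_apply]
  refine eq_of_forall_smodEq fun M => SModEq.trans ?_ (expOp_smodEq hΨ M _).symm
  have h1 : φ (expPartial Φ M B) = expPartial Ψ M (φ B) := by
    simp only [expPartial_apply, map_sum, map_smul, hpow]
  rw [← h1, SModEq.sub_mem, ← map_sub]
  exact hφ M _ (SModEq.sub_mem.mp (expOp_smodEq hΦ M B))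

theorem map_expS (φ : MvPowerSeries σ A →ₗ[ℂ] MvPowerSeries σ' A')
    (hφ : ∀ n F, F ∈ orderGE σ A n → φ F ∈ orderGE σ' A' n) (h1 : φ 1 = 1)
    (hmul : ∀ F G, φ (F * G) = φ F * φ G) {F : MvPowerSeries σ A} (hF : F ∈ orderGE σ A 1) :
    φ (expS F) = expS (φ F) := by
  rw [expS_eq_expOp, expS_eq_expOp, map_expOp φ hφ (raises_mulOp hF)
    (raises_mulOp (hφ 1 F hF)) (fun G => hmul F G), h1]

/-! ### Translates -/

/-- The operator preserves the order. -/
def PreservesOrder (d : Module.End ℂ (MvPowerSeries σ A)) : Prop :=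
  ∀ n F, F ∈ orderGE σ A n → d F ∈ orderGE σ A n

theorem translate_eq_expOp {d : Module.End ℂ (MvPowerSeries σ A)} {δ : MvPowerSeries σ A}
    (hd : ∀ F, d (δ * F) = δ * d F) (B : MvPowerSeries σ A) :
    translate d δ B = expOp (mulOp δ * d) B := by
  have hpow : ∀ m, ((mulOp δ * d) ^ m) B = δ ^ m * d^[m] B := by
    intro m
    have hdm : ∀ k F, d (δ ^ k * F) = δ ^ k * d F := by
      intro k F
      induction k generalizing F with
      | zero => simp
      | succ k ih => rw [pow_succ', mul_assoc, hd, ih, mul_assoc]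
    induction m with
    | zero => simp
    | succ m ih =>
      rw [pow_succ', Module.End.mul_apply, ih, Module.End.mul_apply, hdm,
        Function.iterate_succ_apply', mulOp_apply, pow_succ', mul_assoc]
  funext α
  simp only [translate, expOp, hpow]

theorem raises_mulOp_mul {d : Module.End ℂ (MvPowerSeries σ A)} {δ : MvPowerSeries σ A}
    (hδ : δ ∈ orderGE σ A 1) (hd : PreservesOrder d) : Raises (mulOp δ * d) :=
  fun n F hF => raises_mulOp hδ n _ (hd n F hF)

/-- `exp(δ (d + w)) B = exp(δ w) exp(δ d) B` if `d` commutes with `δ` and `w`. -/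
theorem translate_add_mulOp {d : Module.End ℂ (MvPowerSeries σ A)} {δ w : MvPowerSeries σ A}
    (hδ : δ ∈ orderGE σ A 1) (hd : PreservesOrder d)
    (hdδ : ∀ F, d (δ * F) = δ * d F) (hdw : ∀ F, d (w * F) = w * d F) (B : MvPowerSeries σ A) :
    translate (d + mulOp w) δ B = expS (δ * w) * translate d δ B := by
  have hw : δ * w ∈ orderGE σ A 1 := by
    simpa using mul_mem_orderGE hδ (show w ∈ orderGE σ A 0 by rw [orderGE_zero]; trivial)
  have hd' : ∀ F, (d + mulOp w) (δ * F) = δ * (d + mulOp w) F := fun F => by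
    simp [hdδ, mul_add, mul_left_comm]
  have h : mulOp δ * (d + mulOp w) = mulOp (δ * w) + mulOp δ * d := by
    refine LinearMap.ext fun F => ?_
    simp [Module.End.mul_apply, mul_add, mul_assoc, add_comm]
  rw [translate_eq_expOp hd', translate_eq_expOp hdδ, ← expOp_mulOp hw, h]
  refine expOp_add (raises_mulOp hw) (raises_mulOp_mul hδ hd) (LinearMap.ext fun F => ?_) B
  simp [Module.End.mul_apply, mul_assoc, hdδ, hdw, mul_left_comm]

/-- `exp(δ d) (u B) = u exp(δ (d + w)) B` if `d (u B) = u (d + w) B`. -/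
theorem translate_mul_left {d d' : Module.End ℂ (MvPowerSeries σ A)}
    {δ u : MvPowerSeries σ A} (h : ∀ F, d (u * F) = u * d' F) (hδ : δ ∈ orderGE σ A 1)
    (hd : PreservesOrder d) (hd' : PreservesOrder d') (hdδ : ∀ F, d (δ * F) = δ * d F)
    (hd'δ : ∀ F, d' (δ * F) = δ * d' F) (B : MvPowerSeries σ A) :
    translate d δ (u * B) = u * translate d' δ B := by
  rw [translate_eq_expOp hdδ, translate_eq_expOp hd'δ]
  refine (map_expOp (mulOp u) (fun n F hF => ?_) (raises_mulOp_mul hδ hd')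
    (raises_mulOp_mul hδ hd) (fun F => ?_) B).symm
  · simpa using mul_mem_orderGE (show u ∈ orderGE σ A 0 by rw [orderGE_zero]; trivial) hF
  · simp [Module.End.mul_apply, h, mul_left_comm]

end ExpCalculus

/-! ## Derivations and substitutions -/

section Smooth

variable {N : ℕ} {V W : Type} [NormedAddCommGroup V] [NormedSpace ℝ V]
  [NormedAddCommGroup W] [NormedSpace ℝ W]

theorem Fn.ext_entries {f g : Fn N V} (h : ∀ x i j, f.1 x i j = g.1 x i j) : f = g :=
  Subtype.ext (funext fun x => Matrix.ext fun i j => h x i j)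

theorem Fn.hasFDerivAt (f : Fn N V) (x : V) (i j : Fin N) :
    HasFDerivAt (fun y => f.1 y i j) (fderiv ℝ (fun y => f.1 y i j) x) x :=
  ((f.2.2 i j).differentiable (by simp) x).hasFDerivAt

theorem der_mul (v : V) (f g : Fn N V) : der v (f * g) = der v f * g + f * der v g := by
  refine Fn.ext_entries fun x i j => ?_
  have h : HasFDerivAt (fun y => ∑ k, f.1 y i k * g.1 y k j) _ x :=
    HasFDerivAt.fun_sum fun k _ => (f.hasFDerivAt x i k).mul (g.hasFDerivAt x k j)
  change fderiv ℝ (fun y => ∑ k, f.1 y i k * g.1 y k j) x v =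
    (∑ k, fderiv ℝ (fun y => f.1 y i k) x v * g.1 x k j) +
      ∑ k, f.1 x i k * fderiv ℝ (fun y => g.1 y k j) x v
  rw [h.fderiv]
  simp only [sum_apply, add_apply, smul_apply, smul_eq_mul, ← Finset.sum_add_distrib]
  exact Finset.sum_congr rfl fun k _ => by ring

theorem der_algebraMap (v : V) (a : ℂ) : der v (algebraMap ℂ (Fn N V) a) = 0 := by
  refine Fn.ext_entries fun x i j => ?_
  change fderiv ℝ (fun _ : V => (algebraMap ℂ (Matrix (Fin N) (Fin N) ℂ) a) i j) x v = 0
  simp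

theorem der_smul (v : V) (a : ℂ) (f : Fn N V) : der v (a • f) = a • der v f := by
  rw [Algebra.smul_def, der_mul, der_algebraMap, zero_mul, zero_add, ← Algebra.smul_def]

/-- The chain rule for maps whose differential carries `v` to one fixed vector `w`, such as affine
maps. -/
theorem der_pull (g : V → W) (hg : ContDiff ℝ ∞ g) (v : V) (w : W)
    (h : ∀ x, fderiv ℝ g x v = w) (f : Fn N W) :
    der v (pull g hg f) = pull g hg (der w f) := by
  refine Fn.ext_entries fun x i j => ?_
  change fderiv ℝ (fun y => f.1 (g y) i j) x v = fderiv ℝ (fun y => f.1 y i j) (g x) w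
  have hc := (f.hasFDerivAt (g x) i j).comp x (hg.differentiable (by simp) x).hasFDerivAt
  have h' : fderiv ℝ (fun y => f.1 (g y) i j) x = _ := hc.fderiv
  rw [h', ContinuousLinearMap.comp_apply, h]

/-- `pull` as a homomorphism of algebras. -/
def pullHom (g : V → W) (hg : ContDiff ℝ ∞ g) : Fn N W →ₐ[ℂ] Fn N V :=
  { pull g hg with commutes' := fun _ => rfl }

/-- `der` as a linear map. -/
def derLin (v : V) : Fn N V →ₗ[ℂ] Fn N V :=
  { der v with map_smul' := der_smul v }

end Smooth

/-! ## Laurent series and power series over them -/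

section Laurent

variable {σ σ' A B : Type} [CommRing A] [Algebra ℂ A] [CommRing B] [Algebra ℂ B]

theorem laurent_coeff_smul (a : ℂ) (x : LaurentSeries A) (n : ℤ) :
    (a • x).coeff n = a • x.coeff n := rfl

theorem laurent_coeff_map (φ : A →+ B) (x : LaurentSeries A) (n : ℤ) :
    (x.map φ).coeff n = φ (x.coeff n) := rfl

/-- The Cauchy product is taken over an interval that depends only on lower bounds of the supports.
These bounds persist under additive maps, whereas the supports may shrink. -/
theorem laurent_coeff_mul {x y : LaurentSeries A} {a b : ℤ} (hx : ∀ i < a, x.coeff i = 0)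
    (hy : ∀ i < b, y.coeff i = 0) (n : ℤ) :
    (x * y).coeff n = ∑ i ∈ Finset.Icc a (n - b), x.coeff i * y.coeff (n - i) := by
  rw [HahnSeries.coeff_mul]
  have h1 : ∑ i ∈ Finset.Icc a (n - b), x.coeff i * y.coeff (n - i) =
      ∑ p ∈ (Finset.Icc a (n - b)).image (fun i => (i, n - i)), x.coeff p.1 * y.coeff p.2 := by
    rw [Finset.sum_image (by intro i _ j _ h; exact (Prod.mk.inj h).1)]
  rw [h1]
  refine Finset.sum_subset (fun p hp => ?_) (fun p hp hp' => ?_)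
  · rw [Finset.mem_antidiagonal] at hp
    obtain ⟨h1, h2, h3⟩ := hp
    rw [HahnSeries.mem_support] at h1 h2
    rw [Finset.mem_image]
    refine ⟨p.1, ?_, Prod.ext rfl (by simp only; omega)⟩
    rw [Finset.mem_Icc]
    constructor
    · by_contra h; exact h1 (hx _ (by omega))
    · by_contra h; exact h2 (hy _ (by omega))
  · rw [Finset.mem_image] at hp
    obtain ⟨i, _, rfl⟩ := hp
    simp only [Finset.mem_antidiagonal, HahnSeries.mem_support] at hp'
    by_cases h : x.coeff i = 0
    · simp [h]
    · have : y.coeff (n - i) = 0 := by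
        by_contra h'
        exact hp' ⟨h, h', by omega⟩
      simp [this]

theorem exists_laurent_bound (x : LaurentSeries A) : ∃ a : ℤ, ∀ i < a, x.coeff i = 0 :=
  ⟨x.order, fun _ h => HahnSeries.coeff_eq_zero_of_lt_order h⟩

/-- The form with four auxiliary maps treats homomorphisms (`d₃ = d₄ = 0`) and derivations (Leibniz
rule, with two of the maps the identity) at once. -/
theorem laurent_map_mul {d₁ d₂ d₃ d₄ d : A →+ B} (h : ∀ x y, d (x * y) = d₁ x * d₂ y + d₃ x * d₄ y)
    (x y : LaurentSeries A) : (x * y).map d = x.map d₁ * y.map d₂ + x.map d₃ * y.map d₄ := by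
  obtain ⟨a, ha⟩ := exists_laurent_bound x
  obtain ⟨b, hb⟩ := exists_laurent_bound y
  have hm : ∀ (e : A →+ B) (c : ℤ) (z : LaurentSeries A), (∀ i < c, z.coeff i = 0) →
      ∀ i < c, (z.map e).coeff i = 0 := fun e c z hz i hi => by
    rw [laurent_coeff_map, hz i hi, map_zero]
  ext n
  rw [laurent_coeff_map, laurent_coeff_mul ha hb, HahnSeries.coeff_add,
    laurent_coeff_mul (hm d₁ a x ha) (hm d₂ b y hb),
    laurent_coeff_mul (hm d₃ a x ha) (hm d₄ b y hb), map_sum, ← Finset.sum_add_distrib]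
  exact Finset.sum_congr rfl fun i _ => h _ _

theorem mapBase_mul_of {d₁ d₂ d₃ d₄ d : A →+ B}
    (h : ∀ x y, d (x * y) = d₁ x * d₂ y + d₃ x * d₄ y) (F G : MvPowerSeries σ (LaurentSeries A)) :
    mapBase d (F * G) = mapBase d₁ F * mapBase d₂ G + mapBase d₃ F * mapBase d₄ G := by
  classical
  have hadd : ∀ x y : LaurentSeries A, (x + y).map d = x.map d + y.map d :=
    fun x y => HahnSeries.map_add d
  let D : LaurentSeries A →+ LaurentSeries B :=
    { toFun := fun x => x.map d, map_zero' := HahnSeries.map_zero (d : ZeroHom A B),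
      map_add' := hadd }
  ext1 α
  rw [map_add, MvPowerSeries.coeff_mul, MvPowerSeries.coeff_mul, ← Finset.sum_add_distrib]
  change D (MvPowerSeries.coeff α (F * G)) = _
  rw [MvPowerSeries.coeff_mul, map_sum]
  exact Finset.sum_congr rfl fun p _ => laurent_map_mul h _ _

/-- `mapBase` as a linear map. -/
def mapBaseLin (φ : A →ₗ[ℂ] B) :
    MvPowerSeries σ (LaurentSeries A) →ₗ[ℂ] MvPowerSeries σ (LaurentSeries B) where
  toFun := mapBase φ.toAddMonoidHom
  map_add' F G := by
    ext1 α
    exact HahnSeries.map_add φ.toAddMonoidHom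
  map_smul' a F := by
    ext1 α
    ext n
    change φ ((MvPowerSeries.coeff α (a • F)).coeff n) =
      (MvPowerSeries.coeff α (a • mapBase φ.toAddMonoidHom F)).coeff n
    rw [coeff_complex_smul, laurent_coeff_smul, map_smul, coeff_complex_smul]
    rfl

/-- `mapBase` for a homomorphism of algebras. -/
def mapBaseHom (φ : A →ₐ[ℂ] B) :
    MvPowerSeries σ (LaurentSeries A) →ₐ[ℂ] MvPowerSeries σ (LaurentSeries B) :=
  AlgHom.ofLinearMap (mapBaseLin φ.toLinearMap)
    (by
      classical
      ext α n
      change φ ((MvPowerSeries.coeff α (1 : MvPowerSeries σ (LaurentSeries A))).coeff n) =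
        (MvPowerSeries.coeff α (1 : MvPowerSeries σ (LaurentSeries B))).coeff n
      rw [MvPowerSeries.coeff_one, MvPowerSeries.coeff_one]
      split_ifs
      · rw [HahnSeries.coeff_one, HahnSeries.coeff_one]
        split_ifs <;> simp
      · simp)
    (fun F G => by
      have := mapBase_mul_of (d := φ.toLinearMap.toAddMonoidHom)
        (d₁ := φ.toLinearMap.toAddMonoidHom) (d₂ := φ.toLinearMap.toAddMonoidHom)
        (d₃ := 0) (d₄ := 0) (fun x y => by simp) F G
      refine this.trans ?_
      have h0 : mapBase (0 : A →+ B) F = 0 := by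
        ext α n; rfl
      rw [h0, zero_mul, add_zero]
      rfl)

/-- The coefficient of `z^n` of all coefficients. -/
def zCoeffFun (n : ℤ) (F : MvPowerSeries σ (LaurentSeries A)) : MvPowerSeries σ A :=
  fun α => (MvPowerSeries.coeff α F).coeff n

/-- The coefficient of `z^n` of all coefficients, as a linear map. -/
def zCoeff (n : ℤ) : MvPowerSeries σ (LaurentSeries A) →ₗ[ℂ] MvPowerSeries σ A where
  toFun := zCoeffFun n
  map_add' _ _ := rfl
  map_smul' a F := by
    ext1 α
    change (MvPowerSeries.coeff α (a • F)).coeff n = MvPowerSeries.coeff α (a • zCoeffFun n F)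
    rw [coeff_complex_smul, coeff_complex_smul]
    rfl

theorem coeff_zCoeff (n : ℤ) (F : MvPowerSeries σ (LaurentSeries A)) (α : σ →₀ ℕ) :
    MvPowerSeries.coeff α (zCoeff n F) = (MvPowerSeries.coeff α F).coeff n := rfl

theorem zCoeff_ext {F G : MvPowerSeries σ (LaurentSeries A)} (h : ∀ n, zCoeff n F = zCoeff n G) :
    F = G := by
  ext α n
  rw [← coeff_zCoeff, h, coeff_zCoeff]

theorem zCoeff_rename (f : σ → σ') [Filter.TendstoCofinite f] (n : ℤ)
    (F : MvPowerSeries σ (LaurentSeries A)) :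
    zCoeff n (MvPowerSeries.rename f F) = MvPowerSeries.rename f (zCoeff n F) := by
  ext α
  rw [coeff_zCoeff, MvPowerSeries.coeff_rename, MvPowerSeries.coeff_rename, HahnSeries.coeff_sum]
  rfl

theorem zCoeff_pderiv (i : σ) (n : ℤ) (F : MvPowerSeries σ (LaurentSeries A)) :
    zCoeff n (MvPowerSeries.pderiv _ i F) = MvPowerSeries.pderiv _ i (zCoeff n F) := by
  ext α
  rw [coeff_zCoeff, MvPowerSeries.coeff_pderiv, MvPowerSeries.coeff_pderiv, coeff_zCoeff,
    ← Nat.cast_succ, ← Nat.cast_succ, ← nsmul_eq_mul', ← nsmul_eq_mul', HahnSeries.coeff_nsmul]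
  rfl

theorem zCoeff_mul {F G : MvPowerSeries σ (LaurentSeries A)} {a b : ℤ}
    (hF : ∀ i < a, zCoeff i F = 0) (hG : ∀ i < b, zCoeff i G = 0) (n : ℤ) :
    zCoeff n (F * G) = ∑ i ∈ Finset.Icc a (n - b), zCoeff i F * zCoeff (n - i) G := by
  classical
  ext α
  rw [coeff_zCoeff, MvPowerSeries.coeff_mul, HahnSeries.coeff_sum, map_sum]
  simp only [MvPowerSeries.coeff_mul]
  rw [Finset.sum_comm]
  refine Finset.sum_congr rfl fun p _ => ?_
  refine laurent_coeff_mul (fun i hi => ?_) (fun i hi => ?_) n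
  · rw [← coeff_zCoeff, hF i hi, map_zero]
  · rw [← coeff_zCoeff, hG i hi, map_zero]

theorem zCoeff_C_single_mul (k : ℤ) (r : A) (n : ℤ) (F : MvPowerSeries σ (LaurentSeries A)) :
    zCoeff n (MvPowerSeries.C (HahnSeries.single k r) * F) =
      MvPowerSeries.C r * zCoeff (n - k) F := by
  ext α
  rw [coeff_zCoeff, MvPowerSeries.coeff_C_mul, MvPowerSeries.coeff_C_mul, coeff_zCoeff,
    HahnSeries.coeff_single_mul]

theorem zCoeff_X_mul (i : σ) (n : ℤ) (F : MvPowerSeries σ (LaurentSeries A)) :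
    zCoeff n (MvPowerSeries.X i * F) = MvPowerSeries.X i * zCoeff n F := by
  classical
  ext α
  rw [coeff_zCoeff, MvPowerSeries.X, MvPowerSeries.X, MvPowerSeries.coeff_monomial_mul,
    MvPowerSeries.coeff_monomial_mul]
  split_ifs
  · rw [one_mul, one_mul]; rfl
  · rfl

theorem zCoeff_mapBase (φ : A →+ B) (n : ℤ) (F : MvPowerSeries σ (LaurentSeries A)) :
    zCoeff n (mapBase φ F) = mapCoeff φ (zCoeff n F) := rfl

theorem zCoeff_toLaurent_of_neg (F : PowerSeries (MvPowerSeries σ A)) {n : ℤ} (hn : n < 0) :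
    zCoeff n (toLaurent F) = 0 := by
  ext1 α
  change (HahnSeries.ofPowerSeries ℤ A _).coeff n = 0
  rw [HahnSeries.ofPowerSeries_apply, HahnSeries.embDomain_of_notMem_range]
  rintro ⟨k, hk⟩
  simp at hk
  omega

theorem zCoeff_toLaurent (F : PowerSeries (MvPowerSeries σ A)) (n : ℕ) :
    zCoeff n (toLaurent F) = PowerSeries.coeff n F := by
  ext1 α
  change (HahnSeries.ofPowerSeries ℤ A _).coeff n = _
  rw [HahnSeries.ofPowerSeries_apply_coeff, PowerSeries.coeff_mk]

/-! ### Naturality -/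

theorem map_pderiv (φ : A →+* B) (i : σ) (F : MvPowerSeries σ A) :
    MvPowerSeries.map φ (MvPowerSeries.pderiv A i F) =
      MvPowerSeries.pderiv B i (MvPowerSeries.map φ F) := by
  ext α
  rw [MvPowerSeries.coeff_map, MvPowerSeries.coeff_pderiv, MvPowerSeries.coeff_pderiv,
    MvPowerSeries.coeff_map, map_mul]
  simp

theorem map_complex_smul (φ : A →ₐ[ℂ] B) (a : ℂ) (F : MvPowerSeries σ A) :
    MvPowerSeries.map φ.toRingHom (a • F) = a • MvPowerSeries.map φ.toRingHom F := by
  ext α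
  rw [MvPowerSeries.coeff_map, coeff_complex_smul, coeff_complex_smul, MvPowerSeries.coeff_map]
  exact map_smul φ a _

/-- The Miwa shift is built from time derivatives and complex scalars only, hence commutes with
substitutions in `x` and `s_0`. -/
theorem miwa_map (φ : A →ₐ[ℂ] B) (ε : ℝ) (s : ℤ) (f : MvPowerSeries Time A) :
    miwa ε s (MvPowerSeries.map φ.toRingHom f) =
      PowerSeries.map (MvPowerSeries.map φ.toRingHom) (miwa ε s f) := by
  have h1 : ∀ F : PowerSeries (MvPowerSeries Time A),
      miwaD ε (PowerSeries.map (MvPowerSeries.map φ.toRingHom) F) =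
        PowerSeries.map (MvPowerSeries.map φ.toRingHom) (miwaD ε F) := by
    intro F
    ext1 k
    rw [PowerSeries.coeff_map]
    simp only [miwaD, PowerSeries.coeff_mk, PowerSeries.coeff_map, map_sum, map_complex_smul,
      map_pderiv]
  have h2 : ∀ (m : ℕ) (F : PowerSeries (MvPowerSeries Time A)),
      (miwaD ε)^[m] (PowerSeries.map (MvPowerSeries.map φ.toRingHom) F) =
        PowerSeries.map (MvPowerSeries.map φ.toRingHom) ((miwaD ε)^[m] F) := by
    intro m
    induction m with
    | zero => intro F; rfl
    | succ m ih => intro F; rw [Function.iterate_succ_apply, h1, ih, Function.iterate_succ_apply]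
  ext1 k
  rw [PowerSeries.coeff_map]
  simp only [miwa, PowerSeries.coeff_mk, map_sum, map_complex_smul]
  refine Finset.sum_congr rfl fun m _ => ?_
  rw [← PowerSeries.coeff_map, ← h2, PowerSeries.map_C]

theorem mapBaseHom_toLaurent (φ : A →ₐ[ℂ] B) (F : PowerSeries (MvPowerSeries σ A)) :
    mapBaseHom φ (toLaurent F) =
      toLaurent (PowerSeries.map (MvPowerSeries.map φ.toRingHom) F) := by
  refine zCoeff_ext fun n => ?_
  have h : zCoeff n (mapBaseHom φ (toLaurent F)) =
      MvPowerSeries.map φ.toRingHom (zCoeff n (toLaurent F)) := rfl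
  rw [h]
  rcases lt_or_ge n 0 with hn | hn
  · rw [zCoeff_toLaurent_of_neg _ hn, zCoeff_toLaurent_of_neg _ hn, map_zero]
  · lift n to ℕ using hn
    rw [zCoeff_toLaurent, zCoeff_toLaurent, PowerSeries.coeff_map]

theorem mapBase_rename (f : σ → σ') [Filter.TendstoCofinite f] (φ : A →+ B)
    (F : MvPowerSeries σ (LaurentSeries A)) :
    mapBase φ (MvPowerSeries.rename f F) = MvPowerSeries.rename f (mapBase φ F) := by
  refine zCoeff_ext fun n => ?_
  rw [zCoeff_mapBase, zCoeff_rename, zCoeff_rename, zCoeff_mapBase]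
  ext α
  rw [MvPowerSeries.coeff_rename]
  change φ (MvPowerSeries.coeff α (MvPowerSeries.rename f _)) = _
  rw [MvPowerSeries.coeff_rename, map_sum]
  rfl

end Laurent

/-! ## Linear forms, renaming and orders -/

section Rename

variable {σ σ' A B : Type} [CommRing A] [Algebra ℂ A] [CommRing B] [Algebra ℂ B]

theorem rename_mem_orderGE (f : σ → σ') [Filter.TendstoCofinite f] {n : ℕ}
    {F : MvPowerSeries σ A} (hF : F ∈ orderGE σ A n) :
    MvPowerSeries.rename f F ∈ orderGE σ' A n := by
  intro α hα
  rw [MvPowerSeries.coeff_rename]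
  refine Finset.sum_eq_zero fun β hβ => hF β ?_
  rw [Set.Finite.mem_toFinset, Set.mem_preimage, Set.mem_singleton_iff] at hβ
  rwa [← Finsupp.degree_mapDomain f β, hβ]

/-- `rename` as a `ℂ`-linear map. -/
def renameLin (f : σ → σ') [Filter.TendstoCofinite f] :
    MvPowerSeries σ A →ₗ[ℂ] MvPowerSeries σ' A :=
  (MvPowerSeries.rename f).toLinearMap.restrictScalars ℂ

theorem rename_complex_smul (f : σ → σ') [Filter.TendstoCofinite f] (a : ℂ)
    (F : MvPowerSeries σ A) : MvPowerSeries.rename f (a • F) = a • MvPowerSeries.rename f F :=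
  (renameLin f).map_smul a F

theorem rename_expS (f : σ → σ') [Filter.TendstoCofinite f] {F : MvPowerSeries σ A}
    (hF : F ∈ orderGE σ A 1) :
    MvPowerSeries.rename f (expS F) = expS (MvPowerSeries.rename f F) :=
  map_expS (renameLin f) (fun _ _ h => rename_mem_orderGE f h) (map_one (MvPowerSeries.rename f))
    (fun F G => map_mul (MvPowerSeries.rename f) F G) hF

theorem mapBase_mem_orderGE (φ : A →+ B) {n : ℕ} {F : MvPowerSeries σ (LaurentSeries A)}
    (hF : F ∈ orderGE σ (LaurentSeries A) n) : mapBase φ F ∈ orderGE σ (LaurentSeries B) n := by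
  intro α hα
  change (MvPowerSeries.coeff α F).map φ = 0
  rw [hF α hα]
  exact HahnSeries.map_zero (φ : ZeroHom A B)

theorem mapBaseHom_expS (φ : A →ₐ[ℂ] B) {F : MvPowerSeries σ (LaurentSeries A)}
    (hF : F ∈ orderGE σ (LaurentSeries A) 1) :
    mapBaseHom φ (expS F) = expS (mapBaseHom φ F) :=
  map_expS (mapBaseHom φ).toLinearMap (fun _ _ h => mapBase_mem_orderGE _ h)
    (map_one (mapBaseHom φ)) (fun F G => map_mul (mapBaseHom φ) F G) hF

theorem mul_mem_orderGE_left {n : ℕ} (F : MvPowerSeries σ A) {G : MvPowerSeries σ A}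
    (hG : G ∈ orderGE σ A n) : F * G ∈ orderGE σ A n := by
  simpa using mul_mem_orderGE (show F ∈ orderGE σ A 0 by rw [orderGE_zero]; trivial) hG

theorem X_mem_orderGE (i : σ) : (MvPowerSeries.X i : MvPowerSeries σ A) ∈ orderGE σ A 1 := by
  classical
  intro α hα
  rw [MvPowerSeries.coeff_X, if_neg]
  rintro rfl
  rw [Finsupp.degree_single] at hα
  omega

theorem coeff_linForm (a : σ → A) (α : σ →₀ ℕ) : MvPowerSeries.coeff α (linForm a) =
    if α.degree = 1 then ∑ v ∈ α.support, a v else 0 := rfl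

theorem linForm_mem_orderGE (a : σ → A) : linForm a ∈ orderGE σ A 1 := by
  intro α hα
  rw [coeff_linForm, if_neg (by omega)]

theorem pderiv_linForm (a : σ → A) (v : σ) :
    MvPowerSeries.pderiv A v (linForm a) = MvPowerSeries.C (a v) := by
  classical
  ext α
  rw [MvPowerSeries.coeff_pderiv, coeff_linForm, MvPowerSeries.coeff_C, map_add,
    Finsupp.degree_single]
  by_cases h : α = 0
  · subst h
    simp [Finsupp.support_single]
  · have : ¬ (α.degree + 1 = 1) := by
      rw [Nat.add_eq_right, Finsupp.degree_eq_zero_iff]; exact h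
    rw [if_neg this, if_neg h, zero_mul]

theorem mapBase_linForm (φ : A →+ B) (a : σ → LaurentSeries A) :
    mapBase φ (linForm a) = linForm fun v => (a v).map φ := by
  ext α n
  rw [coeff_linForm]
  change φ ((MvPowerSeries.coeff α (linForm a)).coeff n) = _
  rw [coeff_linForm]
  split_ifs
  · rw [HahnSeries.coeff_sum, HahnSeries.coeff_sum, map_sum]
    rfl
  · exact map_zero φ

theorem pderiv_rename (e : σ ↪ σ') (i : σ) (F : MvPowerSeries σ A) :
    MvPowerSeries.pderiv A (e i) (MvPowerSeries.rename e F) =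
      MvPowerSeries.rename e (MvPowerSeries.pderiv A i F) := by
  classical
  ext β
  rw [MvPowerSeries.coeff_pderiv]
  by_cases h : β ∈ Set.range (Finsupp.embDomain (M := ℕ) e)
  · obtain ⟨α, rfl⟩ := h
    rw [MvPowerSeries.coeff_embDomain_rename, MvPowerSeries.coeff_pderiv,
      ← Finsupp.embDomain_single, ← Finsupp.embDomain_add, MvPowerSeries.coeff_embDomain_rename,
      Finsupp.embDomain_apply_self]
  · have h2 : β + Finsupp.single (e i) 1 ∉ Set.range (Finsupp.embDomain (M := ℕ) e) := by
      rw [Finsupp.mem_range_embDomain_iff] at h ⊢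
      refine fun h' => h (fun j hj => h' ?_)
      simp only [Finset.mem_coe, Finsupp.mem_support_iff, Finsupp.add_apply] at hj ⊢
      omega
    have hr : Finsupp.mapDomain (M := ℕ) e = Finsupp.embDomain e :=
      funext fun x => (Finsupp.embDomain_eq_mapDomain e x).symm
    rw [MvPowerSeries.coeff_rename_eq_zero e _ (by rwa [hr]),
      MvPowerSeries.coeff_rename_eq_zero e _ (by rwa [hr]), zero_mul]

theorem pderiv_rename_of_notMem (e : σ ↪ σ') {i : σ'} (hi : i ∉ Set.range e)
    (F : MvPowerSeries σ A) : MvPowerSeries.pderiv A i (MvPowerSeries.rename e F) = 0 := by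
  classical
  ext β
  have hr : Finsupp.mapDomain (M := ℕ) e = Finsupp.embDomain e :=
    funext fun x => (Finsupp.embDomain_eq_mapDomain e x).symm
  rw [MvPowerSeries.coeff_pderiv, MvPowerSeries.coeff_rename_eq_zero e, zero_mul]
  · simp
  · rw [hr, Finsupp.mem_range_embDomain_iff]
    exact fun h => hi (h (by simp))

end Rename

/-! ## The variables -/

instance : Filter.TendstoCofinite Var2.fst :=
  Filter.tendstoCofinite_of_injective fun _ _ h => Var2.fst.inj h

instance : Filter.TendstoCofinite Var2.snd :=
  Filter.tendstoCofinite_of_injective fun _ _ h => Var2.snd.inj h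

/-- `inFst` as an embedding. -/
def inFstEmb : Var1 ↪ Var2 := ⟨inFst, by rintro (_ | v) (_ | w) h <;> simp_all [inFst]⟩

/-- `inSnd` as an embedding. -/
def inSndEmb : Var1 ↪ Var2 := ⟨inSnd, by rintro (_ | v) (_ | w) h <;> simp_all [inSnd]⟩

section Forms

variable {A B : Type} [CommRing A] [Algebra ℂ A] [CommRing B] [Algebra ℂ B]

/-- `z^{-j} / j!`. -/
def divZ (A : Type) [CommRing A] [Algebra ℂ A] (j : ℕ) : LaurentSeries A :=
  ((1 : ℂ) / (j.factorial : ℂ)) • HahnSeries.single (-(j : ℤ)) 1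

theorem divPow_eq (p : Kind) (j : ℕ) : (divPow p j : LaurentSeries A) = divZ A j := by
  cases p <;> simp [divPow, divZ, lamPow, Kind.sgn]

theorem divZ_eq_single (j : ℕ) :
    divZ A j = HahnSeries.single (-(j : ℤ)) (algebraMap ℂ A (1 / (j.factorial : ℂ))) := by
  ext n
  rw [divZ, laurent_coeff_smul, HahnSeries.coeff_single, HahnSeries.coeff_single]
  split_ifs
  · rw [Algebra.algebraMap_eq_smul_one]
  · rw [smul_zero]

theorem laurent_map_smul (φ : A →ₗ[ℂ] B) (a : ℂ) (x : LaurentSeries A) :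
    (a • x).map φ.toAddMonoidHom = a • x.map φ.toAddMonoidHom := by
  ext n
  exact map_smul φ a _

theorem map_divZ (φ : A →ₐ[ℂ] B) (j : ℕ) :
    (divZ A j).map φ.toLinearMap.toAddMonoidHom = divZ B j := by
  rw [divZ_eq_single, divZ_eq_single]
  refine (HahnSeries.map_single (φ.toLinearMap.toAddMonoidHom : ZeroHom A B)).trans ?_
  exact congrArg _ (φ.commutes _)

theorem mapBaseHom_tForm (φ : A →ₐ[ℂ] B) (u : ℕ → LaurentSeries A) :
    mapBaseHom φ (tForm u) = tForm fun j => (u j).map φ.toLinearMap.toAddMonoidHom := by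
  refine (mapBase_linForm φ.toLinearMap.toAddMonoidHom _).trans (congrArg linForm (funext ?_))
  rintro (_ | _ | _)
  · exact HahnSeries.map_zero (φ.toLinearMap.toAddMonoidHom : ZeroHom A B)
  · rfl
  · exact HahnSeries.map_zero (φ.toLinearMap.toAddMonoidHom : ZeroHom A B)

theorem mapBaseHom_sForm (φ : A →ₐ[ℂ] B) (u : ℕ → LaurentSeries A) :
    mapBaseHom φ (sForm u) = sForm fun j => (u j).map φ.toLinearMap.toAddMonoidHom := by
  refine (mapBase_linForm φ.toLinearMap.toAddMonoidHom _).trans (congrArg linForm (funext ?_))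
  rintro (_ | _ | _)
  · exact HahnSeries.map_zero (φ.toLinearMap.toAddMonoidHom : ZeroHom A B)
  · exact HahnSeries.map_zero (φ.toLinearMap.toAddMonoidHom : ZeroHom A B)
  · rfl

theorem mapBaseHom_X {σ : Type} (φ : A →ₐ[ℂ] B) (i : σ) :
    mapBaseHom φ (MvPowerSeries.X i) = MvPowerSeries.X i := by
  classical
  ext α n
  change φ ((MvPowerSeries.coeff α (MvPowerSeries.X i : MvPowerSeries σ (LaurentSeries A))).coeff n)
    = (MvPowerSeries.coeff α (MvPowerSeries.X i : MvPowerSeries σ (LaurentSeries B))).coeff n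
  rw [MvPowerSeries.coeff_X, MvPowerSeries.coeff_X]
  split_ifs
  · rw [HahnSeries.coeff_one, HahnSeries.coeff_one]
    split_ifs <;> simp
  · simp

theorem mapBaseHom_C {σ : Type} (φ : A →ₐ[ℂ] B) (x : LaurentSeries A) :
    mapBaseHom φ (MvPowerSeries.C (σ := σ) x) =
      MvPowerSeries.C (x.map φ.toLinearMap.toAddMonoidHom) := by
  classical
  ext α n
  change φ ((MvPowerSeries.coeff α (MvPowerSeries.C (σ := σ) x)).coeff n) = _
  rw [MvPowerSeries.coeff_C, MvPowerSeries.coeff_C]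
  split_ifs
  · rfl
  · simp

/-- The difference of the two copies of a power series, in the variables of the first and of the
second factor. -/
def twoPoint (F : MvPowerSeries Var1 A) : MvPowerSeries Var2 A :=
  MvPowerSeries.rename inFst F - MvPowerSeries.rename inSnd F

theorem twoPoint_mem_orderGE {F : MvPowerSeries Var1 A} (hF : F ∈ orderGE Var1 A 1) :
    twoPoint F ∈ orderGE Var2 A 1 :=
  sub_mem (rename_mem_orderGE _ hF) (rename_mem_orderGE _ hF)

theorem pderiv_twoPoint (F : MvPowerSeries Var1 A) (v : Time) :
    MvPowerSeries.pderiv A (Var2.fst v) (twoPoint F) =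
      MvPowerSeries.rename inFst (MvPowerSeries.pderiv A (some v) F) := by
  have h1 := pderiv_rename inFstEmb (some v) F
  have h2 := pderiv_rename_of_notMem inSndEmb (i := Var2.fst v) (by
    rintro ⟨_ | w, h⟩
    · exact Var2.noConfusion h
    · exact Var2.noConfusion h) F
  change MvPowerSeries.pderiv A (Var2.fst v) (MvPowerSeries.rename inFst F) = _ at h1
  change MvPowerSeries.pderiv A (Var2.fst v) (MvPowerSeries.rename inSnd F) = 0 at h2
  rw [twoPoint, map_sub, h1, h2, sub_zero]
  rfl

/-- `δ = ∑_{j > 0} (z^{-j}/j!) (s_j - s_j')`. -/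
def deltaZ (A : Type) [CommRing A] [Algebra ℂ A] : MvPowerSeries Var2 (LaurentSeries A) :=
  twoPoint (sForm (divZ A))

/-- The exponent `a ∑_j (1/2) (t_j - t_j') z^{-j-1}/(j+1)! - a ∑_j c_j (s_j - s_j') z^{-j}/j!`. -/
def expoZ (A : Type) [CommRing A] [Algebra ℂ A] (a : ℂ) : MvPowerSeries Var2 (LaurentSeries A) :=
  a • (twoPoint (tForm fun j => ((1 : ℂ) / 2) • divZ A (j + 1)) -
    twoPoint (sForm fun j => c j • divZ A j))

theorem deltaZ_mem : deltaZ A ∈ orderGE Var2 (LaurentSeries A) 1 :=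
  twoPoint_mem_orderGE (linForm_mem_orderGE _)

theorem expoZ_mem (a : ℂ) : expoZ A a ∈ orderGE Var2 (LaurentSeries A) 1 :=
  Submodule.smul_mem _ _ (sub_mem (twoPoint_mem_orderGE (linForm_mem_orderGE _))
    (twoPoint_mem_orderGE (linForm_mem_orderGE _)))

/-- The derivative of `δ` with respect to a time variable of the first factor. -/
def deltaCoeff (A : Type) [CommRing A] [Algebra ℂ A] : Time → LaurentSeries A
  | Time.t _ => 0
  | Time.s j => divZ A (j + 1)

/-- The derivative of the exponent with respect to a time variable of the first factor. -/
def expoCoeff (A : Type) [CommRing A] [Algebra ℂ A] (a : ℂ) : Time → LaurentSeries A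
  | Time.t j => (a / 2) • divZ A (j + 1)
  | Time.s j => -((a * c (j + 1)) • divZ A (j + 1))

theorem pderiv_complex_smul {σ : Type} (i : σ) (a : ℂ) (F : MvPowerSeries σ A) :
    MvPowerSeries.pderiv A i (a • F) = a • MvPowerSeries.pderiv A i F :=
  (MvPowerSeries.pderiv A i).toLinearMap.map_smul_of_tower a F

theorem pderiv_deltaZ (v : Time) :
    MvPowerSeries.pderiv _ (Var2.fst v) (deltaZ A) = MvPowerSeries.C (deltaCoeff A v) := by
  rw [deltaZ, pderiv_twoPoint, sForm, pderiv_linForm, MvPowerSeries.rename_C]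
  cases v <;> rfl

theorem C_complex_smul {σ : Type} (a : ℂ) (x : A) :
    (MvPowerSeries.C (a • x) : MvPowerSeries σ A) = a • MvPowerSeries.C x := by
  classical
  ext α
  rw [coeff_complex_smul, MvPowerSeries.coeff_C, MvPowerSeries.coeff_C]
  split_ifs
  · rfl
  · rw [smul_zero]

theorem pderiv_expoZ (a : ℂ) (v : Time) :
    MvPowerSeries.pderiv _ (Var2.fst v) (expoZ A a) = MvPowerSeries.C (expoCoeff A a v) := by
  rw [expoZ, pderiv_complex_smul, map_sub, pderiv_twoPoint, pderiv_twoPoint, sForm, tForm,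
    pderiv_linForm, pderiv_linForm, MvPowerSeries.rename_C, MvPowerSeries.rename_C, ← map_sub,
    ← C_complex_smul]
  congr 1
  cases v with
  | t j =>
    change a • (((1 : ℂ) / 2) • divZ A (j + 1) - 0) = (a / 2) • divZ A (j + 1)
    rw [sub_zero, smul_smul]
    congr 1
    ring
  | s j =>
    change a • (0 - c (j + 1) • divZ A (j + 1)) = -((a * c (j + 1)) • divZ A (j + 1))
    rw [zero_sub, smul_neg, smul_smul]

end Forms

/-! ## The derivation `∂` on power series over Laurent series -/

section Derivation

variable {N : ℕ} {V : Type} [NormedAddCommGroup V] [NormedSpace ℝ V] {σ : Type}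

/-- The derivation in the direction `v`, on power series over Laurent series. -/
def derZ (v : V) : Module.End ℂ (MvPowerSeries σ (LaurentSeries (Fn N V))) :=
  mapBaseLin (derLin v)

theorem derZ_mul (v : V) (F G : MvPowerSeries σ (LaurentSeries (Fn N V))) :
    derZ v (F * G) = derZ v F * G + F * derZ v G := by
  have hid : ∀ H : MvPowerSeries σ (LaurentSeries (Fn N V)),
      mapBase (AddMonoidHom.id (Fn N V)) H = H := fun H => by ext α n; rfl
  have := mapBase_mul_of (d := der v) (d₁ := der v) (d₂ := AddMonoidHom.id (Fn N V))
    (d₃ := AddMonoidHom.id (Fn N V)) (d₄ := der v) (fun x y => der_mul v x y) F G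
  rwa [hid, hid] at this

theorem derZ_preserves (v : V) :
    PreservesOrder (derZ v : Module.End ℂ (MvPowerSeries σ (LaurentSeries (Fn N V)))) :=
  fun _ _ hF => mapBase_mem_orderGE (der v) hF

theorem derZ_rename {σ' : Type} (f : σ → σ') [Filter.TendstoCofinite f] (v : V)
    (F : MvPowerSeries σ (LaurentSeries (Fn N V))) :
    derZ v (MvPowerSeries.rename f F) = MvPowerSeries.rename f (derZ v F) :=
  mapBase_rename f (der v) F

theorem derZ_one (v : V) : derZ v (1 : MvPowerSeries σ (LaurentSeries (Fn N V))) = 0 := by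
  have := derZ_mul v (1 : MvPowerSeries σ (LaurentSeries (Fn N V))) 1
  simpa using this

theorem derZ_expS (v : V) {F : MvPowerSeries σ (LaurentSeries (Fn N V))}
    (hF : F ∈ orderGE σ _ 1) : derZ v (expS F) = derZ v F * expS F := by
  rw [expS_eq_expOp, lin_expOp (Ψ := mulOp (derZ v F)) (raises_mulOp hF)
    (fun n G hG => derZ_preserves v n G (orderGE_anti (by omega) hG))
    (fun n G hG => mul_mem_orderGE_left _ hG) ?_ (commute_mulOp _ _) 1, derZ_one, expOp_mulOp hF,
    mul_zero, zero_add, mulOp_apply]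
  refine LinearMap.ext fun G => ?_
  simp [Module.End.mul_apply, derZ_mul, add_comm]

theorem derZ_linForm_eq_zero (v : V) {a : σ → LaurentSeries (Fn N V)}
    (h : ∀ i, (a i).map (der v) = 0) : derZ v (linForm a) = 0 := by
  refine (mapBase_linForm (der v) a).trans ?_
  simp only [h]
  ext1 α
  rw [coeff_linForm]
  simp

theorem map_der_divZ (v : V) (j : ℕ) : (divZ (Fn N V) j).map (der v) = 0 := by
  rw [divZ_eq_single]
  refine (HahnSeries.map_single ((der v : Fn N V →+ Fn N V) : ZeroHom (Fn N V) (Fn N V))).trans ?_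
  change HahnSeries.single _ (der v (algebraMap ℂ (Fn N V) _)) = 0
  rw [der_algebraMap, HahnSeries.single_eq_zero]

theorem derZ_sForm_smul_divZ (v : V) (a : ℕ → ℂ) :
    derZ v (sForm fun j => a j • divZ (Fn N V) j) = 0 := by
  refine derZ_linForm_eq_zero v ?_
  rintro (_ | _ | j)
  · exact HahnSeries.map_zero ((der v : Fn N V →+ Fn N V) : ZeroHom (Fn N V) (Fn N V))
  · exact HahnSeries.map_zero ((der v : Fn N V →+ Fn N V) : ZeroHom (Fn N V) (Fn N V))
  · refine (laurent_map_smul (derLin v) _ _).trans ?_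
    change _ • (divZ (Fn N V) (j + 1)).map (der v) = 0
    rw [map_der_divZ, smul_zero]

theorem derZ_sForm_divZ (v : V) : derZ v (sForm (divZ (Fn N V))) = 0 := by
  have := derZ_sForm_smul_divZ (N := N) v fun _ => 1
  simpa only [one_smul] using this

theorem derZ_tForm_smul_divZ (v : V) (a : ℂ) :
    derZ v (tForm fun j => a • divZ (Fn N V) (j + 1)) = 0 := by
  refine derZ_linForm_eq_zero v ?_
  rintro (_ | j | j)
  · exact HahnSeries.map_zero ((der v : Fn N V →+ Fn N V) : ZeroHom (Fn N V) (Fn N V))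
  · refine (laurent_map_smul (derLin v) _ _).trans ?_
    change _ • (divZ (Fn N V) (j + 1)).map (der v) = 0
    rw [map_der_divZ, smul_zero]
  · exact HahnSeries.map_zero ((der v : Fn N V →+ Fn N V) : ZeroHom (Fn N V) (Fn N V))

theorem derZ_deltaZ_mul (v : V) (F : MvPowerSeries Var2 (LaurentSeries (Fn N V))) :
    derZ v (deltaZ (Fn N V) * F) = deltaZ (Fn N V) * derZ v F := by
  rw [derZ_mul, deltaZ, twoPoint, map_sub, derZ_rename, derZ_rename, derZ_sForm_divZ, map_zero,
    map_zero, sub_zero, zero_mul, zero_add]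

theorem derZ_X (v : V) (i : σ) :
    derZ v (MvPowerSeries.X i : MvPowerSeries σ (LaurentSeries (Fn N V))) = 0 := by
  classical
  ext α n
  change der v ((MvPowerSeries.coeff α
    (MvPowerSeries.X i : MvPowerSeries σ (LaurentSeries (Fn N V)))).coeff n) = 0
  have h1 : der v (1 : Fn N V) = 0 := by
    rw [← map_one (algebraMap ℂ (Fn N V)), der_algebraMap]
  rw [MvPowerSeries.coeff_X]
  split_ifs
  · rw [HahnSeries.coeff_one]
    split_ifs
    · exact h1
    · exact map_zero _
  · exact map_zero _

end Derivation

/-! ## The normal form of the Hirota expression -/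

section NormalForm

variable {N : ℕ}

/-- The operator `∂ + X_∂`, that is the symbol of left composition with `∂`. -/
def symD : Module.End ℂ (MvPowerSeries Var2 (LaurentSeries (Fn N (ℝ × ℝ)))) :=
  derZ ((1 : ℝ), (0 : ℝ)) + mulOp (MvPowerSeries.X Var2.del)

/-- The series `τ(s_0 + x - σ ε/2, t - σ [z])`. -/
def firstSeries (ε : ℝ) (σ : ℤ) (τ : TauSpace N) : PowerSeries (Coef N) :=
  miwa ε (-σ) (atSum (-((σ : ℝ) * (ε / 2))) τ)

/-- The series `τ(s_0 + x + σ ε/2, t + σ [z])`. -/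
def secondSeries (ε : ℝ) (σ : ℤ) (τ : TauSpace N) : PowerSeries (Coef N) :=
  miwa ε σ (atSum ((σ : ℝ) * (ε / 2)) τ)

/-- The Hirota expression, free of logarithms, with general series in place of those given
by `τ`. -/
def hirotaForm (ε : ℝ) (σ : ℤ) (a : MvPowerSeries Time (LaurentSeries (Fn N (ℝ × ℝ))))
    (b : MvPowerSeries Var2 (LaurentSeries (Fn N (ℝ × ℝ)))) :
    MvPowerSeries Var2 (LaurentSeries (Fn N (ℝ × ℝ))) :=
  expS (expoZ (Fn N (ℝ × ℝ)) ((σ : ℂ) / (ε : ℂ))) * MvPowerSeries.rename Var2.fst a *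
    translate symD (deltaZ (Fn N (ℝ × ℝ))) b

section VertexExponent

variable {V W : Type} [NormedAddCommGroup V] [NormedSpace ℝ V] [NormedAddCommGroup W]
  [NormedSpace ℝ W]

/-- The exponent of the vertex operators, with `y` in place of `s_0`. -/
def vertexExpo (ε : ℝ) (κ : ℂ) (y : Fn N V) : MvPowerSeries Var1 (LaurentSeries (Fn N V)) :=
  ((1 : ℂ) / (ε : ℂ)) •
    (tForm (fun j => ((1 : ℂ) / 2) • divZ (Fn N V) (j + 1))
      + MvPowerSeries.C (HahnSeries.C y) * (κ • MvPowerSeries.X none)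
      + (sForm (divZ (Fn N V)) * (κ • MvPowerSeries.X none) -
          sForm fun j => c j • divZ (Fn N V) j))

/-- In the local parameter, the two types of exponents differ only in the sign of the logarithm. -/
theorem vertexExponent_eq (ε : ℝ) (p : Kind) : vertexExponent (N := N) ε p =
    vertexExpo ε (p.sgn : ℂ) (scalarFn (fun y : ℝ => (y : ℂ)) Complex.ofRealCLM.contDiff) := by
  simp only [vertexExponent, vertexExpo, divPow_eq, logVar]

theorem mapBaseHom_vertexExpo (φ : Fn N V →ₐ[ℂ] Fn N W) (ε : ℝ) (κ : ℂ) (y : Fn N V) :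
    mapBaseHom φ (vertexExpo ε κ y) = vertexExpo ε κ (φ y) := by
  have h : (HahnSeries.C y : LaurentSeries (Fn N V)).map φ.toLinearMap.toAddMonoidHom =
      HahnSeries.C (φ y) :=
    HahnSeries.map_single (φ.toLinearMap.toAddMonoidHom : ZeroHom (Fn N V) (Fn N W))
  simp only [vertexExpo, map_smul, map_add, map_sub, map_mul, mapBaseHom_tForm, mapBaseHom_sForm,
    mapBaseHom_X, mapBaseHom_C, h, laurent_map_smul, map_divZ]

theorem vertexExpo_mem (ε : ℝ) (κ : ℂ) (y : Fn N V) : vertexExpo ε κ y ∈ orderGE Var1 _ 1 :=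
  Submodule.smul_mem _ _ (add_mem (add_mem (linForm_mem_orderGE _)
    (mul_mem_orderGE_left _ (Submodule.smul_mem _ _ (X_mem_orderGE _))))
    (sub_mem (mul_mem_orderGE_left _ (Submodule.smul_mem _ _ (X_mem_orderGE _)))
      (linForm_mem_orderGE _)))

/-- Only the term `y log λ` depends on the point; all other coefficients are complex constants. -/
theorem derZ_vertexExpo (ε : ℝ) (κ : ℂ) (y : Fn N V) (v : V) (hy : der v y = 1) :
    derZ v (vertexExpo ε κ y) = ((1 : ℂ) / (ε : ℂ) * κ) • MvPowerSeries.X none := by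
  have hC : derZ v (MvPowerSeries.C (σ := Var1) (HahnSeries.C y : LaurentSeries (Fn N V))) = 1 := by
    classical
    ext1 α
    change (MvPowerSeries.coeff α (MvPowerSeries.C (σ := Var1)
      (HahnSeries.C y : LaurentSeries (Fn N V)))).map (der v) = _
    rw [MvPowerSeries.coeff_C, MvPowerSeries.coeff_one]
    split_ifs
    · refine (HahnSeries.map_single ((der v : Fn N V →+ Fn N V) : ZeroHom (Fn N V) (Fn N V))).trans ?_
      exact congrArg _ hy
    · exact HahnSeries.map_zero ((der v : Fn N V →+ Fn N V) : ZeroHom (Fn N V) (Fn N V))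
  simp only [vertexExpo, map_smul, map_add, map_sub, derZ_mul, derZ_X, derZ_sForm_divZ, hC,
    derZ_sForm_smul_divZ, derZ_tForm_smul_divZ, smul_zero, mul_zero, zero_mul, zero_add, add_zero,
    sub_zero, one_mul, smul_smul]

end VertexExponent

theorem pull_congr {V W : Type} [NormedAddCommGroup V] [NormedSpace ℝ V] [NormedAddCommGroup W]
    [NormedSpace ℝ W] {g g' : V → W} (h : g = g') (hg : ContDiff ℝ ∞ g) (hg' : ContDiff ℝ ∞ g') :
    (pull g hg : Fn N W →+* Fn N V) = pull g' hg' := by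
  subst h
  rfl

theorem map_pull_map_pull {U V W σ : Type} [NormedAddCommGroup U] [NormedSpace ℝ U]
    [NormedAddCommGroup V] [NormedSpace ℝ V] [NormedAddCommGroup W]
    [NormedSpace ℝ W] {g : U → V} {h : V → W} {k : U → W} (hk : ∀ x, k x = h (g x))
    (hg : ContDiff ℝ ∞ g) (hh : ContDiff ℝ ∞ h) (hk' : ContDiff ℝ ∞ k)
    (F : MvPowerSeries σ (Fn N W)) :
    MvPowerSeries.map (pull g hg) (MvPowerSeries.map (pull h hh) F) =
      MvPowerSeries.map (pull k hk') F := by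
  ext1 α
  rw [MvPowerSeries.coeff_map, MvPowerSeries.coeff_map, MvPowerSeries.coeff_map,
    pull_congr (funext hk) hk' (hh.comp hg)]
  rfl

theorem mapBaseHom_vertex (ε : ℝ) (p : Kind) (σ : ℤ) (τ : TauSpace N) {g : ℝ × ℝ → ℝ}
    (hg : ContDiff ℝ ∞ g) :
    mapBaseHom (pullHom g hg) (vertex ε p σ τ) =
      expS ((σ : ℂ) • vertexExpo ε (p.sgn : ℂ) (scalarFn (fun q => (g q : ℂ))
        (Complex.ofRealCLM.contDiff.comp hg))) *
      MvPowerSeries.rename (some : Time → Var1) (toLaurent (miwa ε (-σ)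
        (MvPowerSeries.map (pull (fun q => g q - (σ : ℝ) * (ε / 2)) (by fun_prop)) τ))) := by
  rw [vertex, map_mul, mapBaseHom_expS _ (Submodule.smul_mem _ _ (by
    rw [vertexExponent_eq]; exact vertexExpo_mem _ _ _)), map_smul, vertexExponent_eq,
    mapBaseHom_vertexExpo]
  congr 1
  refine (mapBase_rename some _ _).trans (congrArg _ ?_)
  refine (mapBaseHom_toLaurent (pullHom g hg) _).trans (congrArg _ ?_)
  rw [← miwa_map]
  exact congrArg (miwa ε (-σ)) (map_pull_map_pull (g := g)
    (h := fun y => y - (σ : ℝ) * (ε / 2)) (k := fun q => g q - (σ : ℝ) * (ε / 2))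
    (fun _ => rfl) hg (by fun_prop) (by fun_prop) τ)

theorem symD_deltaZ_mul (F : MvPowerSeries Var2 (LaurentSeries (Fn N (ℝ × ℝ)))) :
    symD (deltaZ (Fn N (ℝ × ℝ)) * F) = deltaZ (Fn N (ℝ × ℝ)) * symD F := by
  simp only [symD, LinearMap.add_apply, derZ_deltaZ_mul, mulOp_apply, mul_add, mul_left_comm]

theorem symD_preserves : PreservesOrder (symD (N := N)) := fun n F hF =>
  add_mem (derZ_preserves _ n F hF) (mul_mem_orderGE_left _ hF)

theorem derZ_scalarFn {g : ℝ × ℝ → ℝ} (hg : ContDiff ℝ ∞ g) {v : ℝ × ℝ}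
    (h : ∀ q, fderiv ℝ g q v = 1) :
    der v (scalarFn (N := N) (fun q => (g q : ℂ)) (Complex.ofRealCLM.contDiff.comp hg)) = 1 := by
  have h1 : scalarFn (N := N) (fun q => (g q : ℂ)) (Complex.ofRealCLM.contDiff.comp hg) =
      pull g hg (scalarFn (fun y : ℝ => (y : ℂ)) Complex.ofRealCLM.contDiff) := rfl
  rw [h1, der_pull g hg v 1 h, ← map_one (pull g hg)]
  congr 1
  refine Fn.ext_entries fun x i j => ?_
  change fderiv ℝ (fun y : ℝ => (algebraMap ℂ (Matrix (Fin N) (Fin N) ℂ) (y : ℂ)) i j) x 1 =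
    (1 : Matrix (Fin N) (Fin N) ℂ) i j
  by_cases hij : i = j
  · subst hij
    simp only [Matrix.algebraMap_matrix_apply, if_true, Matrix.one_apply_eq]
    have : HasFDerivAt (fun y : ℝ => (y : ℂ)) Complex.ofRealCLM x :=
      Complex.ofRealCLM.hasFDerivAt
    simpa using congrArg (fun L => L 1) this.fderiv
  · simp [Matrix.algebraMap_matrix_apply, hij]

/-- Moving `exp F` to the left of `exp(δ ∂)` replaces `∂` by `∂ + w`. As `w` is constant in `x`,
this splits off the factor `exp(δ w)`. The factor `exp(δ X_∂)` is absorbed in the same way and turns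
`∂` into `∂ + X_∂`, which is `symD`. -/
theorem translate_exp_mul {F w : MvPowerSeries Var2 (LaurentSeries (Fn N (ℝ × ℝ)))}
    (hF : F ∈ orderGE Var2 _ 1) (hFw : derZ ((1 : ℝ), (0 : ℝ)) F = w)
    (hw : derZ ((1 : ℝ), (0 : ℝ)) w = 0) (B : MvPowerSeries Var2 (LaurentSeries (Fn N (ℝ × ℝ)))) :
    translate (derZ ((1 : ℝ), (0 : ℝ))) (deltaZ (Fn N (ℝ × ℝ))) (expS F * B) *
        expS (deltaZ (Fn N (ℝ × ℝ)) * MvPowerSeries.X Var2.del) =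
      expS F * (expS (deltaZ (Fn N (ℝ × ℝ)) * w) *
        translate symD (deltaZ (Fn N (ℝ × ℝ))) B) := by
  have hd := derZ_preserves (N := N) (σ := Var2) ((1 : ℝ), (0 : ℝ))
  have hw' : ∀ G, derZ ((1 : ℝ), (0 : ℝ)) (w * G) = w * derZ ((1 : ℝ), (0 : ℝ)) G := fun G => by
    rw [derZ_mul, hw, zero_mul, zero_add]
  have hX : ∀ G : MvPowerSeries Var2 (LaurentSeries (Fn N (ℝ × ℝ))),
      derZ ((1 : ℝ), (0 : ℝ)) (MvPowerSeries.X Var2.del * G) =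
        MvPowerSeries.X Var2.del * derZ ((1 : ℝ), (0 : ℝ)) G := fun G => by
    rw [derZ_mul, derZ_X, zero_mul, zero_add]
  rw [translate_mul_left (d' := derZ ((1 : ℝ), (0 : ℝ)) + mulOp w) ?_ deltaZ_mem hd
    (fun n G hG => add_mem (hd n G hG) (mul_mem_orderGE_left _ hG)) (derZ_deltaZ_mul _) ?_,
    translate_add_mulOp deltaZ_mem hd (derZ_deltaZ_mul _) hw', symD,
    translate_add_mulOp deltaZ_mem hd (derZ_deltaZ_mul _) hX]
  · ring
  · intro G
    rw [derZ_mul, derZ_expS _ hF, hFw]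
    simp only [LinearMap.add_apply, mulOp_apply]
    ring
  · intro G
    simp only [LinearMap.add_apply, mulOp_apply, derZ_deltaZ_mul]
    ring

/-- The point `(x, s_0, s_0')` with `s_0 - s_0' = l ε`. -/
def diagPoint (ε : ℝ) (l : ℤ) (q : ℝ × ℝ) : ℝ × ℝ × ℝ := (q.1, q.2, q.2 - (l : ℝ) * ε)

theorem contDiff_diagPoint (ε : ℝ) (l : ℤ) : ContDiff ℝ ∞ (diagPoint ε l) := by
  unfold diagPoint
  fun_prop

theorem fderiv_diagPoint (ε : ℝ) (l : ℤ) (q : ℝ × ℝ) :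
    fderiv ℝ (diagPoint ε l) q (1, 0) = (1, 0, 0) := by
  have h1 : HasFDerivAt (fun q : ℝ × ℝ => q.1) (ContinuousLinearMap.fst ℝ ℝ ℝ) q := hasFDerivAt_fst
  have h2 : HasFDerivAt (fun q : ℝ × ℝ => q.2) (ContinuousLinearMap.snd ℝ ℝ ℝ) q := hasFDerivAt_snd
  have h3 := h1.prodMk (h2.prodMk (h2.sub_const ((l : ℝ) * ε)))
  have h4 : fderiv ℝ (diagPoint ε l) q = _ := h3.fderiv
  rw [h4]
  simp

/-- The substitution `s_0' = s_0 - l ε` does not involve `x`, so it commutes with `∂` and can be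
carried out inside the translate. -/
theorem mapBaseHom_diag_sharp (ε : ℝ) (l : ℤ) (p : Kind)
    (f g : MvPowerSeries Var1 (LaurentSeries (Fn N ℝ))) :
    mapBaseHom (pullHom (diagPoint ε l) (contDiff_diagPoint ε l)) (sharp p f g) =
      MvPowerSeries.rename inFst
        (mapBaseHom (pullHom (fun q : ℝ × ℝ => q.2 + q.1) (by fun_prop)) f) *
      (translate (derZ ((1 : ℝ), (0 : ℝ))) (deltaZ (Fn N (ℝ × ℝ))) (MvPowerSeries.rename inSnd
        (mapBaseHom (pullHom (fun q : ℝ × ℝ => q.2 - (l : ℝ) * ε + q.1) (by fun_prop)) g)) *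
      expS (deltaZ (Fn N (ℝ × ℝ)) * MvPowerSeries.X Var2.del)) := by
  have hδ : mapBaseHom (pullHom (diagPoint ε l) (contDiff_diagPoint ε l))
      (deltaZ (Fn N (ℝ × ℝ × ℝ))) = deltaZ (Fn N (ℝ × ℝ)) := by
    have hs : mapBaseHom (pullHom (diagPoint ε l) (contDiff_diagPoint ε l))
        (sForm (divZ (Fn N (ℝ × ℝ × ℝ)))) = sForm (divZ (Fn N (ℝ × ℝ))) := by
      rw [mapBaseHom_sForm]
      simp only [map_divZ]
    rw [deltaZ, twoPoint, map_sub, deltaZ, twoPoint, ← hs]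
    exact congrArg₂ _ (mapBase_rename _ _ _) (mapBase_rename _ _ _)
  have hdelta : ∀ (p : Kind), (delta p : TensorSpace N) = deltaZ (Fn N (ℝ × ℝ × ℝ)) := by
    intro p
    simp only [delta, deltaZ, twoPoint, divPow_eq]
  have hder : ∀ F : TensorSpace N, mapBaseHom (pullHom (diagPoint ε l) (contDiff_diagPoint ε l))
      (derZ ((1 : ℝ), (0 : ℝ), (0 : ℝ)) F) = derZ ((1 : ℝ), (0 : ℝ))
        (mapBaseHom (pullHom (diagPoint ε l) (contDiff_diagPoint ε l)) F) := by
    intro F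
    ext1 α
    ext1
    funext n
    exact (der_pull (diagPoint ε l) (contDiff_diagPoint ε l) _ _ (fderiv_diagPoint ε l) _).symm
  have htr : ∀ B : TensorSpace N, mapBaseHom (pullHom (diagPoint ε l) (contDiff_diagPoint ε l))
      (translate (derZ ((1 : ℝ), (0 : ℝ), (0 : ℝ))) (deltaZ (Fn N (ℝ × ℝ × ℝ))) B) =
      translate (derZ ((1 : ℝ), (0 : ℝ))) (deltaZ (Fn N (ℝ × ℝ)))
        (mapBaseHom (pullHom (diagPoint ε l) (contDiff_diagPoint ε l)) B) := by
    intro B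
    rw [translate_eq_expOp (derZ_deltaZ_mul _), translate_eq_expOp (derZ_deltaZ_mul _)]
    refine map_expOp
      (mapBaseHom (pullHom (diagPoint ε l) (contDiff_diagPoint ε l))).toLinearMap
      (fun n F hF => mapBase_mem_orderGE _ hF)
      (raises_mulOp_mul deltaZ_mem (derZ_preserves _))
      (raises_mulOp_mul deltaZ_mem (derZ_preserves _)) (fun F => ?_) B
    rw [Module.End.mul_apply, Module.End.mul_apply, mulOp_apply, mulOp_apply]
    refine (map_mul (mapBaseHom _) _ _).trans ?_
    rw [hδ, hder]
    rfl
  rw [sharp, map_mul, map_mul, hdelta,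
    mapBaseHom_expS _ (by rw [mul_comm]; exact mul_mem_orderGE_left _ deltaZ_mem), map_mul, hδ,
    mapBaseHom_X]
  refine congrArg₂ _ (mapBase_rename inFst _ _) (congrArg₂ _ ?_ rfl)
  refine (htr _).trans (congrArg _ ?_)
  exact mapBase_rename inSnd _ _

/-- Used with `e = 1/ε`, `m = l ε`, `s = σ`, `k` the sign of the type, `X = log λ`, `Y` the function
`s_0' + x`, and `T`, `S`, `C` the linear forms of the two vertex exponents. The first term
compensates for the power of `λ`, the next two are the vertex exponents, and the last comes from
moving `exp(δ ∂)` past the second one. All multiples of `X` cancel. -/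
theorem log_cancellation {R : Type} [CommRing R] [Algebra ℂ R] {e m l s k : ℂ} (h : e * m = l)
    (T₁ T₂ S₁ S₂ C₁ C₂ Y X : R) :
    -(k * s * l) • X + s • (e • (T₁ + (m • 1 + Y) * (k • X) + (S₁ * (k • X) - C₁))) +
      (-s) • (e • (T₂ + Y * (k • X) + (S₂ * (k • X) - C₂))) + (S₁ - S₂) * ((-s * (e * k)) • X) =
    (s * e) • (T₁ - T₂ - (C₁ - C₂)) := by
  subst h
  simp only [mul_smul_comm, smul_mul_assoc, add_mul, sub_mul, one_mul]
  module

/-- The logarithms in the Hirota expression cancel. -/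
theorem hirota_eq (ε : ℝ) (hε : ε ≠ 0) (p : Kind) (σ l : ℤ) (τ : TauSpace N) :
    hirota ε p σ l τ = MvPowerSeries.C (HahnSeries.single (-(σ * l)) 1) *
      hirotaForm ε σ (toLaurent (firstSeries ε σ τ)) (MvPowerSeries.rename Var2.snd
        (toLaurent (PowerSeries.map (shift ε (-l)) (secondSeries ε σ τ)))) := by
  have hε' : (ε : ℂ) ≠ 0 := by exact_mod_cast hε
  have hκ : (p.sgn : ℂ) * p.sgn = 1 := by cases p <;> simp [Kind.sgn]
  have hκ' : p.sgn * p.sgn = 1 := by cases p <;> rfl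
  have hlam : (lamPow p (p.sgn * σ * l) : LaurentSeries (Fn N (ℝ × ℝ))) =
      HahnSeries.single (-(σ * l)) 1 := by
    rw [lamPow, ← mul_assoc, ← mul_assoc, hκ', one_mul]
  set g1 : ℝ × ℝ → ℝ := fun q => q.2 + q.1 with hg1
  have hg1' : ContDiff ℝ ∞ g1 := by fun_prop
  set g2 : ℝ × ℝ → ℝ := fun q => q.2 - (l : ℝ) * ε + q.1 with hg2
  have hg2' : ContDiff ℝ ∞ g2 := by fun_prop
  have ha : MvPowerSeries.rename inFst (MvPowerSeries.rename (some : Time → Var1)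
      (toLaurent (miwa ε (-σ)
        (MvPowerSeries.map (pull (fun q => g1 q - (σ : ℝ) * (ε / 2)) (by fun_prop)) τ)))) =
      MvPowerSeries.rename Var2.fst (toLaurent (firstSeries ε σ τ)) := by
    rw [MvPowerSeries.rename_rename, firstSeries, atSum]
    have : pull (N := N) (fun q => g1 q - (σ : ℝ) * (ε / 2)) (by fun_prop) =
        pull (fun q : ℝ × ℝ => q.2 + q.1 + -((σ : ℝ) * (ε / 2))) (by fun_prop) :=
      pull_congr (funext fun q => by simp only [hg1]; ring) _ _
    rw [this]
    rfl
  -- As `s_0' + x = s_0 + (x - l ε)`, the second factor is the series at `s_0` with its coefficients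
  -- shifted by `Λ^{-l}`.
  have hb : MvPowerSeries.rename inSnd (MvPowerSeries.rename (some : Time → Var1)
      (toLaurent (miwa ε (-(-σ)) (MvPowerSeries.map
        (pull (fun q => g2 q - ((-σ : ℤ) : ℝ) * (ε / 2)) (by fun_prop)) τ)))) =
      MvPowerSeries.rename Var2.snd
        (toLaurent (PowerSeries.map (shift ε (-l)) (secondSeries ε σ τ))) := by
    rw [MvPowerSeries.rename_rename, secondSeries, atSum, shift, neg_neg]
    have := miwa_map (pullHom (N := N) (fun q : ℝ × ℝ => (q.1 + ((-l : ℤ) : ℝ) * ε, q.2))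
      (by fun_prop)) ε σ (atSum ((σ : ℝ) * (ε / 2)) τ)
    rw [atSum] at this
    refine Eq.trans ?_ (congrArg (fun F => MvPowerSeries.rename Var2.snd (toLaurent F)) this)
    have h2 := map_pull_map_pull (N := N) (σ := Time)
      (g := fun q : ℝ × ℝ => (q.1 + ((-l : ℤ) : ℝ) * ε, q.2))
      (h := fun q : ℝ × ℝ => q.2 + q.1 + (σ : ℝ) * (ε / 2))
      (k := fun q => g2 q - ((-σ : ℤ) : ℝ) * (ε / 2))
      (fun q => by simp only [hg2]; push_cast; ring) (by fun_prop) (by fun_prop) (by fun_prop) τ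
    exact congrArg (fun F => MvPowerSeries.rename (inSnd ∘ some) (toLaurent (miwa ε σ F))) h2.symm
  have hfd : ∀ q, fderiv ℝ g2 q (1, 0) = 1 := fun q => by
    have h1 : HasFDerivAt (fun q : ℝ × ℝ => q.1) (ContinuousLinearMap.fst ℝ ℝ ℝ) q :=
      hasFDerivAt_fst
    have h2 : HasFDerivAt (fun q : ℝ × ℝ => q.2) (ContinuousLinearMap.snd ℝ ℝ ℝ) q :=
      hasFDerivAt_snd
    have h4 : fderiv ℝ g2 q = _ := ((h2.sub_const ((l : ℝ) * ε)).add h1).fderiv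
    rw [h4]
    simp
  set y1 : Fn N (ℝ × ℝ) := scalarFn (fun q => (g1 q : ℂ)) (Complex.ofRealCLM.contDiff.comp hg1')
  set y2 : Fn N (ℝ × ℝ) := scalarFn (fun q => (g2 q : ℂ)) (Complex.ofRealCLM.contDiff.comp hg2')
  have hy : y1 - y2 = algebraMap ℂ _ ((l : ℂ) * ε) := by
    refine Fn.ext_entries fun q i j => ?_
    change (algebraMap ℂ (Matrix (Fin N) (Fin N) ℂ) (g1 q : ℂ)) i j -
      (algebraMap ℂ (Matrix (Fin N) (Fin N) ℂ) (g2 q : ℂ)) i j =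
      (algebraMap ℂ (Matrix (Fin N) (Fin N) ℂ) ((l : ℂ) * ε)) i j
    have h : (g1 q : ℂ) - (g2 q : ℂ) = (l : ℂ) * ε := by
      simp only [hg1, hg2]
      push_cast
      ring
    rw [← Matrix.sub_apply, ← map_sub, h]
  have hdy : der ((1 : ℝ), (0 : ℝ)) y2 = 1 := derZ_scalarFn hg2' hfd
  set E1 := MvPowerSeries.rename inFst (vertexExpo ε (p.sgn : ℂ) y1) with hE1
  set E2 := MvPowerSeries.rename inSnd (vertexExpo ε (p.sgn : ℂ) y2) with hE2
  have hE1m : E1 ∈ orderGE Var2 _ 1 := rename_mem_orderGE _ (vertexExpo_mem _ _ _)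
  have hE2m : E2 ∈ orderGE Var2 _ 1 := rename_mem_orderGE _ (vertexExpo_mem _ _ _)
  -- This constant multiple of `log λ` is the `w` added to `∂` when `exp(δ ∂)` passes the second
  -- vertex exponential.
  have hdE2 : derZ ((1 : ℝ), (0 : ℝ)) (((-σ : ℤ) : ℂ) • E2) =
      ((-σ : ℂ) * (1 / (ε : ℂ) * p.sgn)) • MvPowerSeries.X Var2.log := by
    rw [map_smul, hE2, derZ_rename, derZ_vertexExpo _ _ _ _ hdy, rename_complex_smul, smul_smul,
      MvPowerSeries.rename_X]
    push_cast
    rfl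
  have hkey : mapBaseHom (pullHom (diagPoint ε l) (contDiff_diagPoint ε l))
      (sharp p (vertex ε p σ τ) (vertex ε p (-σ) τ)) = _ := mapBaseHom_diag_sharp ε l p _ _
  rw [mapBaseHom_vertex ε p σ τ hg1', mapBaseHom_vertex ε p (-σ) τ hg2', map_mul, map_mul, ha, hb,
    rename_expS inFst (Submodule.smul_mem _ _ (vertexExpo_mem _ _ _)),
    rename_expS inSnd (Submodule.smul_mem _ _ (vertexExpo_mem _ _ _)), rename_complex_smul,
    rename_complex_smul, ← hE1, ← hE2,
    translate_exp_mul (Submodule.smul_mem _ _ hE2m) hdE2 (by rw [map_smul, derZ_X, smul_zero])]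
    at hkey
  -- The four exponentials collected so far combine into one that is free of logarithms.
  have hexp : expS (-((p.sgn * σ * l : ℤ) : ℂ) • MvPowerSeries.X Var2.log) *
      expS ((σ : ℂ) • E1) * expS (((-σ : ℤ) : ℂ) • E2) *
      expS (deltaZ (Fn N (ℝ × ℝ)) *
        ((-σ : ℂ) * (1 / (ε : ℂ) * p.sgn)) • MvPowerSeries.X Var2.log) =
      expS (expoZ (Fn N (ℝ × ℝ)) ((σ : ℂ) / (ε : ℂ))) := by
    have m1 : (-((p.sgn * σ * l : ℤ) : ℂ) • MvPowerSeries.X Var2.log :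
        MvPowerSeries Var2 (LaurentSeries (Fn N (ℝ × ℝ)))) ∈ orderGE Var2 _ 1 :=
      Submodule.smul_mem _ _ (X_mem_orderGE _)
    have m2 := Submodule.smul_mem _ (σ : ℂ) hE1m
    have m3 := Submodule.smul_mem _ ((-σ : ℤ) : ℂ) hE2m
    have m4 : (deltaZ (Fn N (ℝ × ℝ)) *
        ((-σ : ℂ) * (1 / (ε : ℂ) * p.sgn)) • MvPowerSeries.X Var2.log) ∈ orderGE Var2 _ 1 :=
      mul_mem_orderGE_left _ (Submodule.smul_mem _ _ (X_mem_orderGE _))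
    rw [← expS_add m1 m2, ← expS_add (add_mem m1 m2) m3,
      ← expS_add (add_mem (add_mem m1 m2) m3) m4]
    congr 1
    have hC : MvPowerSeries.C (σ := Var2) (HahnSeries.C y1 : LaurentSeries (Fn N (ℝ × ℝ))) -
        MvPowerSeries.C (HahnSeries.C y2) = ((l : ℂ) * ε) • 1 := by
      rw [← map_sub, ← map_sub, hy, Algebra.algebraMap_eq_smul_one]
      have : (HahnSeries.C (((l : ℂ) * ε) • (1 : Fn N (ℝ × ℝ))) : LaurentSeries (Fn N (ℝ × ℝ))) =
          ((l : ℂ) * ε) • 1 := by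
        ext n
        rw [laurent_coeff_smul, HahnSeries.C_apply, HahnSeries.coeff_single, HahnSeries.coeff_one]
        split_ifs
        · rfl
        · rw [smul_zero]
      rw [this, C_complex_smul, map_one]
    rw [sub_eq_iff_eq_add] at hC
    simp only [hE1, hE2, vertexExpo, rename_complex_smul, map_add, map_sub, map_mul,
      MvPowerSeries.rename_C, MvPowerSeries.rename_X, hC, expoZ, deltaZ, twoPoint,
      show inFst none = Var2.log from rfl, show inSnd none = Var2.log from rfl]
    have h := log_cancellation (e := 1 / (ε : ℂ)) (m := (l : ℂ) * ε) (l := l) (s := σ) (k := p.sgn)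
      (by field_simp) (MvPowerSeries.rename inFst (tForm fun j => ((1 : ℂ) / 2) • divZ (Fn N (ℝ × ℝ)) (j + 1)))
      (MvPowerSeries.rename inSnd (tForm fun j => ((1 : ℂ) / 2) • divZ (Fn N (ℝ × ℝ)) (j + 1)))
      (MvPowerSeries.rename inFst (sForm (divZ (Fn N (ℝ × ℝ)))))
      (MvPowerSeries.rename inSnd (sForm (divZ (Fn N (ℝ × ℝ)))))
      (MvPowerSeries.rename inFst (sForm fun j => c j • divZ (Fn N (ℝ × ℝ)) j))
      (MvPowerSeries.rename inSnd (sForm fun j => c j • divZ (Fn N (ℝ × ℝ)) j))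
      (MvPowerSeries.C (HahnSeries.C y2)) (MvPowerSeries.X Var2.log)
    rw [mul_one_div] at h
    rw [← h]
    push_cast
    rfl
  have h0 : hirota ε p σ l τ = MvPowerSeries.C (lamPow p (p.sgn * σ * l)) *
      expS (-((p.sgn * σ * l : ℤ) : ℂ) • MvPowerSeries.X Var2.log) *
      mapBaseHom (pullHom (diagPoint ε l) (contDiff_diagPoint ε l))
        (sharp p (vertex ε p σ τ) (vertex ε p (-σ) τ)) := rfl
  rw [h0, hkey, hlam, hirotaForm, ← hexp]
  ring

end NormalForm

/-! ## The Hirota equations in normal form -/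

section Equations

variable {N : ℕ}

/-- The Hirota expression at `s_0 - s_0' = l ε` in normal form. -/
def hirotaNormal (ε : ℝ) (σ l : ℤ) (τ : TauSpace N) :
    MvPowerSeries Var2 (LaurentSeries (Fn N (ℝ × ℝ))) :=
  MvPowerSeries.C (HahnSeries.single (-(σ * l)) 1) *
    hirotaForm ε σ (toLaurent (firstSeries ε σ τ)) (MvPowerSeries.rename Var2.snd
      (toLaurent (PowerSeries.map (shift ε (-l)) (secondSeries ε σ τ))))

/-- For type a the residue is the coefficient of `z` after multiplication by `z^{1-r}`; for type b
it is the coefficient of `z⁻¹` after multiplication by `z^{-r-1}`. In both cases the coefficient of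
`z^r` is picked out. -/
theorem hirotaEquations_iff (ε : ℝ) (hε : ε ≠ 0) (τ : TauSpace N) : HirotaEquations ε τ ↔
    ∀ (l : ℤ) (r : ℕ), zCoeff r (hirotaNormal ε 1 l τ) = zCoeff r (hirotaNormal ε (-1) l τ) := by
  refine forall_congr' fun l => forall_congr' fun r => ?_
  have h1 : resLam Kind.a (MvPowerSeries.C (lamPow Kind.a ((r : ℤ) - 1)) * hirota ε Kind.a 1 l τ) =
      zCoeff r (hirotaNormal ε 1 l τ) := by
    change zCoeff (Kind.sgn Kind.a) _ = _
    rw [lamPow, zCoeff_C_single_mul, hirota_eq ε hε, map_one, one_mul]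
    congr 2
    simp [Kind.sgn]
  have h2 : resLam Kind.b (MvPowerSeries.C (lamPow Kind.b (-(r : ℤ) - 1)) *
      hirota ε Kind.b (-1) l τ) = zCoeff r (hirotaNormal ε (-1) l τ) := by
    change zCoeff (Kind.sgn Kind.b) _ = _
    rw [lamPow, zCoeff_C_single_mul, hirota_eq ε hε, map_one, one_mul]
    congr 2
    simp [Kind.sgn]
  rw [h1, h2]

/-- The normal form does not see the type, so the term of type a with `σ = -1` plays the role of the
one of type b. The factor `λ⁻¹ = z` shifts the condition at `z^n`, `n > 0`, to `z^r` with `r = n - 1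
≥ 0`. -/
theorem hirotaRegular_iff (ε : ℝ) (hε : ε ≠ 0) (τ : TauSpace N) : HirotaRegular ε τ ↔
    ∀ (l : ℤ) (r : ℕ), zCoeff r (hirotaNormal ε 1 l τ) = zCoeff r (hirotaNormal ε (-1) l τ) := by
  have key : ∀ (l : ℤ) (α : Var2 →₀ ℕ) (n : ℤ), (MvPowerSeries.coeff α
      (MvPowerSeries.C (lamPow Kind.a (-1)) *
        (hirota ε Kind.a 1 l τ - hirota ε Kind.a (-1) l τ))).coeff n = MvPowerSeries.coeff α
      (zCoeff (n - 1) (hirotaNormal ε 1 l τ) - zCoeff (n - 1) (hirotaNormal ε (-1) l τ)) := by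
    intro l α n
    rw [← coeff_zCoeff, lamPow, zCoeff_C_single_mul, hirota_eq ε hε, hirota_eq ε hε, map_one,
      one_mul, ← map_sub]
    simp [Kind.sgn, hirotaNormal]
  refine forall_congr' fun l => ⟨fun h r => ?_, fun h α n hn => ?_⟩
  · rw [← sub_eq_zero]
    ext1 α
    have := h α (r + 1) (by omega)
    rwa [key, add_sub_cancel_right] at this
  · rw [key]
    obtain ⟨r, hr⟩ := Int.eq_ofNat_of_zero_le (show 0 ≤ n - 1 by omega)
    rw [hr, h, sub_self, map_zero]

end Equations

/-! ## Restriction to the diagonal -/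

/-- The map of variables that identifies the two sets of times. -/
def diagVar : Var2 → Var2
  | Var2.fst v => Var2.fst v
  | Var2.snd v => Var2.fst v
  | Var2.log => Var2.log
  | Var2.del => Var2.del

/-- The exchange of the two sets of times. -/
def swapVar : Var2 → Var2
  | Var2.fst v => Var2.snd v
  | Var2.snd v => Var2.fst v
  | Var2.log => Var2.log
  | Var2.del => Var2.del

instance : Filter.TendstoCofinite diagVar := by
  rw [Filter.tendstoCofinite_iff_finite_preimage_singleton]
  rintro (v | v | _ | _)
  · refine ((Set.finite_singleton (Var2.fst v)).union (Set.finite_singleton (Var2.snd v))).subset ?_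
    rintro (w | w | _ | _) h <;> simp_all [diagVar]
  · refine (Set.finite_empty).subset ?_
    rintro (w | w | _ | _) h <;> simp_all [diagVar]
  · refine (Set.finite_singleton Var2.log).subset ?_
    rintro (w | w | _ | _) h <;> simp_all [diagVar]
  · refine (Set.finite_singleton Var2.del).subset ?_
    rintro (w | w | _ | _) h <;> simp_all [diagVar]

section Diagonal

variable {A : Type} [CommRing A] [Algebra ℂ A]

/-- The iterated derivatives with respect to the times of the first factor. -/
def fstDerivs (L : List Time) (F : MvPowerSeries Var2 A) : MvPowerSeries Var2 A :=
  L.foldl (fun G v => MvPowerSeries.pderiv A (Var2.fst v) G) F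

/-- The weight of the variables of the first factor. -/
def fstWeight : Var2 → ℕ
  | Var2.fst _ => 1
  | _ => 0

/-- The weight of the variables of the second factor. -/
def sndWeight : Var2 → ℕ
  | Var2.snd _ => 1
  | _ => 0

theorem weight_fst_mapDomain (β : Var2 →₀ ℕ) :
    Finsupp.weight fstWeight (Finsupp.mapDomain diagVar β) =
      Finsupp.weight fstWeight β + Finsupp.weight sndWeight β := by
  simp only [Finsupp.weight_apply]
  rw [Finsupp.sum_mapDomain_index (by simp) (by intros; simp [add_mul]), ← Finsupp.sum_add]
  refine Finsupp.sum_congr fun i _ => ?_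
  rw [← smul_add]
  cases i <;> rfl

/-- On exponents without times of the first factor, `swapVar` undoes `diagVar`. -/
theorem eq_of_mapDomain_diagVar {β μ : Var2 →₀ ℕ} (hβ : Finsupp.weight fstWeight β = 0)
    (hμ : Finsupp.weight fstWeight μ = 0)
    (h : Finsupp.mapDomain diagVar β = Finsupp.mapDomain diagVar μ) : β = μ := by
  have key : ∀ γ : Var2 →₀ ℕ, Finsupp.weight fstWeight γ = 0 →
      Finsupp.mapDomain swapVar (Finsupp.mapDomain diagVar γ) = γ := by
    intro γ hγ
    rw [← Finsupp.mapDomain_comp]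
    refine (Finsupp.mapDomain_congr (g := id) fun i hi => ?_).trans Finsupp.mapDomain_id
    cases i with
    | fst v =>
      exfalso
      have := Finsupp.le_weight fstWeight (s := Var2.fst v) one_ne_zero γ
      rw [Finsupp.mem_support_iff] at hi
      omega
    | snd v => rfl
    | log => rfl
    | del => rfl
  rw [← key β hβ, h, key μ hμ]

theorem eq_zero_of_mul_succ {x : A} (k : ℕ) (h : x * ((k : A) + 1) = 0) : x = 0 := by
  have hk : ((k : ℂ) + 1) ≠ 0 := by exact_mod_cast Nat.succ_ne_zero k
  have h1 : ((k : ℂ) + 1) • x = 0 := by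
    rw [Algebra.smul_def, map_add, map_one, map_natCast, mul_comm]
    exact h
  rw [← one_smul ℂ x, ← inv_mul_cancel₀ hk, mul_smul, h1, smul_zero]

/-- A power series vanishes if the restrictions to the diagonal of all its derivatives vanish. -/
theorem eq_zero_of_diag_fstDerivs {F : MvPowerSeries Var2 A}
    (hF : ∀ L, MvPowerSeries.rename diagVar (fstDerivs L F) = 0) : F = 0 := by
  -- Strong induction on the degree `n` in the times of the second factor, and inside it induction
  -- on the degree `m` in those of the first. The statement ranges over all `F`, so that `F` can be
  -- replaced by its derivatives.
  have main : ∀ (n m : ℕ) (F : MvPowerSeries Var2 A),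
      (∀ L, MvPowerSeries.rename diagVar (fstDerivs L F) = 0) → ∀ μ : Var2 →₀ ℕ,
      Finsupp.weight sndWeight μ = n → Finsupp.weight fstWeight μ = m →
      MvPowerSeries.coeff μ F = 0 := by
    intro n
    induction n using Nat.strong_induction_on with
    | _ n ihn =>
      intro m
      induction m with
      | zero =>
        intro F hF μ hn hm
        have h0 := congrArg (MvPowerSeries.coeff (Finsupp.mapDomain diagVar μ)) (hF [])
        -- The restriction to the diagonal sums the coefficients at all `β` with the same image as
        -- `μ`. Any `β ≠ μ` contains a time of the first factor; the total degree in the times being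
        -- the same, its degree in the second times is below `n`, and the outer induction applies.
        rw [MvPowerSeries.coeff_rename, Finset.sum_eq_single μ, map_zero] at h0
        · exact h0
        · intro β hβ hne
          rw [Set.Finite.mem_toFinset, Set.mem_preimage, Set.mem_singleton_iff] at hβ
          have h1 := weight_fst_mapDomain β
          rw [hβ, weight_fst_mapDomain μ] at h1
          have h2 : Finsupp.weight fstWeight β ≠ 0 := fun h2 =>
            hne (eq_of_mapDomain_diagVar h2 hm hβ)
          exact ihn (Finsupp.weight sndWeight β) (by omega) _ F hF β rfl rfl
        · intro h
          exact absurd (by simp) h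
      | succ m ihm =>
        intro F hF μ hn hm
        have hex : ∃ v, μ (Var2.fst v) ≠ 0 := by
          by_contra hcon
          push Not at hcon
          have : Finsupp.weight fstWeight μ = 0 := by
            rw [Finsupp.weight_apply]
            refine Finset.sum_eq_zero fun i _ => ?_
            cases i with
            | fst v => rw [hcon v]; exact zero_smul _ _
            | snd v => exact smul_zero _
            | log => exact smul_zero _
            | del => exact smul_zero _
          omega
        obtain ⟨v, hv⟩ := hex
        obtain ⟨μ', rfl⟩ : ∃ μ', μ = μ' + Finsupp.single (Var2.fst v) 1 :=
          ⟨μ - Finsupp.single (Var2.fst v) 1, (tsub_add_cancel_of_le (by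
            rw [Finsupp.single_le_iff]; omega)).symm⟩
        have hw1 : Finsupp.weight sndWeight (Finsupp.single (Var2.fst v) 1) = 0 := by
          rw [Finsupp.weight_apply, Finsupp.sum_single_index (by simp)]
          rfl
        have hw2 : Finsupp.weight fstWeight (Finsupp.single (Var2.fst v) 1) = 1 := by
          rw [Finsupp.weight_apply, Finsupp.sum_single_index (by simp)]
          rfl
        rw [map_add, hw1] at hn
        rw [map_add, hw2] at hm
        -- The coefficient of the derivative at `μ'` is a positive integer multiple of the
        -- coefficient of `F` at `μ`, and positive integers are invertible.
        have := ihm (MvPowerSeries.pderiv A (Var2.fst v) F) (fun L => hF (v :: L)) μ'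
          (by omega) (by omega)
        rw [MvPowerSeries.coeff_pderiv] at this
        exact eq_zero_of_mul_succ _ this
  ext1 μ
  exact main _ _ F hF μ rfl rfl

theorem fstDerivs_sub (L : List Time) (F G : MvPowerSeries Var2 A) :
    fstDerivs L (F - G) = fstDerivs L F - fstDerivs L G := by
  induction L generalizing F G with
  | nil => rfl
  | cons v L ih =>
    have := ih (MvPowerSeries.pderiv A (Var2.fst v) F) (MvPowerSeries.pderiv A (Var2.fst v) G)
    rw [← map_sub] at this
    exact this

theorem fstDerivs_add (L : List Time) (F G : MvPowerSeries Var2 A) :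
    fstDerivs L (F + G) = fstDerivs L F + fstDerivs L G := by
  induction L generalizing F G with
  | nil => rfl
  | cons v L ih =>
    have := ih (MvPowerSeries.pderiv A (Var2.fst v) F) (MvPowerSeries.pderiv A (Var2.fst v) G)
    rw [← map_add] at this
    exact this

theorem eq_iff_diag_fstDerivs {F G : MvPowerSeries Var2 A} : F = G ↔
    ∀ L, MvPowerSeries.rename diagVar (fstDerivs L F) =
      MvPowerSeries.rename diagVar (fstDerivs L G) := by
  refine ⟨fun h L => by rw [h], fun h => sub_eq_zero.mp (eq_zero_of_diag_fstDerivs fun L => ?_)⟩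
  rw [fstDerivs_sub, map_sub, h, sub_self]

theorem zCoeff_fstDerivs (n : ℤ) (L : List Time) (F : MvPowerSeries Var2 (LaurentSeries A)) :
    zCoeff n (fstDerivs L F) = fstDerivs L (zCoeff n F) := by
  induction L generalizing F with
  | nil => rfl
  | cons v L ih =>
    have := ih (MvPowerSeries.pderiv _ (Var2.fst v) F)
    rw [zCoeff_pderiv] at this
    exact this

end Diagonal

/-! ## The rings of difference-differential operators -/

section OperatorRing

variable {N : ℕ}

/-- `∂/∂x` as a linear map. -/
def dxLin : Module.End ℂ (Coef N) where
  toFun := dx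
  map_add' F G := by
    ext1 α
    exact map_add (der ((1 : ℝ), (0 : ℝ))) _ _
  map_smul' a F := by
    ext1 α
    change der _ (MvPowerSeries.coeff α (a • F)) = MvPowerSeries.coeff α (a • dx F)
    rw [coeff_complex_smul, coeff_complex_smul, der_smul]
    rfl

theorem mapCoeff_der_mul {V : Type} [NormedAddCommGroup V] [NormedSpace ℝ V] {σ : Type} (v : V)
    (F G : MvPowerSeries σ (Fn N V)) :
    mapCoeff (der v) (F * G) = mapCoeff (der v) F * G + F * mapCoeff (der v) G := by
  classical
  ext1 α
  change der v (MvPowerSeries.coeff α (F * G)) = _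
  rw [map_add, MvPowerSeries.coeff_mul, MvPowerSeries.coeff_mul, MvPowerSeries.coeff_mul, map_sum,
    ← Finset.sum_add_distrib]
  exact Finset.sum_congr rfl fun p _ => der_mul v _ _

theorem dxLin_mul (f g : Coef N) : dxLin (f * g) = dxLin f * g + f * dxLin g :=
  mapCoeff_der_mul _ f g

theorem fderiv_shift (a : ℝ) (q v : ℝ × ℝ) :
    fderiv ℝ (fun p : ℝ × ℝ => (p.1 + a, p.2)) q v = v := by
  have h1 : HasFDerivAt (fun q : ℝ × ℝ => q.1) (ContinuousLinearMap.fst ℝ ℝ ℝ) q := hasFDerivAt_fst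
  have h2 : HasFDerivAt (fun q : ℝ × ℝ => q.2) (ContinuousLinearMap.snd ℝ ℝ ℝ) q := hasFDerivAt_snd
  have h4 : fderiv ℝ (fun p : ℝ × ℝ => (p.1 + a, p.2)) q = _ := ((h1.add_const a).prodMk h2).fderiv
  rw [h4]
  rfl

theorem mapCoeff_der_shift (ε : ℝ) (k : ℤ) (v : ℝ × ℝ) (f : Coef N) :
    mapCoeff (der v) (shift ε k f) = shift ε k (mapCoeff (der v) f) := by
  ext1 α
  exact der_pull (fun p : ℝ × ℝ => (p.1 + (k : ℝ) * ε, p.2)) (by fun_prop) _ _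
    (fun q => fderiv_shift _ q v) _

theorem dxLin_shift (ε : ℝ) (k : ℤ) (f : Coef N) : dxLin (shift ε k f) = shift ε k (dxLin f) :=
  mapCoeff_der_shift ε k _ f

theorem shift_shift (ε : ℝ) (i j : ℤ) (f : Coef N) : shift ε i (shift ε j f) = shift ε (i + j) f :=
  map_pull_map_pull (fun x => by
    refine Prod.ext ?_ rfl
    push_cast
    ring) _ _ _ f

theorem shift_zero (ε : ℝ) (f : Coef N) : shift ε 0 f = f := by
  ext1 α
  rw [shift, MvPowerSeries.coeff_map, pull_congr (g' := fun p : ℝ × ℝ => p)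
    (funext fun p => by simp) _ contDiff_id]
  rfl

theorem shift_smul (ε : ℝ) (k : ℤ) (a : ℂ) (f : Coef N) :
    shift ε k (a • f) = a • shift ε k f :=
  map_complex_smul (pullHom (fun p : ℝ × ℝ => (p.1 + (k : ℝ) * ε, p.2)) (by fun_prop)) a f

open Polynomial

/-- `∂/∂x` applied to the coefficients of a polynomial. -/
def dxPoly : Module.End ℂ (Coef N)[X] where
  toFun P := P.sum fun k f => monomial k (dxLin f)
  map_add' P Q := by
    rw [Polynomial.sum_add_index] <;> intros <;> simp
  map_smul' a P := by
    rw [Polynomial.sum_smul_index', RingHom.id_apply, Polynomial.sum, Polynomial.sum,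
      Finset.smul_sum]
    · simp only [map_smul, Polynomial.smul_monomial]
    · intros; simp

theorem dxPoly_monomial (k : ℕ) (f : Coef N) :
    dxPoly (monomial k f) = monomial k (dxLin f) := by
  change (monomial k f).sum (fun k f => monomial k (dxLin f)) = _
  rw [Polynomial.sum_monomial_index _ _ (by simp)]

/-- The symbol of left composition with `∂`. -/
def polyD : Module.End ℂ (Coef N)[X] := dxPoly + LinearMap.mulLeft ℂ X

theorem polyD_monomial (k : ℕ) (f : Coef N) :
    polyD (monomial k f) = monomial k (dxLin f) + monomial (k + 1) f := by
  rw [polyD, LinearMap.add_apply, dxPoly_monomial, LinearMap.mulLeft_apply, X_mul_monomial]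

theorem polyD_C_mul (f : Coef N) (Q : (Coef N)[X]) :
    polyD (C f * Q) = C (dxLin f) * Q + C f * polyD Q := by
  induction Q using Polynomial.induction_on' with
  | add P Q hP hQ => rw [mul_add, map_add, hP, hQ, map_add, mul_add, mul_add]; abel
  | monomial k g =>
    rw [C_mul_monomial, polyD_monomial, polyD_monomial, dxLin_mul, mul_add, C_mul_monomial,
      C_mul_monomial, C_mul_monomial, map_add]
    abel

/-- The Leibniz formula is the binomial theorem for the commuting operators `∂` on coefficients and
multiplication by `X`. -/
theorem polyD_pow_monomial (k m : ℕ) (f : Coef N) : (polyD ^ k) (monomial m f) =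
    ∑ p ∈ Finset.range (k + 1), monomial (k - p + m) ((k.choose p : Coef N) * dx^[p] f) := by
  have hc : Commute (dxPoly : Module.End ℂ (Coef N)[X]) (LinearMap.mulLeft ℂ X) := by
    refine LinearMap.ext fun Q => ?_
    induction Q using Polynomial.induction_on' with
    | add P Q hP hQ => rw [map_add, map_add, hP, hQ]
    | monomial k g =>
      simp only [Module.End.mul_apply, LinearMap.mulLeft_apply, X_mul_monomial, dxPoly_monomial]
  have h2 : ∀ (p n : ℕ) (g : Coef N), ((dxPoly : Module.End ℂ (Coef N)[X]) ^ p) (monomial n g) =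
      monomial n (dx^[p] g) := by
    intro p n g
    induction p with
    | zero => rfl
    | succ p ih =>
      rw [pow_succ', Module.End.mul_apply, ih, dxPoly_monomial, Function.iterate_succ_apply']
      rfl
  have h3 : ∀ (p n : ℕ) (g : Coef N),
      ((LinearMap.mulLeft ℂ X : Module.End ℂ (Coef N)[X]) ^ p) (monomial n g) =
      monomial (p + n) g := by
    intro p n g
    induction p with
    | zero => simp
    | succ p ih =>
      rw [pow_succ', Module.End.mul_apply, ih, LinearMap.mulLeft_apply, X_mul_monomial,
        add_right_comm]
  rw [polyD, hc.add_pow, LinearMap.sum_apply]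
  refine Finset.sum_congr rfl fun p _ => ?_
  rw [← nsmul_eq_mul', LinearMap.smul_apply, Module.End.mul_apply, h3, h2, ← nsmul_eq_mul,
    Polynomial.smul_monomial]

/-- The symbol of the composition of the operators with symbols `P` and `Q`. -/
def act (P : (Coef N)[X]) : Module.End ℂ (Coef N)[X] :=
  P.sum fun k f => LinearMap.mulLeft ℂ (C f) * polyD ^ k

theorem act_add (P Q : (Coef N)[X]) : act (P + Q) = act P + act Q := by
  rw [act, Polynomial.sum_add_index]
  · rfl
  · intro k
    exact LinearMap.ext fun Q => by simp
  · intro k f g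
    exact LinearMap.ext fun Q => by simp [Module.End.mul_apply, add_mul]

theorem act_zero : act (0 : (Coef N)[X]) = 0 := Polynomial.sum_zero_index _

theorem act_monomial (k : ℕ) (f : Coef N) (Q : (Coef N)[X]) :
    act (monomial k f) Q = C f * (polyD ^ k) Q := by
  rw [act, Polynomial.sum_monomial_index]
  · rfl
  · exact LinearMap.ext fun Q => by simp

theorem act_C (f : Coef N) (Q : (Coef N)[X]) : act (C f) Q = C f * Q := by
  rw [← monomial_zero_left, act_monomial]
  rfl

theorem act_smul (a : ℂ) (P Q : (Coef N)[X]) : act (a • P) Q = a • act P Q := by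
  induction P using Polynomial.induction_on' with
  | add P P' h h' => rw [smul_add, act_add, act_add, LinearMap.add_apply, h, h',
      LinearMap.add_apply, smul_add]
  | monomial k f => rw [Polynomial.smul_monomial, act_monomial, act_monomial, ← smul_C,
      smul_mul_assoc]

theorem act_C_mul (f : Coef N) (P Q : (Coef N)[X]) : act (C f * P) Q = C f * act P Q := by
  induction P using Polynomial.induction_on' with
  | add P P' h h' => rw [mul_add, act_add, act_add, LinearMap.add_apply, h, h',
      LinearMap.add_apply, mul_add]
  | monomial k g => rw [C_mul_monomial, act_monomial, act_monomial, C_mul, mul_assoc]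

theorem act_polyD (P Q : (Coef N)[X]) : act (polyD P) Q = polyD (act P Q) := by
  induction P using Polynomial.induction_on' with
  | add P P' h h' => rw [map_add, act_add, act_add, LinearMap.add_apply, h, h',
      LinearMap.add_apply, map_add]
  | monomial k g =>
    rw [polyD_monomial, act_add, LinearMap.add_apply, act_monomial, act_monomial, act_monomial,
      polyD_C_mul, pow_succ', Module.End.mul_apply]

/-- Composition of symbols is associative because it is compatible with the two generating
operations: multiplication by functions (`act_C_mul`) and composition with `∂` (`act_polyD`). -/
theorem act_act (P Q H : (Coef N)[X]) : act (act P Q) H = act P (act Q H) := by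
  induction P using Polynomial.induction_on' with
  | add P P' h h' => rw [act_add, LinearMap.add_apply, act_add, LinearMap.add_apply, h, h',
      LinearMap.add_apply]
  | monomial k f =>
    rw [act_monomial, act_monomial, act_C_mul]
    congr 1
    induction k with
    | zero => rfl
    | succ k ih => rw [pow_succ', Module.End.mul_apply, act_polyD, ih, Module.End.mul_apply]

/-- The shift of the coefficients. -/
def shiftPoly (ε : ℝ) (i : ℤ) : (Coef N)[X] →+* (Coef N)[X] := Polynomial.mapRingHom (shift ε i)

theorem shiftPoly_monomial (ε : ℝ) (i : ℤ) (k : ℕ) (f : Coef N) :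
    shiftPoly ε i (monomial k f) = monomial k (shift ε i f) :=
  Polynomial.map_monomial _

theorem shiftPoly_C (ε : ℝ) (i : ℤ) (f : Coef N) : shiftPoly ε i (C f) = C (shift ε i f) :=
  Polynomial.map_C _

theorem shiftPoly_polyD (ε : ℝ) (i : ℤ) (Q : (Coef N)[X]) :
    shiftPoly ε i (polyD Q) = polyD (shiftPoly ε i Q) := by
  induction Q using Polynomial.induction_on' with
  | add P Q hP hQ => rw [map_add, map_add, hP, hQ, map_add, map_add]
  | monomial k g =>
    rw [polyD_monomial, map_add, shiftPoly_monomial, shiftPoly_monomial, shiftPoly_monomial,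
      polyD_monomial, dxLin_shift]

theorem shiftPoly_act (ε : ℝ) (i : ℤ) (P Q : (Coef N)[X]) :
    shiftPoly ε i (act P Q) = act (shiftPoly ε i P) (shiftPoly ε i Q) := by
  induction P using Polynomial.induction_on' with
  | add P P' h h' => rw [act_add, LinearMap.add_apply, map_add, h, h', map_add, act_add,
      LinearMap.add_apply]
  | monomial k f =>
    rw [act_monomial, map_mul, shiftPoly_C, shiftPoly_monomial, act_monomial]
    congr 1
    induction k with
    | zero => rfl
    | succ k ih =>
      rw [pow_succ', Module.End.mul_apply, Module.End.mul_apply, shiftPoly_polyD, ih]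

theorem shiftPoly_shiftPoly (ε : ℝ) (i j : ℤ) (Q : (Coef N)[X]) :
    shiftPoly ε i (shiftPoly ε j Q) = shiftPoly ε (i + j) Q := by
  induction Q using Polynomial.induction_on' with
  | add P Q hP hQ => rw [map_add, map_add, hP, hQ, map_add]
  | monomial k g =>
    rw [shiftPoly_monomial, shiftPoly_monomial, shiftPoly_monomial, shift_shift]

theorem shiftPoly_zero (ε : ℝ) (Q : (Coef N)[X]) : shiftPoly ε 0 Q = Q := by
  induction Q using Polynomial.induction_on' with
  | add P Q hP hQ => rw [map_add, hP, hQ]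
  | monomial k g => rw [shiftPoly_monomial, shift_zero]

theorem shiftPoly_smul (ε : ℝ) (i : ℤ) (a : ℂ) (Q : (Coef N)[X]) :
    shiftPoly ε i (a • Q) = a • shiftPoly ε i Q := by
  induction Q using Polynomial.induction_on' with
  | add P Q hP hQ => rw [smul_add, map_add, hP, hQ, map_add, smul_add]
  | monomial k g =>
    rw [Polynomial.smul_monomial, shiftPoly_monomial, shiftPoly_monomial, shift_smul,
      Polynomial.smul_monomial]

/-- Replaces the explicit Leibniz sum in `comp` by the structural composition of symbols, from which
the ring axioms follow. -/
theorem comp_eq_finsum (ε : ℝ) (F G : Op N) (n : ℤ) :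
    comp ε F G n = ∑ᶠ i : ℤ, act (F i) (shiftPoly ε i (G (n - i))) := by
  refine finsum_congr fun i => ?_
  generalize F i = P
  generalize G (n - i) = Q
  rw [act, Polynomial.sum, Polynomial.sum, LinearMap.sum_apply]
  refine Finset.sum_congr rfl fun k _ => ?_
  generalize P.coeff k = f
  rw [Module.End.mul_apply, LinearMap.mulLeft_apply]
  conv_rhs => rw [← Polynomial.sum_monomial_eq Q]
  rw [Polynomial.sum, Polynomial.sum, map_sum, map_sum, Finset.mul_sum]
  refine Finset.sum_congr rfl fun m _ => ?_
  rw [shiftPoly_monomial, polyD_pow_monomial, Finset.mul_sum]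
  refine Finset.sum_congr rfl fun p _ => ?_
  have hit : shift ε i (dx^[p] (Q.coeff m)) = dx^[p] (shift ε i (Q.coeff m)) := by
    clear * -
    induction p with
    | zero => rfl
    | succ p ih =>
      rw [Function.iterate_succ_apply', Function.iterate_succ_apply', ← ih]
      exact (dxLin_shift ε i _).symm
  rw [C_mul_monomial, hit]
  congr 1
  ring

theorem comp_eq_sum (ε : ℝ) {F G : Op N} {n : ℤ} (s : Finset ℤ)
    (h : ∀ i, i ∉ s → F i = 0 ∨ G (n - i) = 0) :
    comp ε F G n = ∑ i ∈ s, act (F i) (shiftPoly ε i (G (n - i))) := by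
  rw [comp_eq_finsum]
  refine finsum_eq_sum_of_support_subset _ fun i hi => ?_
  by_contra hs
  rcases h i hs with h | h
  · exact hi (by simp only [h, act_zero, LinearMap.zero_apply])
  · exact hi (by simp only [h, map_zero])

end OperatorRing

/-! ### Rings of operators with support bounded on one side -/

section BoundedOperators

variable {N : ℕ} {ε : ℝ} {σ : ℤˣ}

open Polynomial

/-- The operators whose support is bounded in the direction `σ`: bounded above for `σ = 1` and
bounded below for `σ = -1`. -/
def bddOps (N : ℕ) (σ : ℤˣ) : Submodule ℂ (Op N) where
  carrier := {F | ∃ M : ℕ, ∀ n : ℤ, (M : ℤ) < σ * n → F n = 0}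
  zero_mem' := ⟨0, fun _ _ => rfl⟩
  add_mem' := by
    rintro F G ⟨a, ha⟩ ⟨b, hb⟩
    refine ⟨a + b, fun n hn => ?_⟩
    rw [Pi.add_apply, ha n (by omega), hb n (by omega), add_zero]
  smul_mem' := by
    rintro c F ⟨a, ha⟩
    refine ⟨a, fun n hn => ?_⟩
    rw [Pi.smul_apply, ha n hn, smul_zero]

/-- The bound on `F` limits `i` on one side, and the bound on `G` at `n - i` limits it on the other.
-/
theorem finite_support_pairs {F G : Op N} (hF : F ∈ bddOps N σ) (hG : G ∈ bddOps N σ) (n : ℤ) :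
    {i : ℤ | F i ≠ 0 ∧ G (n - i) ≠ 0}.Finite := by
  obtain ⟨a, ha⟩ := hF
  obtain ⟨b, hb⟩ := hG
  refine (Set.finite_Icc (-(a + b + |n|) : ℤ) (a + b + |n|)).subset fun i hi => ?_
  have h1 : ¬ (a : ℤ) < σ * i := fun h => hi.1 (ha i h)
  have h2 : ¬ (b : ℤ) < σ * (n - i) := fun h => hi.2 (hb _ h)
  have h3 := abs_le.mp (le_refl |n|)
  rw [Set.mem_Icc]
  rcases Int.units_eq_one_or σ with rfl | rfl
  · simp only [Units.val_one, one_mul] at h1 h2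
    constructor <;> omega
  · simp only [Units.val_neg, Units.val_one, neg_mul, one_mul] at h1 h2
    constructor <;> omega

theorem comp_mem_bddOps {F G : Op N} (hF : F ∈ bddOps N σ) (hG : G ∈ bddOps N σ) :
    comp ε F G ∈ bddOps N σ := by
  obtain ⟨a, ha⟩ := hF
  obtain ⟨b, hb⟩ := hG
  refine ⟨a + b, fun n hn => ?_⟩
  rw [comp_eq_sum ε ∅, Finset.sum_empty]
  intro i _
  by_cases h : (a : ℤ) < σ * i
  · exact Or.inl (ha i h)
  · refine Or.inr (hb _ ?_)
    rw [mul_sub]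
    push_cast at hn
    omega

theorem finite_support_comp {F G : Op N} {n : ℤ}
    (h : {i : ℤ | F i ≠ 0 ∧ G (n - i) ≠ 0}.Finite) :
    (Function.support fun i : ℤ => act (F i) (shiftPoly ε i (G (n - i)))).Finite := by
  refine h.subset fun i hi => ⟨fun h0 => hi ?_, fun h0 => hi ?_⟩
  · simp only [h0, act_zero, LinearMap.zero_apply]
  · simp only [h0, map_zero]

theorem comp_add_right_of_finite {F G H : Op N}
    (h1 : ∀ n, {i : ℤ | F i ≠ 0 ∧ G (n - i) ≠ 0}.Finite)
    (h2 : ∀ n, {i : ℤ | F i ≠ 0 ∧ H (n - i) ≠ 0}.Finite) :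
    comp ε F (G + H) = comp ε F G + comp ε F H := by
  funext n
  rw [Pi.add_apply, comp_eq_finsum, comp_eq_finsum, comp_eq_finsum,
    ← finsum_add_distrib (finite_support_comp (h1 n)) (finite_support_comp (h2 n))]
  exact finsum_congr fun i => by rw [Pi.add_apply, map_add, map_add]

theorem comp_add_left_of_finite {F G H : Op N}
    (h1 : ∀ n, {i : ℤ | F i ≠ 0 ∧ H (n - i) ≠ 0}.Finite)
    (h2 : ∀ n, {i : ℤ | G i ≠ 0 ∧ H (n - i) ≠ 0}.Finite) :
    comp ε (F + G) H = comp ε F H + comp ε G H := by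
  funext n
  rw [Pi.add_apply, comp_eq_finsum, comp_eq_finsum, comp_eq_finsum,
    ← finsum_add_distrib (finite_support_comp (h1 n)) (finite_support_comp (h2 n))]
  exact finsum_congr fun i => by rw [Pi.add_apply, act_add, LinearMap.add_apply]

theorem comp_smul_right (a : ℂ) (F G : Op N) : comp ε F (a • G) = a • comp ε F G := by
  funext n
  rw [Pi.smul_apply, comp_eq_finsum, comp_eq_finsum]
  rw [smul_finsum]
  exact finsum_congr fun i => by rw [Pi.smul_apply, shiftPoly_smul, map_smul]

theorem comp_smul_left (a : ℂ) (F G : Op N) : comp ε (a • F) G = a • comp ε F G := by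
  funext n
  rw [Pi.smul_apply, comp_eq_finsum, comp_eq_finsum, smul_finsum]
  exact finsum_congr fun i => by rw [Pi.smul_apply, act_smul]

/-- Both sides are iterated sums of the same terms `T i j`, with exponents `j`, `i - j`, `n - i` in
the three factors. The family has finite support because all three factors are bounded in the same
direction, so the sums may be exchanged. -/
theorem comp_assoc {F G H : Op N} (hF : F ∈ bddOps N σ) (hG : G ∈ bddOps N σ)
    (hH : H ∈ bddOps N σ) : comp ε (comp ε F G) H = comp ε F (comp ε G H) := by
  funext n
  set T : ℤ → ℤ → (Coef N)[X] := fun i j =>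
    act (F j) (shiftPoly ε j (act (G (i - j)) (shiftPoly ε (i - j) (H (n - i))))) with hT
  have hfin : (Function.support (fun p : ℤ × ℤ => T p.1 p.2)).Finite := by
    obtain ⟨a, ha⟩ := hF
    obtain ⟨b, hb⟩ := hG
    obtain ⟨c, hc⟩ := hH
    refine ((Set.finite_Icc (-(a + b + c + |n|) : ℤ) (a + b + c + |n|)).prod
      (Set.finite_Icc (-(a + b + c + |n|) : ℤ) (a + b + c + |n|))).subset fun p hp => ?_
    have h1 : ¬ (a : ℤ) < σ * p.2 := fun h => hp (by
      simp only [hT, ha _ h, act_zero, LinearMap.zero_apply])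
    have h2 : ¬ (b : ℤ) < σ * (p.1 - p.2) := fun h => hp (by
      simp only [hT, hb _ h, act_zero, LinearMap.zero_apply, map_zero])
    have h3 : ¬ (c : ℤ) < σ * (n - p.1) := fun h => hp (by
      simp only [hT, hc _ h, map_zero])
    have h4 := abs_le.mp (le_refl |n|)
    rw [Set.mem_prod, Set.mem_Icc, Set.mem_Icc]
    rcases Int.units_eq_one_or σ with rfl | rfl
    · simp only [Units.val_one, one_mul] at h1 h2 h3
      refine ⟨⟨?_, ?_⟩, ?_, ?_⟩ <;> omega
    · simp only [Units.val_neg, Units.val_one, neg_mul, one_mul] at h1 h2 h3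
      refine ⟨⟨?_, ?_⟩, ?_, ?_⟩ <;> omega
  have hl : comp ε (comp ε F G) H n = ∑ᶠ i, ∑ᶠ j, T i j := by
    rw [comp_eq_finsum]
    refine finsum_congr fun i => ?_
    let f : (Coef N)[X] →+ (Coef N)[X] :=
      { toFun := fun P => act P (shiftPoly ε i (H (n - i)))
        map_zero' := by rw [act_zero, LinearMap.zero_apply]
        map_add' := fun P Q => by rw [act_add, LinearMap.add_apply] }
    change f (comp ε F G i) = _
    rw [comp_eq_finsum, f.map_finsum (finite_support_comp (finite_support_pairs hF hG i))]
    refine finsum_congr fun j => ?_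
    change act (act (F j) (shiftPoly ε j (G (i - j)))) (shiftPoly ε i (H (n - i))) = _
    rw [hT, act_act]
    simp only [shiftPoly_act, shiftPoly_shiftPoly, add_sub_cancel]
  have hr : comp ε F (comp ε G H) n = ∑ᶠ j, ∑ᶠ i, T i j := by
    rw [comp_eq_finsum]
    refine finsum_congr fun j => ?_
    let f : (Coef N)[X] →+ (Coef N)[X] :=
      (act (F j)).toAddMonoidHom.comp (shiftPoly ε j).toAddMonoidHom
    change f (comp ε G H (n - j)) = _
    -- The exponent of `G` is `k = i - j`; the inner sum is reindexed by `i = k + j`.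
    rw [comp_eq_finsum, f.map_finsum (finite_support_comp (finite_support_pairs hG hH (n - j))),
      ← finsum_comp_equiv (Equiv.addRight j) (f := fun i => T i j)]
    refine finsum_congr fun k => ?_
    change act (F j) (shiftPoly ε j _) = T (k + j) j
    simp only [hT, sub_sub, add_comm k j, add_sub_cancel_left]
  have hfin' : (Function.support (fun p : ℤ × ℤ => T p.2 p.1)).Finite :=
    (hfin.preimage (Prod.swap_injective.injOn)).subset fun p hp => hp
  rw [hl, hr, ← finsum_curry _ hfin, ← finsum_curry _ hfin',
    ← finsum_comp_equiv (Equiv.prodComm ℤ ℤ)]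
  rfl

theorem act_one (P : (Coef N)[X]) : act P 1 = P := by
  induction P using Polynomial.induction_on' with
  | add P P' h h' => rw [act_add, LinearMap.add_apply, h, h']
  | monomial k f =>
    rw [act_monomial]
    have hx : dxLin (1 : Coef N) = 0 := by simpa using dxLin_mul (1 : Coef N) 1
    have : (polyD ^ k) (1 : (Coef N)[X]) = monomial k 1 := by
      induction k with
      | zero => rfl
      | succ k ih => rw [pow_succ', Module.End.mul_apply, ih, polyD_monomial, hx, map_zero, zero_add]
    rw [this, C_mul_monomial, mul_one]

/-- Left multiplication with a function times a power of `Λ`. -/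
theorem term_comp (f : Coef N) (k : ℕ) (m : ℤ) (G : Op N) (n : ℤ) :
    comp ε (term f k m) G n = C f * (polyD ^ k) (shiftPoly ε m (G (n - m))) := by
  rw [comp_eq_sum ε {m}, Finset.sum_singleton]
  · rw [term, if_pos rfl, act_monomial]
  · intro i hi
    rw [Finset.mem_singleton] at hi
    exact Or.inl (if_neg hi)

theorem comp_term (F : Op N) (f : Coef N) (k : ℕ) (m n : ℤ) :
    comp ε F (term f k m) n = act (F (n - m)) (monomial k (shift ε (n - m) f)) := by
  rw [comp_eq_sum ε {n - m}, Finset.sum_singleton]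
  · rw [term, sub_sub_cancel, if_pos rfl, shiftPoly_monomial]
  · intro i hi
    rw [Finset.mem_singleton] at hi
    exact Or.inr (if_neg (by omega))

theorem one_comp (G : Op N) : comp ε one G = G := by
  funext n
  rw [one, term_comp, sub_zero, shiftPoly_zero, C_1, one_mul]
  rfl

theorem comp_one (F : Op N) : comp ε F one = F := by
  funext n
  rw [one, comp_term, sub_zero, map_one]
  exact act_one _

theorem term_mem_bddOps (f : Coef N) (k : ℕ) (m : ℤ) : term f k m ∈ bddOps N σ := by
  refine ⟨(σ * m).natAbs, fun n hn => if_neg ?_⟩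
  rintro rfl
  omega

/-- The ring of operators whose support is bounded in the direction `σ`. -/
def BOp (N : ℕ) (_ε : ℝ) (σ : ℤˣ) : Type := bddOps N σ

instance : AddCommGroup (BOp N ε σ) := inferInstanceAs (AddCommGroup (bddOps N σ))

instance : Module ℂ (BOp N ε σ) := inferInstanceAs (Module ℂ (bddOps N σ))

/-- The underlying operator. -/
def BOp.op : BOp N ε σ →ₗ[ℂ] Op N := (bddOps N σ).subtype

/-- A bounded operator as an element of the ring. -/
def BOp.mk (F : Op N) (h : F ∈ bddOps N σ) : BOp N ε σ := ⟨F, h⟩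

@[simp]
theorem BOp.op_mk (F : Op N) (h : F ∈ bddOps N σ) : (BOp.mk F h : BOp N ε σ).op = F := rfl

theorem BOp.op_mem (x : BOp N ε σ) : x.op ∈ bddOps N σ := x.2

theorem BOp.ext {x y : BOp N ε σ} (h : x.op = y.op) : x = y := Subtype.ext h

instance : Mul (BOp N ε σ) := ⟨fun x y => BOp.mk (comp ε x.op y.op) (comp_mem_bddOps x.2 y.2)⟩

instance : One (BOp N ε σ) := ⟨BOp.mk one (term_mem_bddOps _ _ _)⟩

@[simp]
theorem BOp.op_mul (x y : BOp N ε σ) : (x * y).op = comp ε x.op y.op := rfl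

@[simp]
theorem BOp.op_one : (1 : BOp N ε σ).op = one := rfl

instance : Ring (BOp N ε σ) :=
  { (inferInstance : AddCommGroup (BOp N ε σ)) with
    mul_assoc := fun x y z => BOp.ext (comp_assoc x.2 y.2 z.2)
    one_mul := fun x => BOp.ext (one_comp _)
    mul_one := fun x => BOp.ext (comp_one _)
    left_distrib := fun x y z => BOp.ext (comp_add_right_of_finite
      (finite_support_pairs x.2 y.2) (finite_support_pairs x.2 z.2))
    right_distrib := fun x y z => BOp.ext (comp_add_left_of_finite
      (finite_support_pairs x.2 z.2) (finite_support_pairs y.2 z.2))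
    zero_mul := fun x => BOp.ext (by
      have := comp_smul_left (ε := ε) 0 (0 : Op N) x.op
      rwa [zero_smul, zero_smul] at this)
    mul_zero := fun x => BOp.ext (by
      have := comp_smul_right (ε := ε) 0 x.op (0 : Op N)
      rwa [zero_smul, zero_smul] at this) }

instance : Algebra ℂ (BOp N ε σ) := Algebra.ofModule
  (fun a x y => BOp.ext (comp_smul_left a x.op y.op))
  (fun a x y => BOp.ext (comp_smul_right a x.op y.op))

theorem smulOp_eq (a : ℂ) (F : Op N) : smulOp a F = a • F := by
  funext n
  rw [smulOp, Pi.smul_apply, Algebra.algebraMap_eq_smul_one, C_complex_smul, map_one, ← smul_C,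
    smul_mul_assoc, C_1, one_mul]

theorem BOp.op_pow (x : BOp N ε σ) (n : ℕ) : (x ^ n).op = power ε x.op n := by
  induction n with
  | zero => rw [pow_zero]; rfl
  | succ n ih => rw [pow_succ, BOp.op_mul, ih]; rfl

end BoundedOperators

/-! ## Derivations of the rings of operators -/

section OperatorDerivations

variable {N : ℕ} {ε : ℝ} {σ : ℤˣ}

open Polynomial

/-- A linear map applied to the coefficients of a polynomial. -/
def mapPoly (d : Module.End ℂ (Coef N)) : Module.End ℂ (Coef N)[X] where
  toFun P := P.sum fun k f => monomial k (d f)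
  map_add' P Q := by
    rw [Polynomial.sum_add_index] <;> intros <;> simp
  map_smul' a P := by
    rw [Polynomial.sum_smul_index', RingHom.id_apply, Polynomial.sum, Polynomial.sum,
      Finset.smul_sum]
    · simp only [map_smul, Polynomial.smul_monomial]
    · intros; simp

theorem mapPoly_monomial (d : Module.End ℂ (Coef N)) (k : ℕ) (f : Coef N) :
    mapPoly d (monomial k f) = monomial k (d f) := by
  change (monomial k f).sum (fun k f => monomial k (d f)) = _
  rw [Polynomial.sum_monomial_index _ _ (by simp)]

/-- A derivation of the coefficients that commutes with `∂` and `Λ`. -/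
structure IsCoefDer (ε : ℝ) (d : Module.End ℂ (Coef N)) : Prop where
  mul : ∀ f g, d (f * g) = d f * g + f * d g
  dx : ∀ f, d (dxLin f) = dxLin (d f)
  shift : ∀ i f, d (shift ε i f) = shift ε i (d f)

theorem mapPoly_act {d : Module.End ℂ (Coef N)} (hd : IsCoefDer ε d) (P Q : (Coef N)[X]) :
    mapPoly d (act P Q) = act (mapPoly d P) Q + act P (mapPoly d Q) := by
  have hC : ∀ (f : Coef N) (H : (Coef N)[X]),
      mapPoly d (C f * H) = C (d f) * H + C f * mapPoly d H := by
    intro f H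
    induction H using Polynomial.induction_on' with
    | add P Q hP hQ => rw [mul_add, map_add, hP, hQ, map_add, mul_add, mul_add]; abel
    | monomial k g =>
      rw [C_mul_monomial, mapPoly_monomial, mapPoly_monomial, hd.mul, C_mul_monomial,
        C_mul_monomial, map_add]
  have hD : ∀ H : (Coef N)[X], mapPoly d (polyD H) = polyD (mapPoly d H) := by
    intro H
    induction H using Polynomial.induction_on' with
    | add P Q hP hQ => rw [map_add, map_add, hP, hQ, map_add, map_add]
    | monomial k g =>
      rw [polyD_monomial, map_add, mapPoly_monomial, mapPoly_monomial, mapPoly_monomial,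
        polyD_monomial, hd.dx]
  induction P using Polynomial.induction_on' with
  | add P P' h h' =>
    rw [act_add, LinearMap.add_apply, map_add, h, h', map_add, act_add, LinearMap.add_apply,
      LinearMap.add_apply]
    abel
  | monomial k f =>
    rw [mapPoly_monomial, act_monomial, act_monomial, act_monomial, hC]
    congr 2
    induction k with
    | zero => rfl
    | succ k ih => rw [pow_succ', Module.End.mul_apply, hD, ih, Module.End.mul_apply]

theorem mapPoly_shiftPoly {d : Module.End ℂ (Coef N)} (hd : IsCoefDer ε d) (i : ℤ)
    (Q : (Coef N)[X]) : mapPoly d (shiftPoly ε i Q) = shiftPoly ε i (mapPoly d Q) := by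
  induction Q using Polynomial.induction_on' with
  | add P Q hP hQ => rw [map_add, map_add, hP, hQ, map_add, map_add]
  | monomial k g =>
    rw [shiftPoly_monomial, mapPoly_monomial, mapPoly_monomial, shiftPoly_monomial, hd.shift]

/-- A derivation of the coefficients, applied to operators. -/
def BOp.der (d : Module.End ℂ (Coef N)) : BOp N ε σ →ₗ[ℂ] BOp N ε σ where
  toFun x := BOp.mk (fun n => mapPoly d (x.op n)) (by
    obtain ⟨a, ha⟩ := x.op_mem
    exact ⟨a, fun n hn => by simp only [ha n hn, map_zero]⟩)
  map_add' x y := BOp.ext (funext fun n => map_add (mapPoly d) _ _)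
  map_smul' a x := BOp.ext (funext fun n => map_smul (mapPoly d) _ _)

theorem BOp.op_der (d : Module.End ℂ (Coef N)) (x : BOp N ε σ) : (x.der d).op = mapOp d x.op := rfl

theorem BOp.der_mul {d : Module.End ℂ (Coef N)} (hd : IsCoefDer ε d) (x y : BOp N ε σ) :
    (x * y).der d = x.der d * y + x * y.der d := by
  refine BOp.ext (funext fun n => ?_)
  have hfin := finite_support_comp (ε := ε) (finite_support_pairs x.op_mem y.op_mem n)
  rw [map_add, Pi.add_apply, op_mul, op_mul, comp_eq_finsum, comp_eq_finsum,
    ← finsum_add_distrib (finite_support_comp (finite_support_pairs (x.der d).op_mem y.op_mem n))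
      (finite_support_comp (finite_support_pairs x.op_mem (y.der d).op_mem n))]
  change mapPoly d ((x * y).op n) = _
  rw [op_mul, comp_eq_finsum]
  refine ((mapPoly d).toAddMonoidHom.map_finsum hfin).trans (finsum_congr fun i => ?_)
  change mapPoly d _ = act (mapPoly d (x.op i)) _ + act _ (shiftPoly ε i (mapPoly d (y.op (n - i))))
  rw [mapPoly_act hd, mapPoly_shiftPoly hd]

/-- The derivation with respect to a formal time. -/
def timeDer (v : Time) : Module.End ℂ (Coef N) :=
  (MvPowerSeries.pderiv (Fn N (ℝ × ℝ)) v).toLinearMap.restrictScalars ℂ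

theorem timeDer_apply (v : Time) (f : Coef N) :
    timeDer v f = MvPowerSeries.pderiv (Fn N (ℝ × ℝ)) v f := rfl

theorem pderiv_mapCoeff_der {V σ' : Type} [NormedAddCommGroup V] [NormedSpace ℝ V] (v : σ') (w : V)
    (f : MvPowerSeries σ' (Fn N V)) : MvPowerSeries.pderiv _ v (mapCoeff (EZTH.der w) f) =
      mapCoeff (EZTH.der w) (MvPowerSeries.pderiv _ v f) := by
  ext1 α
  change _ = EZTH.der w (MvPowerSeries.coeff α (MvPowerSeries.pderiv _ v f))
  rw [MvPowerSeries.coeff_pderiv, MvPowerSeries.coeff_pderiv, ← Nat.cast_succ, ← nsmul_eq_mul',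
    ← nsmul_eq_mul', map_nsmul]
  rfl

theorem isCoefDer_timeDer (v : Time) : IsCoefDer ε (timeDer v : Module.End ℂ (Coef N)) where
  mul f g := by
    rw [timeDer_apply, Derivation.leibniz, smul_eq_mul, smul_eq_mul, timeDer_apply, timeDer_apply]
    ring
  dx f := pderiv_mapCoeff_der v _ f
  shift i f := (map_pderiv _ v f).symm

/-- The multiplication operator with a function. -/
def fnOp (f : Coef N) : BOp N ε σ := BOp.mk (term f 0 0) (term_mem_bddOps _ _ _)

/-- The operator `Λ^m`. -/
def lamOp (m : ℤ) : BOp N ε σ := BOp.mk (term 1 0 m) (term_mem_bddOps _ _ _)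

/-- The operator `∂`. -/
def delOp : BOp N ε σ := BOp.mk (term 1 1 0) (term_mem_bddOps _ _ _)

theorem op_fnOp_mul (f : Coef N) (x : BOp N ε σ) (n : ℤ) : (fnOp f * x).op n = C f * x.op n := by
  rw [BOp.op_mul, fnOp, BOp.op_mk, term_comp, shiftPoly_zero, sub_zero]
  rfl

theorem op_mul_lamOp (x : BOp N ε σ) (m n : ℤ) : (x * lamOp m).op n = x.op (n - m) := by
  rw [BOp.op_mul, lamOp, BOp.op_mk, comp_term, map_one]
  exact act_one _

theorem op_delOp_mul (x : BOp N ε σ) (n : ℤ) : (delOp * x).op n = polyD (x.op n) := by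
  rw [BOp.op_mul, delOp, BOp.op_mk, term_comp, shiftPoly_zero, sub_zero, C_1, one_mul, pow_one]

theorem op_mul_delOp (x : BOp N ε σ) (n : ℤ) : (x * delOp).op n = act (x.op n) X := by
  rw [BOp.op_mul, delOp, BOp.op_mk, comp_term, map_one, sub_zero, monomial_one_one_eq_X]

theorem op_lamOp_mul (x : BOp N ε σ) (m n : ℤ) :
    (lamOp m * x).op n = shiftPoly ε m (x.op (n - m)) := by
  rw [BOp.op_mul, lamOp, BOp.op_mk, term_comp, C_1, one_mul]
  rfl

theorem fnOp_mul_fnOp (f g : Coef N) : (fnOp f * fnOp g : BOp N ε σ) = fnOp (f * g) := by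
  refine BOp.ext (funext fun n => ?_)
  rw [op_fnOp_mul, fnOp, fnOp, BOp.op_mk, BOp.op_mk, term, term]
  split_ifs
  · rw [C_mul_monomial]
  · rw [mul_zero]

theorem fnOp_one : (fnOp 1 : BOp N ε σ) = 1 := rfl

theorem lamOp_zero : (lamOp 0 : BOp N ε σ) = 1 := rfl

theorem lamOp_add (m n : ℤ) : (lamOp (m + n) : BOp N ε σ) = lamOp m * lamOp n := by
  refine BOp.ext (funext fun k => ?_)
  rw [op_mul_lamOp, lamOp, lamOp, BOp.op_mk, BOp.op_mk, term, term]
  simp only [sub_eq_iff_eq_add]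

theorem lamOp_mul_delOp (m : ℤ) : (lamOp m * delOp : BOp N ε σ) = delOp * lamOp m := by
  refine BOp.ext (funext fun n => ?_)
  rw [op_delOp_mul, op_lamOp_mul, delOp, lamOp, BOp.op_mk, BOp.op_mk, term, term]
  have hx : dxLin (1 : Coef N) = 0 := by simpa using dxLin_mul (1 : Coef N) 1
  by_cases h : n = m
  · rw [if_pos (by omega), if_pos h, shiftPoly_monomial, polyD_monomial, hx, map_one, map_zero,
      zero_add]
  · rw [if_neg (by omega), if_neg h, map_zero, map_zero]

theorem der_delOp (d : Module.End ℂ (Coef N)) (hd : IsCoefDer ε d) :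
    (delOp : BOp N ε σ).der d = 0 := by
  refine BOp.ext (funext fun n => ?_)
  have h1 : d 1 = 0 := by simpa using hd.mul 1 1
  change mapPoly d (term 1 1 0 n) = 0
  rw [term]
  split_ifs
  · rw [mapPoly_monomial, h1, map_zero]
  · rw [map_zero]

/-! ### The flows of the wave operators -/

/-- The part without `∂` of the generator of the flow of a time. -/
def flowE (ε : ℝ) (σ : ℤˣ) : Time → BOp N ε σ
  | Time.t j => (((σ : ℤ) : ℂ) / ε / 2 * (1 / ((j + 1).factorial : ℂ))) • lamOp (σ * (j + 1 : ℕ))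
  | Time.s j => (-(((σ : ℤ) : ℂ) / ε * c (j + 1) * (1 / ((j + 1).factorial : ℂ)))) •
      lamOp (σ * (j + 1 : ℕ))

/-- The part with `∂` of the generator of the flow of a time. -/
def flowD (ε : ℝ) (σ : ℤˣ) : Time → BOp N ε σ
  | Time.t _ => 0
  | Time.s j => ((1 : ℂ) / ((j + 1).factorial : ℂ)) • lamOp (σ * (j + 1 : ℕ))

/-- The generator of the flow of a time for the wave operators. -/
def flow (ε : ℝ) (σ : ℤˣ) (v : Time) : BOp N ε σ := flowE ε σ v + flowD ε σ v * delOp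

theorem flowE_mul_delOp (v : Time) :
    (flowE ε σ v * delOp : BOp N ε σ) = delOp * flowE ε σ v := by
  cases v <;> simp only [flowE, smul_mul_assoc, mul_smul_comm, lamOp_mul_delOp]

theorem flowD_mul_delOp (v : Time) :
    (flowD ε σ v * delOp : BOp N ε σ) = delOp * flowD ε σ v := by
  cases v <;> simp only [flowD, smul_mul_assoc, mul_smul_comm, lamOp_mul_delOp, zero_mul, mul_zero]

theorem flow_mul_delOp (v : Time) : (flow ε σ v * delOp : BOp N ε σ) = delOp * flow ε σ v := by
  rw [flow, add_mul, mul_add, flowE_mul_delOp, ← mul_assoc delOp, flowD_mul_delOp]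

/-- The derivative of `X W`, where `W` is the exponential of the flows, divided by `W`. -/
def waveDer (v : Time) : BOp N ε σ →ₗ[ℂ] BOp N ε σ :=
  BOp.der (timeDer v) + LinearMap.mulRight ℂ (flow ε σ v)

theorem waveDer_apply (v : Time) (x : BOp N ε σ) :
    waveDer v x = x.der (timeDer v) + x * flow ε σ v := rfl

/-- The flow is multiplied on the far right, so it affects only the last factor; the first one is
merely differentiated. -/
theorem waveDer_mul (v : Time) (x y : BOp N ε σ) :
    waveDer v (x * y) = x.der (timeDer v) * y + x * waveDer v y := by
  rw [waveDer_apply, BOp.der_mul (isCoefDer_timeDer v), waveDer_apply, mul_add, mul_assoc, add_assoc]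

/-- The flow has constant coefficients and commutes with `∂`. -/
theorem waveDer_mul_delOp (v : Time) (x : BOp N ε σ) :
    waveDer v (x * delOp) = waveDer v x * delOp := by
  rw [waveDer_apply, BOp.der_mul (isCoefDer_timeDer v), der_delOp _ (isCoefDer_timeDer v), mul_zero,
    add_zero, waveDer_apply, add_mul, mul_assoc, ← flow_mul_delOp, mul_assoc]

/-- Iterated derivatives. -/
def waveDers (L : List Time) (x : BOp N ε σ) : BOp N ε σ := L.foldl (fun y v => waveDer v y) x

theorem waveDers_cons (v : Time) (L : List Time) (x : BOp N ε σ) :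
    waveDers (v :: L) x = waveDers L (waveDer v x) := rfl

theorem waveDers_add (L : List Time) (x y : BOp N ε σ) :
    waveDers L (x + y) = waveDers L x + waveDers L y := by
  induction L generalizing x y with
  | nil => rfl
  | cons v L ih => rw [waveDers_cons, map_add, ih, waveDers_cons, waveDers_cons]

theorem waveDers_mul_delOp (L : List Time) (x : BOp N ε σ) :
    waveDers L (x * delOp) = waveDers L x * delOp := by
  induction L generalizing x with
  | nil => rfl
  | cons v L ih => rw [waveDers_cons, waveDer_mul_delOp, ih, waveDers_cons]

end OperatorDerivations

/-! ## The Hirota expression in terms of operators -/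

section Link

variable {N : ℕ}

open Polynomial

/-- The symbol of a differential operator in `x` as a power series. -/
def symb : (Coef N)[X] →+* MvPowerSeries Var2 (Fn N (ℝ × ℝ)) :=
  Polynomial.eval₂RingHom (MvPowerSeries.rename Var2.fst).toRingHom (MvPowerSeries.X Var2.del)

theorem symb_monomial (k : ℕ) (f : Coef N) :
    symb (monomial k f) = MvPowerSeries.rename Var2.fst f * MvPowerSeries.X Var2.del ^ k :=
  Polynomial.eval₂_monomial _ _

theorem symb_C (f : Coef N) : symb (C f) = MvPowerSeries.rename Var2.fst f :=
  Polynomial.eval₂_C _ _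

/-- The exponent of a monomial in the times of the first factor and `∂`. -/
def fstDelExp (α : Time →₀ ℕ) (k : ℕ) : Var2 →₀ ℕ :=
  Finsupp.mapDomain Var2.fst α + Finsupp.single Var2.del k

theorem coeff_symb (P : (Coef N)[X]) (α : Time →₀ ℕ) (k : ℕ) :
    MvPowerSeries.coeff (fstDelExp α k) (symb P) = MvPowerSeries.coeff α (P.coeff k) := by
  classical
  have hfst : ∀ β : Time →₀ ℕ, (Finsupp.mapDomain Var2.fst β) Var2.del = 0 := fun β =>
    Finsupp.mapDomain_of_notMem_range _ _ (by rintro ⟨v, hv⟩; exact Var2.noConfusion hv)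
  induction P using Polynomial.induction_on' with
  | add P Q hP hQ => rw [map_add, map_add, hP, hQ, coeff_add, map_add]
  | monomial m f =>
    rw [symb_monomial, MvPowerSeries.X_pow_eq, MvPowerSeries.coeff_mul_monomial, mul_one,
      coeff_monomial]
    by_cases hmk : m = k
    · subst hmk
      rw [if_pos rfl, if_pos (by rw [fstDelExp]; exact self_le_add_left _ _), fstDelExp,
        add_tsub_cancel_right]
      have := MvPowerSeries.coeff_embDomain_rename
        (⟨Var2.fst, fun _ _ h => Var2.fst.inj h⟩ : Time ↪ Var2) f α
      rw [Finsupp.embDomain_eq_mapDomain] at this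
      exact this
    · rw [if_neg hmk, map_zero]
      split_ifs with h
      · refine MvPowerSeries.coeff_rename_eq_zero _ _ ?_
        rintro ⟨β, hβ⟩
        have h1 := DFunLike.congr_fun hβ Var2.del
        rw [hfst, Finsupp.tsub_apply, fstDelExp, Finsupp.add_apply, hfst, Finsupp.single_eq_same,
          Finsupp.single_eq_same] at h1
        have h2 := h Var2.del
        rw [fstDelExp, Finsupp.add_apply, hfst, Finsupp.single_eq_same,
          Finsupp.single_eq_same] at h2
        omega
      · rfl

theorem symb_injective : Function.Injective (symb (N := N)) := by
  intro P Q h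
  ext k α
  rw [← coeff_symb, h, coeff_symb]

/-- `∂/∂x + X_∂` on power series. -/
def coefD (F : MvPowerSeries Var2 (Fn N (ℝ × ℝ))) : MvPowerSeries Var2 (Fn N (ℝ × ℝ)) :=
  mapCoeff (der ((1 : ℝ), (0 : ℝ))) F + MvPowerSeries.X Var2.del * F

theorem mapCoeff_der_rename {σ σ' V : Type} [NormedAddCommGroup V] [NormedSpace ℝ V] (f : σ → σ')
    [Filter.TendstoCofinite f] (w : V) (F : MvPowerSeries σ (Fn N V)) :
    mapCoeff (der w) (MvPowerSeries.rename f F) =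
      MvPowerSeries.rename f (mapCoeff (der w) F) := by
  ext1 α
  rw [MvPowerSeries.coeff_rename]
  change der w (MvPowerSeries.coeff α (MvPowerSeries.rename f F)) = _
  rw [MvPowerSeries.coeff_rename, map_sum]
  rfl

theorem symb_polyD (P : (Coef N)[X]) : symb (polyD P) = coefD (symb P) := by
  classical
  have hadd : ∀ F G : MvPowerSeries Var2 (Fn N (ℝ × ℝ)), coefD (F + G) = coefD F + coefD G := by
    intro F G
    have : mapCoeff (der ((1 : ℝ), (0 : ℝ))) (F + G) =
        mapCoeff (der ((1 : ℝ), (0 : ℝ))) F + mapCoeff (der ((1 : ℝ), (0 : ℝ))) G :=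
      funext fun α => map_add (der ((1 : ℝ), (0 : ℝ))) _ _
    rw [coefD, this, coefD, coefD, mul_add]
    abel
  have hX : ∀ k : ℕ, mapCoeff (der ((1 : ℝ), (0 : ℝ)))
      ((MvPowerSeries.X Var2.del : MvPowerSeries Var2 (Fn N (ℝ × ℝ))) ^ k) = 0 := by
    intro k
    have h1 : der ((1 : ℝ), (0 : ℝ)) (1 : Fn N (ℝ × ℝ)) = 0 := by
      rw [← map_one (algebraMap ℂ (Fn N (ℝ × ℝ))), der_algebraMap]
    ext1 α
    change der _ (MvPowerSeries.coeff α _) = 0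
    rw [MvPowerSeries.coeff_X_pow]
    split_ifs
    · exact h1
    · exact map_zero _
  induction P using Polynomial.induction_on' with
  | add P Q hP hQ => rw [map_add, map_add, hP, hQ, map_add, hadd]
  | monomial k f =>
    rw [polyD_monomial, map_add, symb_monomial, symb_monomial, symb_monomial, coefD,
      mapCoeff_der_mul, hX, mul_zero, add_zero, mapCoeff_der_rename, pow_succ']
    change MvPowerSeries.rename Var2.fst (dxLin f) * _ + _ =
      MvPowerSeries.rename Var2.fst (dxLin f) * _ + _
    ring

theorem zCoeff_symD (n : ℤ) (F : MvPowerSeries Var2 (LaurentSeries (Fn N (ℝ × ℝ)))) :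
    zCoeff n (symD F) = coefD (zCoeff n F) := by
  rw [symD, LinearMap.add_apply, map_add, mulOp_apply, zCoeff_X_mul]
  rfl

theorem rename_diag_symD (F : MvPowerSeries Var2 (LaurentSeries (Fn N (ℝ × ℝ)))) :
    MvPowerSeries.rename diagVar (symD F) = symD (MvPowerSeries.rename diagVar F) := by
  rw [symD, LinearMap.add_apply, LinearMap.add_apply, map_add, derZ_rename, mulOp_apply,
    mulOp_apply, map_mul, MvPowerSeries.rename_X]
  rfl

theorem pderiv_symD (v : Time) (F : MvPowerSeries Var2 (LaurentSeries (Fn N (ℝ × ℝ)))) :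
    MvPowerSeries.pderiv _ (Var2.fst v) (symD F) =
      symD (MvPowerSeries.pderiv _ (Var2.fst v) F) := by
  have hd : MvPowerSeries.pderiv _ (Var2.fst v) (derZ ((1 : ℝ), (0 : ℝ)) F) =
      derZ ((1 : ℝ), (0 : ℝ)) (MvPowerSeries.pderiv _ (Var2.fst v) F) := by
    refine zCoeff_ext fun n => ?_
    rw [zCoeff_pderiv]
    change MvPowerSeries.pderiv _ _ (mapCoeff (der _) (zCoeff n F)) =
      mapCoeff (der _) (zCoeff n (MvPowerSeries.pderiv _ (Var2.fst v) F))
    rw [zCoeff_pderiv, pderiv_mapCoeff_der]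
  rw [symD, LinearMap.add_apply, LinearMap.add_apply, map_add, hd, mulOp_apply, mulOp_apply,
    Derivation.leibniz, MvPowerSeries.pderiv_X_of_ne (by simp), smul_zero, add_zero, smul_eq_mul]

theorem symD_C_mul {x : LaurentSeries (Fn N (ℝ × ℝ))} (hx : x.map (der ((1 : ℝ), (0 : ℝ))) = 0)
    (F : MvPowerSeries Var2 (LaurentSeries (Fn N (ℝ × ℝ)))) :
    symD (MvPowerSeries.C x * F) = MvPowerSeries.C x * symD F := by
  classical
  have hC : derZ ((1 : ℝ), (0 : ℝ)) (MvPowerSeries.C (σ := Var2) x) = 0 := by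
    ext1 α
    change (MvPowerSeries.coeff α (MvPowerSeries.C (σ := Var2) x)).map (der ((1 : ℝ), (0 : ℝ))) = 0
    rw [MvPowerSeries.coeff_C]
    split_ifs
    · exact hx
    · exact HahnSeries.map_zero ((der ((1 : ℝ), (0 : ℝ)) : Fn N (ℝ × ℝ) →+ Fn N (ℝ × ℝ)) :
        ZeroHom (Fn N (ℝ × ℝ)) (Fn N (ℝ × ℝ)))
  rw [symD, LinearMap.add_apply, LinearMap.add_apply, derZ_mul, hC, zero_mul, zero_add,
    mulOp_apply, mulOp_apply]
  ring

theorem map_der_deltaCoeff (v : Time) :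
    (deltaCoeff (Fn N (ℝ × ℝ)) v).map (der ((1 : ℝ), (0 : ℝ))) = 0 := by
  cases v with
  | t j =>
    exact HahnSeries.map_zero ((der ((1 : ℝ), (0 : ℝ)) : Fn N (ℝ × ℝ) →+ Fn N (ℝ × ℝ)) :
        ZeroHom (Fn N (ℝ × ℝ)) (Fn N (ℝ × ℝ)))
  | s j => exact map_der_divZ _ _

theorem lowers_pderiv {σ A : Type} [CommRing A] [Algebra ℂ A] (i : σ) (n : ℕ)
    (F : MvPowerSeries σ A) (hF : F ∈ orderGE σ A (n + 1)) :
    MvPowerSeries.pderiv A i F ∈ orderGE σ A n := by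
  intro α hα
  rw [MvPowerSeries.coeff_pderiv, hF, zero_mul]
  rw [map_add, Finsupp.degree_single]
  omega

/-- `pderiv` as a `ℂ`-linear map. -/
def pderivLin {σ A : Type} [CommRing A] [Algebra ℂ A] (i : σ) :
    Module.End ℂ (MvPowerSeries σ A) :=
  (MvPowerSeries.pderiv A i).toLinearMap.restrictScalars ℂ

theorem pderivLin_apply {σ A : Type} [CommRing A] [Algebra ℂ A] (i : σ) (F : MvPowerSeries σ A) :
    pderivLin i F = MvPowerSeries.pderiv A i F := rfl

theorem pderiv_expS {σ A : Type} [CommRing A] [Algebra ℂ A] (i : σ) {F : MvPowerSeries σ A}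
    (hF : F ∈ orderGE σ A 1) :
    MvPowerSeries.pderiv A i (expS F) = MvPowerSeries.pderiv A i F * expS F := by
  have h := lin_expOp (d := pderivLin i) (Ψ := mulOp (MvPowerSeries.pderiv A i F))
    (raises_mulOp hF) (lowers_pderiv i) (fun n G hG => mul_mem_orderGE_left _ hG) ?_
    (commute_mulOp _ _) 1
  · rw [← expS_eq_expOp, show pderivLin i (1 : MvPowerSeries σ A) = 0 from
      MvPowerSeries.pderiv_one, expOp_mulOp hF, mul_zero, zero_add] at h
    exact h
  · refine LinearMap.ext fun G => ?_
    change MvPowerSeries.pderiv A i (F * G) =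
      F * MvPowerSeries.pderiv A i G + MvPowerSeries.pderiv A i F * G
    rw [Derivation.leibniz, smul_eq_mul, smul_eq_mul]
    ring

/-- Since `b` does not contain the time, only `δ` in `exp(δ D) b` is differentiated. Its derivative
is constant and commutes with `D`, so that a factor `D` appears, which can be applied to `b` first.
-/
theorem pderiv_translate (v : Time) (b : MvPowerSeries Var2 (LaurentSeries (Fn N (ℝ × ℝ))))
    (hb : MvPowerSeries.pderiv _ (Var2.fst v) b = 0) :
    MvPowerSeries.pderiv _ (Var2.fst v) (translate symD (deltaZ (Fn N (ℝ × ℝ))) b) =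
      MvPowerSeries.C (deltaCoeff (Fn N (ℝ × ℝ)) v) *
        translate symD (deltaZ (Fn N (ℝ × ℝ))) (symD b) := by
  have hr : Raises (mulOp (deltaZ (Fn N (ℝ × ℝ))) * symD) :=
    raises_mulOp_mul deltaZ_mem symD_preserves
  have hc : pderivLin (Var2.fst v) * (mulOp (deltaZ (Fn N (ℝ × ℝ))) * symD) =
      (mulOp (deltaZ (Fn N (ℝ × ℝ))) * symD) * pderivLin (Var2.fst v) +
        mulOp (MvPowerSeries.C (deltaCoeff (Fn N (ℝ × ℝ)) v)) * symD := by
    refine LinearMap.ext fun G => ?_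
    rw [LinearMap.add_apply]
    simp only [Module.End.mul_apply, mulOp_apply, pderivLin_apply]
    rw [Derivation.leibniz, smul_eq_mul, smul_eq_mul, pderiv_deltaZ, pderiv_symD]
    ring
  have hcomm : Commute (mulOp (deltaZ (Fn N (ℝ × ℝ))) * symD)
      (mulOp (MvPowerSeries.C (deltaCoeff (Fn N (ℝ × ℝ)) v)) * symD) := by
    refine LinearMap.ext fun G => ?_
    simp only [Module.End.mul_apply, mulOp_apply]
    rw [symD_deltaZ_mul, symD_C_mul (map_der_deltaCoeff v)]
    ring
  have h := lin_expOp hr (lowers_pderiv (Var2.fst v))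
    (fun n G hG => mul_mem_orderGE_left _ (symD_preserves n G hG)) hc hcomm b
  have h0 : expOp (mulOp (deltaZ (Fn N (ℝ × ℝ))) * symD) 0 = 0 := by
    refine funext fun α => Finset.sum_eq_zero fun m _ => ?_
    rw [map_zero, map_zero, smul_zero]
  rw [pderivLin_apply, pderivLin_apply, hb, h0, zero_add, Module.End.mul_apply, mulOp_apply] at h
  rw [translate_eq_expOp symD_deltaZ_mul, translate_eq_expOp symD_deltaZ_mul, h]
  congr 1
  refine map_expOp symD symD_preserves hr hr (fun F => ?_) b
  rw [Module.End.mul_apply, Module.End.mul_apply, mulOp_apply, mulOp_apply, symD_deltaZ_mul]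

/-- The derivative is again a sum of expressions of the same form with modified `a` and `b`. This
makes an induction over iterated derivatives possible. -/
theorem pderiv_hirotaForm (ε : ℝ) (σ : ℤ) (v : Time)
    (a : MvPowerSeries Time (LaurentSeries (Fn N (ℝ × ℝ))))
    (b : MvPowerSeries Var2 (LaurentSeries (Fn N (ℝ × ℝ))))
    (hb : MvPowerSeries.pderiv _ (Var2.fst v) b = 0) :
    MvPowerSeries.pderiv _ (Var2.fst v) (hirotaForm ε σ a b) =
      hirotaForm ε σ (MvPowerSeries.pderiv _ v a +
        MvPowerSeries.C (expoCoeff (Fn N (ℝ × ℝ)) ((σ : ℂ) / (ε : ℂ)) v) * a) b +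
      hirotaForm ε σ (MvPowerSeries.C (deltaCoeff (Fn N (ℝ × ℝ)) v) * a) (symD b) := by
  have ha : MvPowerSeries.pderiv _ (Var2.fst v) (MvPowerSeries.rename Var2.fst a) =
      MvPowerSeries.rename Var2.fst (MvPowerSeries.pderiv _ v a) :=
    pderiv_rename (⟨Var2.fst, fun _ _ h => Var2.fst.inj h⟩ : Time ↪ Var2) v a
  simp only [hirotaForm, Derivation.leibniz, pderiv_expS _ (expoZ_mem _), pderiv_expoZ, ha,
    pderiv_translate v b hb, smul_eq_mul, map_add, map_mul, MvPowerSeries.rename_C]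
  ring

theorem rename_congr {σ σ' A : Type} [CommRing A] {f g : σ → σ'} [Filter.TendstoCofinite f]
    [Filter.TendstoCofinite g] (h : f = g) (F : MvPowerSeries σ A) :
    MvPowerSeries.rename f F = MvPowerSeries.rename g F := by
  subst h
  rfl

theorem rename_diag_twoPoint {A : Type} [CommRing A] (F : MvPowerSeries Var1 A) :
    MvPowerSeries.rename diagVar (twoPoint F) = 0 := by
  rw [twoPoint, map_sub, MvPowerSeries.rename_rename, MvPowerSeries.rename_rename, sub_eq_zero]
  exact rename_congr (funext fun v => by cases v <;> rfl) F

/-- On the diagonal both the exponent and `δ` vanish, being differences of two copies of the same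
form. -/
theorem rename_diag_hirotaForm (ε : ℝ) (σ : ℤ)
    (a : MvPowerSeries Time (LaurentSeries (Fn N (ℝ × ℝ))))
    (b : MvPowerSeries Var2 (LaurentSeries (Fn N (ℝ × ℝ)))) :
    MvPowerSeries.rename diagVar (hirotaForm ε σ a b) =
      MvPowerSeries.rename Var2.fst a * MvPowerSeries.rename diagVar b := by
  have h1 : MvPowerSeries.rename diagVar (expoZ (Fn N (ℝ × ℝ)) ((σ : ℂ) / (ε : ℂ))) = 0 := by
    rw [expoZ, rename_complex_smul, map_sub, rename_diag_twoPoint, rename_diag_twoPoint, sub_zero,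
      smul_zero]
  have h0 : (0 : MvPowerSeries Var2 (LaurentSeries (Fn N (ℝ × ℝ)))) ∈ orderGE Var2 _ 1 :=
    zero_mem _
  have h2 : MvPowerSeries.rename diagVar (translate symD (deltaZ (Fn N (ℝ × ℝ))) b) =
      MvPowerSeries.rename diagVar b := by
    rw [translate_eq_expOp symD_deltaZ_mul]
    refine (map_expOp (renameLin diagVar) (fun n F hF => rename_mem_orderGE _ hF)
      (raises_mulOp_mul deltaZ_mem symD_preserves) (raises_mulOp h0) (fun F => ?_) b).trans ?_
    · change MvPowerSeries.rename diagVar (deltaZ (Fn N (ℝ × ℝ)) * symD F) = 0 * _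
      rw [map_mul, deltaZ, rename_diag_twoPoint, zero_mul, zero_mul]
    · rw [expOp_mulOp h0, expS_zero, one_mul]
      rfl
  rw [hirotaForm, map_mul, map_mul, rename_expS _ (expoZ_mem _), h1, expS_zero, one_mul, h2,
    MvPowerSeries.rename_rename]
  rfl

end Link

/-! ### The Hirota expressions as coefficients of operator products -/

section HirotaOperators

variable {N : ℕ} {ε : ℝ} {σ : ℤˣ}

open Polynomial

/-- The operator `∑ a_n Λ^{-σ n}` with left symbol `∑ a_n z^n`. -/
def IsLeftSymb (a : MvPowerSeries Time (LaurentSeries (Fn N (ℝ × ℝ)))) (A : BOp N ε σ) : Prop :=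
  ∀ n : ℤ, A.op (σ * n) = C (zCoeff (-n) a)

namespace IsLeftSymb

variable {a a' : MvPowerSeries Time (LaurentSeries (Fn N (ℝ × ℝ)))} {A A' : BOp N ε σ}

theorem add (h : IsLeftSymb a A) (h' : IsLeftSymb a' A') : IsLeftSymb (a + a') (A + A') := by
  intro n
  rw [map_add, Pi.add_apply, h, h', map_add, C_add]

theorem smul (s : ℂ) (h : IsLeftSymb a A) : IsLeftSymb (s • a) (s • A) := by
  intro n
  rw [map_smul, Pi.smul_apply, h, map_smul, smul_C]

theorem zero : IsLeftSymb 0 (0 : BOp N ε σ) := by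
  intro n
  rw [map_zero, map_zero, C_0]
  rfl

theorem mul_lamOp (k : ℤ) (h : IsLeftSymb a A) :
    IsLeftSymb (MvPowerSeries.C (HahnSeries.single (-k) 1) * a) (A * lamOp (σ * k)) := by
  intro n
  rw [op_mul_lamOp, ← mul_sub, h, zCoeff_C_single_mul, map_one, one_mul]
  congr 3
  ring

theorem der (v : Time) (h : IsLeftSymb a A) :
    IsLeftSymb (MvPowerSeries.pderiv _ v a) (A.der (timeDer v)) := by
  intro n
  change mapPoly (timeDer v) (A.op _) = _
  rw [h, zCoeff_pderiv, ← monomial_zero_left, mapPoly_monomial, timeDer_apply, monomial_zero_left]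

/-- Right multiplication by `Λ^{σ k}` multiplies the left symbol by `z^{-k}`; the constants in
`flowE` are those of the derivatives of the Hirota exponent. -/
theorem mul_flowE (v : Time) (h : IsLeftSymb a A) :
    IsLeftSymb (MvPowerSeries.C (expoCoeff (Fn N (ℝ × ℝ)) (((σ : ℤ) : ℂ) / (ε : ℂ)) v) * a)
      (A * flowE ε σ v) := by
  cases v with
  | t j =>
    rw [expoCoeff, flowE, divZ, smul_smul, C_complex_smul, smul_mul_assoc, mul_smul_comm]
    exact (h.mul_lamOp _).smul _
  | s j =>
    rw [expoCoeff, flowE, divZ, smul_smul, ← neg_smul, C_complex_smul, smul_mul_assoc,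
      mul_smul_comm]
    exact (h.mul_lamOp _).smul _

theorem mul_flowD (v : Time) (h : IsLeftSymb a A) :
    IsLeftSymb (MvPowerSeries.C (deltaCoeff (Fn N (ℝ × ℝ)) v) * a) (A * flowD ε σ v) := by
  cases v with
  | t j =>
    rw [deltaCoeff, flowD, map_zero, zero_mul, mul_zero]
    exact zero
  | s j =>
    rw [deltaCoeff, flowD, divZ, C_complex_smul, smul_mul_assoc, mul_smul_comm]
    exact (h.mul_lamOp _).smul _

end IsLeftSymb

/-- `b` restricted to the diagonal is the right symbol, with all shifts moved by `-l`. -/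
def IsRightSymb (l : ℤ) (b : MvPowerSeries Var2 (LaurentSeries (Fn N (ℝ × ℝ))))
    (B : BOp N ε σ) : Prop :=
  ∀ m : ℤ, zCoeff m (MvPowerSeries.rename diagVar b) =
    symb (shiftPoly ε (-l + σ * m) (B.op (-(σ * m))))

theorem IsRightSymb.delOp_mul {l : ℤ} {b : MvPowerSeries Var2 (LaurentSeries (Fn N (ℝ × ℝ)))}
    {B : BOp N ε σ} (h : IsRightSymb l b B) : IsRightSymb l (symD b) (delOp * B) := by
  intro m
  rw [rename_diag_symD, zCoeff_symD, h, op_delOp_mul, shiftPoly_polyD, symb_polyD]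

theorem unit_mul_unit_mul (σ : ℤˣ) (n : ℤ) : (σ : ℤ) * (σ * n) = n := by
  rw [← mul_assoc, ← Units.val_mul, Int.units_mul_self, Units.val_one, one_mul]

/-- On the diagonal the Hirota expression is a plain product of series, and its Cauchy product is
the composition formula: the coefficient of `z^i` in `a` is the coefficient of `A Λ^{σ r}` at
`Λ^{σ(r-i)}`, and the matching coefficient of `b` is the right coefficient of `B` with its shift
adjusted. -/
theorem zCoeff_diag_hirotaForm (l : ℤ) (r : ℤ)
    {a : MvPowerSeries Time (LaurentSeries (Fn N (ℝ × ℝ)))} {A : BOp N ε σ} (hA : IsLeftSymb a A)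
    {b : MvPowerSeries Var2 (LaurentSeries (Fn N (ℝ × ℝ)))} {B : BOp N ε σ}
    (hB : IsRightSymb l b B) :
    zCoeff r (MvPowerSeries.rename diagVar
      (MvPowerSeries.C (HahnSeries.single (-(σ * l)) 1) * hirotaForm ε σ a b)) =
      symb ((A * lamOp (σ * r) * B).op (-l)) := by
  obtain ⟨M, hM⟩ := A.op_mem
  obtain ⟨K, hK⟩ := B.op_mem
  have ha : ∀ i < -(M : ℤ), zCoeff i (MvPowerSeries.rename Var2.fst a) = 0 := by
    intro i hi
    have h1 := hA (-i)
    rw [hM _ (by rw [unit_mul_unit_mul]; omega), neg_neg] at h1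
    rw [zCoeff_rename, C_eq_zero.mp h1.symm, map_zero]
  have hb : ∀ i < -(K : ℤ), zCoeff i (MvPowerSeries.rename diagVar b) = 0 := by
    intro i hi
    rw [hB, hK _ (by rw [mul_neg, unit_mul_unit_mul]; omega), map_zero, map_zero]
  -- The substitution `i ↦ σ (r - i)` passes from exponents of `z` to exponents of `Λ`.
  have hinj : Set.InjOn (fun i : ℤ => σ * (r - i)) (Finset.Icc (-(M : ℤ)) (r + σ * l - -K)) := by
    intro i _ j _ h
    have := congrArg (fun x : ℤ => (σ : ℤ) * x) h
    simp only [unit_mul_unit_mul] at this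
    omega
  rw [map_mul, MvPowerSeries.rename_C, zCoeff_C_single_mul, map_one, one_mul,
    rename_diag_hirotaForm, sub_neg_eq_add, zCoeff_mul ha hb, BOp.op_mul,
    comp_eq_sum ε ((Finset.Icc (-(M : ℤ)) (r + σ * l - -K)).image fun i : ℤ => σ * (r - i)),
    Finset.sum_image hinj, map_sum]
  · refine Finset.sum_congr rfl fun i _ => ?_
    have h1 : r + σ * l - i = σ * l + (r - i) := by ring
    have h2 : (σ : ℤ) * (σ * l + (r - i)) = l + σ * (r - i) := by
      rw [mul_add, unit_mul_unit_mul]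
    rw [op_mul_lamOp, ← mul_sub, hA, act_C, map_mul, symb_C, zCoeff_rename, h1, hB, h2]
    congr 4
    · ring_nf
    · rw [neg_add_cancel_left]
    · rw [neg_add']
  · intro i hi
    obtain ⟨j, rfl⟩ : ∃ j, i = σ * (r - j) := ⟨r - σ * i, by
      rw [sub_sub_cancel, unit_mul_unit_mul]⟩
    have hj : j ∉ Finset.Icc (-(M : ℤ)) (r + σ * l - -K) := fun h =>
      hi (Finset.mem_image_of_mem _ h)
    rw [Finset.mem_Icc, not_and_or, not_le, not_le] at hj
    rcases hj with hj | hj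
    · left
      rw [op_mul_lamOp, ← mul_sub, hM _ (by rw [unit_mul_unit_mul]; omega)]
    · right
      refine hK _ ?_
      rw [mul_sub, mul_neg, unit_mul_unit_mul]
      omega

/-- The Taylor coefficients of the Hirota expression along the diagonal. -/
theorem zCoeff_diag_fstDerivs_hirotaForm (l : ℤ) (r : ℤ) (L : List Time)
    {a : MvPowerSeries Time (LaurentSeries (Fn N (ℝ × ℝ)))} {A : BOp N ε σ} (hA : IsLeftSymb a A)
    {b : MvPowerSeries Var2 (LaurentSeries (Fn N (ℝ × ℝ)))} {B : BOp N ε σ}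
    (hB : IsRightSymb l b B) (hb : ∀ v, MvPowerSeries.pderiv _ (Var2.fst v) b = 0) :
    zCoeff r (MvPowerSeries.rename diagVar (fstDerivs L
      (MvPowerSeries.C (HahnSeries.single (-(σ * l)) 1) * hirotaForm ε σ a b))) =
      symb ((waveDers L A * lamOp (σ * r) * B).op (-l)) := by
  induction L generalizing a A b B with
  | nil => exact zCoeff_diag_hirotaForm l r hA hB
  | cons v L ih =>
    -- The derivative splits into two Hirota forms: in the first, `A` takes the part of the flow
    -- without `∂`; in the second, the `∂` of the flow is applied to `B`.
    have h1 := ih (((hA.der v).add (hA.mul_flowE v))) hB hb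
    have h2 := ih (hA.mul_flowD v) hB.delOp_mul (fun w => by rw [pderiv_symD, hb, map_zero])
    have hd : MvPowerSeries.pderiv _ (Var2.fst v)
        (MvPowerSeries.C (HahnSeries.single (-(σ * l)) 1) * hirotaForm ε σ a b) =
        MvPowerSeries.C (HahnSeries.single (-(σ * l)) 1) *
          MvPowerSeries.pderiv _ (Var2.fst v) (hirotaForm ε σ a b) := by
      rw [Derivation.leibniz, MvPowerSeries.pderiv_C, smul_zero, add_zero, smul_eq_mul]
    change zCoeff r (MvPowerSeries.rename diagVar (fstDerivs L (MvPowerSeries.pderiv _ (Var2.fst v)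
      (MvPowerSeries.C (HahnSeries.single (-(σ * l)) 1) * hirotaForm ε σ a b)))) = _
    rw [hd, pderiv_hirotaForm ε σ v a b (hb v), mul_add, fstDerivs_add, map_add, map_add, h1, h2,
      ← map_add, ← Pi.add_apply, ← map_add, waveDers_cons, waveDer_apply, flow]
    -- Since `∂` commutes with powers of `Λ`, it can be taken from `B` back to `A`, where both parts
    -- add up to `waveDer v A`.
    have e1 : ∀ X : BOp N ε σ, X * lamOp (σ * r) * (delOp * B) =
        X * delOp * lamOp (σ * r) * B := fun X => by
      rw [mul_assoc X delOp, ← lamOp_mul_delOp]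
      simp only [mul_assoc]
    rw [e1, ← waveDers_mul_delOp, ← add_mul, ← add_mul, ← waveDers_add, mul_add (A), ← mul_assoc A,
      add_assoc]

end HirotaOperators

/-! ### Triangular operators, Lax operators and the generators of the flows -/

section Dressing

variable {N : ℕ} {ε : ℝ} {σ : ℤˣ}

open Polynomial

/-! ### Inverses of triangular operators -/

theorem exists_eq_unit_mul (σ : ℤˣ) (i : ℤ) : ∃ j : ℤ, i = σ * j :=
  ⟨σ * i, (unit_mul_unit_mul σ i).symm⟩

/-- The support of the operator is contained in `-σ ℕ`. -/
def IsTri (x : BOp N ε σ) : Prop := ∀ n : ℤ, 0 < n → x.op (σ * n) = 0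

theorem IsTri.mul {x y : BOp N ε σ} (hx : IsTri x) (hy : IsTri y) : IsTri (x * y) := by
  intro n hn
  rw [BOp.op_mul, comp_eq_sum ε ∅, Finset.sum_empty]
  intro i _
  obtain ⟨j, rfl⟩ := exists_eq_unit_mul σ i
  rw [← mul_sub]
  by_cases h : 0 < j
  · exact Or.inl (hx j h)
  · exact Or.inr (hy _ (by omega))

theorem IsTri.op_mul_zero {x y : BOp N ε σ} (hx : IsTri x) (hy : IsTri y) :
    (x * y).op 0 = act (x.op 0) (y.op 0) := by
  rw [BOp.op_mul, comp_eq_sum ε {0}, Finset.sum_singleton, shiftPoly_zero, sub_zero]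
  intro i hi
  rw [Finset.mem_singleton] at hi
  obtain ⟨j, rfl⟩ := exists_eq_unit_mul σ i
  have hj : j ≠ 0 := fun h => hi (by rw [h, mul_zero])
  rw [zero_sub, ← mul_neg]
  by_cases h : 0 < j
  · exact Or.inl (hx j h)
  · exact Or.inr (hy _ (by omega))

/-- The difference `y = x - 1` is strictly triangular and satisfies `y = -y²`. Squaring increases
the order of a strictly triangular operator, so all coefficients of `y` vanish successively. -/
theorem eq_one_of_mul_self {x : BOp N ε σ} (hx : IsTri x) (h0 : x.op 0 = 1) (hxx : x * x = x) :
    x = 1 := by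
  set y := x - 1 with hy
  have hyy : y = -(y * y) := by
    rw [hy, mul_sub, sub_mul, hxx]
    simp
  have key : ∀ (k : ℕ) (n : ℤ), -(k : ℤ) ≤ n → y.op (σ * n) = 0 := by
    intro k
    induction k with
    | zero =>
      intro n hn
      rw [hy, map_sub, Pi.sub_apply, BOp.op_one, one, term]
      rcases (show 0 ≤ n by simpa using hn).eq_or_lt with rfl | h
      · rw [mul_zero, h0, if_pos rfl, monomial_zero_left, C_1, sub_self]
      · rw [hx n h, if_neg, sub_self]
        intro h1
        have := unit_mul_unit_mul σ n
        rw [h1] at this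
        omega
    | succ k ih =>
      intro n hn
      by_cases hk : -(k : ℤ) ≤ n
      · exact ih n hk
      · rw [hyy, map_neg, Pi.neg_apply, BOp.op_mul, comp_eq_sum ε ∅, Finset.sum_empty, neg_zero]
        intro i _
        obtain ⟨j, rfl⟩ := exists_eq_unit_mul σ i
        rw [← mul_sub]
        by_cases h : -(k : ℤ) ≤ j
        · exact Or.inl (ih j h)
        · exact Or.inr (ih _ (by omega))
  rw [← sub_eq_zero]
  refine BOp.ext (funext fun i => ?_)
  obtain ⟨j, rfl⟩ := exists_eq_unit_mul σ i
  exact key j.natAbs j (by omega)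

/-- If `x y = 1`, then `y x` is idempotent. -/
theorem mul_eq_one_comm_of_isTri {x y : BOp N ε σ} (hx : IsTri x) (hy : IsTri y)
    (h : x * y = 1) (h0 : (y * x).op 0 = 1) : y * x = 1 :=
  eq_one_of_mul_self (hy.mul hx) h0 (by rw [mul_assoc y, ← mul_assoc x, h, one_mul])

/-! ### The derivation with respect to `x` -/

theorem isCoefDer_dxLin : IsCoefDer ε (dxLin : Module.End ℂ (Coef N)) where
  mul := dxLin_mul
  dx _ := rfl
  shift i f := dxLin_shift ε i f

theorem act_X (P : (Coef N)[X]) : act P X = P * X := by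
  induction P using Polynomial.induction_on' with
  | add P Q hP hQ => rw [act_add, LinearMap.add_apply, hP, hQ, add_mul]
  | monomial k f =>
    have hx : dxLin (1 : Coef N) = 0 := by simpa using dxLin_mul (1 : Coef N) 1
    have : (polyD ^ k) (X : (Coef N)[X]) = monomial (k + 1) 1 := by
      induction k with
      | zero => rfl
      | succ k ih => rw [pow_succ', Module.End.mul_apply, ih, polyD_monomial, hx, map_zero, zero_add]
    rw [act_monomial, this, C_mul_monomial, mul_one, monomial_mul_X]

theorem polyD_eq (P : (Coef N)[X]) : polyD P = mapPoly dxLin P + P * X := by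
  induction P using Polynomial.induction_on' with
  | add P Q hP hQ => rw [map_add, hP, hQ, map_add, add_mul]; abel
  | monomial k f => rw [polyD_monomial, mapPoly_monomial, monomial_mul_X]

theorem der_dxLin (x : BOp N ε σ) : x.der dxLin = delOp * x - x * delOp := by
  refine BOp.ext (funext fun n => ?_)
  rw [map_sub, Pi.sub_apply, op_delOp_mul, op_mul_delOp, act_X, polyD_eq, add_sub_cancel_right]
  rfl

/-! ### Operators with finite support -/

theorem finite_support_of_bddOps {F : Op N} (h : F ∈ bddOps N 1) (h' : F ∈ bddOps N (-1)) :
    (Function.support F).Finite := by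
  obtain ⟨a, ha⟩ := h
  obtain ⟨b, hb⟩ := h'
  refine (Set.finite_Icc (-(b : ℤ)) a).subset fun n hn => ?_
  have h1 : ¬ (a : ℤ) < ((1 : ℤˣ) : ℤ) * n := fun h => hn (ha n h)
  have h2 : ¬ (b : ℤ) < ((-1 : ℤˣ) : ℤ) * n := fun h => hn (hb n h)
  simp only [Units.val_neg, Units.val_one, neg_mul, one_mul] at h1 h2
  rw [Set.mem_Icc]
  constructor <;> omega

/-- Left multiplication with an operator with finite support. -/
def compLin (ε : ℝ) (F : Op N) (hF : (Function.support F).Finite) : Op N →ₗ[ℂ] Op N where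
  toFun := comp ε F
  map_add' _ _ := comp_add_right_of_finite (fun _ => hF.subset fun _ hi => hi.1)
    (fun _ => hF.subset fun _ hi => hi.1)
  map_smul' a G := comp_smul_right a F G

/-! ### Lax operators -/

theorem conj_mul_conj {x y : BOp N ε σ} (hyx : y * x = 1) (a b : BOp N ε σ) :
    x * a * y * (x * b * y) = x * (a * b) * y := by
  rw [show x * a * y * (x * b * y) = x * a * (y * x) * b * y by simp only [mul_assoc], hyx,
    mul_one, mul_assoc x a b]

theorem conj_lamOp_pow {x y : BOp N ε σ} (hxy : x * y = 1) (hyx : y * x = 1) (m : ℤ) (r : ℕ) :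
    (x * lamOp m * y) ^ r = x * lamOp (m * r) * y := by
  induction r with
  | zero => rw [pow_zero, Nat.cast_zero, mul_zero, lamOp_zero, mul_one, hxy]
  | succ r ih =>
    rw [pow_succ, ih, conj_mul_conj hyx, Nat.cast_succ, mul_add, mul_one, lamOp_add]

variable {S V : BOp N ε 1} {Sb Vb : BOp N ε (-1)}

/-- The pairs `S`, `Sb` have inverses and define the same Lax operator. -/
structure IsLaxPair (S V : BOp N ε 1) (Sb Vb : BOp N ε (-1)) : Prop where
  mul_inv : S * V = 1
  inv_mul : V * S = 1
  mul_inv' : Sb * Vb = 1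
  inv_mul' : Vb * Sb = 1
  lax_eq : (S * lamOp 1 * V).op = (Sb * lamOp (-1) * Vb).op

theorem IsLaxPair.power_lax (h : IsLaxPair S V Sb Vb) (r : ℕ) :
    power ε (lax ε S.op V.op) r = (S * lamOp (((1 : ℤˣ) : ℤ) * r) * V).op := by
  rw [Units.val_one, ← conj_lamOp_pow h.mul_inv h.inv_mul, BOp.op_pow]
  rfl

theorem IsLaxPair.op_pow_eq (h : IsLaxPair S V Sb Vb) (r : ℕ) :
    (Sb * lamOp (((-1 : ℤˣ) : ℤ) * r) * Vb).op = (S * lamOp (((1 : ℤˣ) : ℤ) * r) * V).op := by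
  rw [Units.val_one, Units.val_neg, Units.val_one, ← conj_lamOp_pow h.mul_inv h.inv_mul,
    ← conj_lamOp_pow h.mul_inv' h.inv_mul', BOp.op_pow, BOp.op_pow, h.lax_eq]

theorem IsLaxPair.opB_eq (h : IsLaxPair S V Sb Vb) (j : ℕ) : opB ε S.op V.op j =
    (1 / ((j + 1).factorial : ℂ)) • (S * lamOp (((1 : ℤˣ) : ℤ) * (j + 1 : ℕ)) * V).op := by
  rw [opB, smulOp_eq, h.power_lax]

/-- The two halves of `log L` lie in different rings, so `L^j log L` is not a product in either of
them. However, `L^j` is bounded above through `S` and below through `S̄`; having finite support, it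
multiplies from the left linearly, and each half is then computed in its own ring. -/
theorem IsLaxPair.opD_eq (h : IsLaxPair S V Sb Vb) (j : ℕ) : opD ε S.op V.op Sb.op Vb.op j =
    (1 / (j.factorial : ℂ)) •
      ((ε : ℂ) • (S * (lamOp (((1 : ℤˣ) : ℤ) * j) * delOp) * V).op -
        (ε : ℂ) • (Sb * (lamOp (((-1 : ℤˣ) : ℤ) * j) * delOp) * Vb).op -
        (2 * c j) • (S * lamOp (((1 : ℤˣ) : ℤ) * j) * V).op) := by
  have hfin : (Function.support (S * lamOp (((1 : ℤˣ) : ℤ) * j) * V).op).Finite :=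
    finite_support_of_bddOps (BOp.op_mem _) (by
      rw [← h.op_pow_eq]
      exact BOp.op_mem _)
  have hp : logPlus ε S.op V.op = (ε : ℂ) • (S * delOp * V).op := by
    rw [logPlus, smulOp_eq, comp_smul_right, comp_smul_left]
    rfl
  have hm : logMinus ε Sb.op Vb.op = -((ε : ℂ) • (Sb * delOp * Vb).op) := by
    rw [logMinus, smulOp_eq, comp_smul_right, comp_smul_left]
    rfl
  have e1 : comp ε (S * lamOp (((1 : ℤˣ) : ℤ) * j) * V).op (S * delOp * V).op =
      (S * (lamOp (((1 : ℤˣ) : ℤ) * j) * delOp) * V).op := by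
    rw [← BOp.op_mul, conj_mul_conj h.inv_mul]
  have e2 : comp ε (S * lamOp (((1 : ℤˣ) : ℤ) * j) * V).op (Sb * delOp * Vb).op =
      (Sb * (lamOp (((-1 : ℤˣ) : ℤ) * j) * delOp) * Vb).op := by
    rw [← h.op_pow_eq, ← BOp.op_mul, conj_mul_conj h.inv_mul']
  rw [opD, logLax, smulOp_eq, smulOp_eq, smulOp_eq, h.power_lax, hp, hm]
  change _ • compLin ε _ hfin _ = _
  simp only [map_sub, map_add, map_smul, map_neg]
  change _ • ((1 / 2 : ℂ) • ((ε : ℂ) • comp ε _ _ + -((ε : ℂ) • comp ε _ _)) -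
    c j • comp ε _ one) = _
  rw [e1, e2, comp_one]
  module

/-- The operators that generate the flows of the hierarchy. -/
def generator (ε : ℝ) (S V Sb Vb : Op N) : Time → Op N
  | Time.t j => opB ε S V j
  | Time.s j => opD ε S V Sb Vb (j + 1)

/-- The signs and factors in `flow` are such that the terms with powers of `L` alone, coming from
`S` and from `S̄`, are equal halves that add up, while the terms with `∂` give the two parts of `log
L`. -/
theorem IsLaxPair.generator_eq (h : IsLaxPair S V Sb Vb) (hε : ε ≠ 0) (v : Time) :
    generator ε S.op V.op Sb.op Vb.op v =
      (ε : ℂ) • (S * flow ε 1 v * V).op - (ε : ℂ) • (Sb * flow ε (-1) v * Vb).op := by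
  have hε' : (ε : ℂ) ≠ 0 := Complex.ofReal_ne_zero.mpr hε
  cases v with
  | t j =>
    have hf : ((j + 1).factorial : ℂ) ≠ 0 := Nat.cast_ne_zero.mpr (Nat.factorial_ne_zero _)
    rw [generator, h.opB_eq, flow, flow, flowE, flowE, flowD, flowD, zero_mul, zero_mul, add_zero,
      add_zero, mul_smul_comm, mul_smul_comm, smul_mul_assoc, smul_mul_assoc, map_smul, map_smul,
      h.op_pow_eq, Units.val_one, Units.val_neg, Units.val_one]
    generalize (S * lamOp _ * V).op = Z
    push_cast
    match_scalars
    field_simp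
    ring
  | s j =>
    have hf : ((j + 1).factorial : ℂ) ≠ 0 := Nat.cast_ne_zero.mpr (Nat.factorial_ne_zero _)
    rw [generator, h.opD_eq, flow, flow, flowE, flowE, flowD, flowD]
    simp only [mul_add, add_mul, smul_mul_assoc, mul_smul_comm, map_add, map_smul, h.op_pow_eq]
    rw [Units.val_one, Units.val_neg, Units.val_one]
    generalize (S * (lamOp _ * delOp) * V).op = X
    generalize (Sb * (lamOp _ * delOp) * Vb).op = Y
    generalize (S * lamOp _ * V).op = Z
    push_cast
    all_goals match_scalars
    all_goals field_simp
    all_goals ring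

end Dressing

/-! ### The hierarchy as bilinear identities for wave operators -/

section Wave

variable {N : ℕ} {ε : ℝ} {σ : ℤˣ} {S V : BOp N ε 1} {Sb Vb : BOp N ε (-1)}

open Polynomial

theorem isTri_of_inGminus (h : InGminus S.op) : IsTri S := by
  intro n hn
  rw [Units.val_one, one_mul]
  exact h.2.2 n hn

theorem isTri_of_nonNeg (h : NonNeg Sb.op) : IsTri Sb := by
  intro n hn
  rw [Units.val_neg, Units.val_one]
  exact h.2 _ (by omega)

theorem IsTri.der {x : BOp N ε σ} (h : IsTri x) (d : Module.End ℂ (Coef N)) : IsTri (x.der d) := by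
  intro n hn
  change mapPoly d (x.op _) = 0
  rw [h n hn, map_zero]

theorem minus_add_plus (F : Op N) : minus F + plus F = F := by
  funext n
  rw [Pi.add_apply, minus, plus]
  by_cases h : n < 0
  · rw [if_pos h, if_neg (by omega), add_zero]
  · rw [if_neg h, if_pos (by omega), zero_add]

theorem minus_mem_bddOps (F : Op N) : minus F ∈ bddOps N 1 :=
  ⟨0, fun n hn => if_neg (by rw [Units.val_one] at hn; omega)⟩

theorem plus_mem_bddOps (F : Op N) : plus F ∈ bddOps N (-1) :=
  ⟨0, fun n hn => if_neg (by rw [Units.val_neg, Units.val_one] at hn; omega)⟩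

/-- A derivation kills the leading coefficient `1` of `S`, so the logarithmic derivative is strictly
negative in `Λ`. -/
theorem op_conj_der_of_nonneg {d : Module.End ℂ (Coef N)} (hd : IsCoefDer ε d)
    (hS : InGminus S.op) (hV : InGminus V.op) {n : ℤ} (hn : 0 ≤ n) :
    (S.der d * V).op n = 0 := by
  have h1 : d 1 = 0 := by simpa using hd.mul 1 1
  rcases hn.eq_or_lt with rfl | hn
  · rw [((isTri_of_inGminus hS).der d).op_mul_zero (isTri_of_inGminus hV)]
    have h2 : (S.der d).op 0 = 0 := by
      change mapPoly d (S.op 0) = 0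
      rw [hS.2.1, ← C_1, ← monomial_zero_left, mapPoly_monomial, h1, map_zero]
    rw [h2, act_zero, LinearMap.zero_apply]
  · have := ((isTri_of_inGminus hS).der d).mul (isTri_of_inGminus hV) n hn
    rwa [Units.val_one, one_mul] at this

theorem op_conj_der_of_neg (d : Module.End ℂ (Coef N)) (hS : NonNeg Sb.op) (hV : NonNeg Vb.op)
    {n : ℤ} (hn : n < 0) : (Sb.der d * Vb).op n = 0 := by
  have := ((isTri_of_nonNeg hS).der d).mul (isTri_of_nonNeg hV) (-n) (by omega)
  rwa [Units.val_neg, Units.val_one, neg_mul_neg, one_mul] at this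

/-- The evolution equations of the dressing operators as one equation for the logarithmic
derivatives. -/
theorem evolution_iff (h : IsLaxPair S V Sb Vb) {d : Module.End ℂ (Coef N)} (hd : IsCoefDer ε d)
    (hS : InGminus S.op) (hV : InGminus V.op) (hSb : NonNeg Sb.op) (hVb : NonNeg Vb.op) (B : Op N) :
    (smulOp (ε : ℂ) (mapOp d S.op) = -comp ε (minus B) S.op ∧
      smulOp (ε : ℂ) (mapOp d Sb.op) = comp ε (plus B) Sb.op) ↔
      B = (ε : ℂ) • (Sb.der d * Vb).op - (ε : ℂ) • (S.der d * V).op := by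
  rw [smulOp_eq, smulOp_eq, ← BOp.op_der, ← BOp.op_der]
  constructor
  · rintro ⟨h1, h2⟩
    have e1 : (ε : ℂ) • S.der d = -(BOp.mk (minus B) (minus_mem_bddOps B) * S) :=
      BOp.ext (by rw [map_smul, h1, map_neg, BOp.op_mul, BOp.op_mk])
    have e2 : (ε : ℂ) • Sb.der d = BOp.mk (plus B) (plus_mem_bddOps B) * Sb :=
      BOp.ext (by rw [map_smul, h2, BOp.op_mul, BOp.op_mk])
    rw [← map_smul, ← map_smul, ← smul_mul_assoc, ← smul_mul_assoc, e1, e2, mul_assoc, h.mul_inv',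
      mul_one, neg_mul, mul_assoc, h.mul_inv, mul_one, map_neg, sub_neg_eq_add, BOp.op_mk,
      BOp.op_mk, add_comm, minus_add_plus]
  · intro hB
    -- The logarithmic derivatives of `S̄` and `S` are supported in non-negative and in negative
    -- powers respectively, so they are recovered from their difference `B` by projection.
    have e1 : minus B = (-((ε : ℂ) • (S.der d * V))).op := by
      funext n
      rw [minus, hB, map_neg, Pi.neg_apply, map_smul, Pi.smul_apply, Pi.sub_apply, Pi.smul_apply,
        Pi.smul_apply]
      split_ifs with hn
      · rw [op_conj_der_of_neg d hSb hVb hn, smul_zero, zero_sub]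
      · rw [op_conj_der_of_nonneg hd hS hV (by omega), smul_zero, neg_zero]
    have e2 : plus B = ((ε : ℂ) • (Sb.der d * Vb)).op := by
      funext n
      rw [plus, hB, map_smul, Pi.smul_apply, Pi.sub_apply, Pi.smul_apply, Pi.smul_apply]
      split_ifs with hn
      · rw [op_conj_der_of_nonneg hd hS hV hn, smul_zero, sub_zero]
      · rw [op_conj_der_of_neg d hSb hVb (by omega), smul_zero]
    rw [e1, e2, ← BOp.op_mul, ← BOp.op_mul, neg_mul, map_neg, neg_neg, smul_mul_assoc,
      smul_mul_assoc, mul_assoc, h.inv_mul, mul_assoc, h.inv_mul', mul_one, mul_one, map_smul,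
      map_smul]
    exact ⟨rfl, rfl⟩

/-- Both the generator and the difference of logarithmic derivatives are differences of an `S`-term
and an `S̄`-term. Sorting the terms by wave operator gives the wave derivatives. -/
theorem evolution_iff_waveDer (h : IsLaxPair S V Sb Vb) (hε : ε ≠ 0)
    (hS : InGminus S.op) (hV : InGminus V.op) (hSb : NonNeg Sb.op) (hVb : NonNeg Vb.op)
    (v : Time) :
    (smulOp (ε : ℂ) (mapOp (timeDer v) S.op) =
        -comp ε (minus (generator ε S.op V.op Sb.op Vb.op v)) S.op ∧
      smulOp (ε : ℂ) (mapOp (timeDer v) Sb.op) =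
        comp ε (plus (generator ε S.op V.op Sb.op Vb.op v)) Sb.op) ↔
      (waveDer v S * V).op = (waveDer v Sb * Vb).op := by
  have hε' : (ε : ℂ) ≠ 0 := Complex.ofReal_ne_zero.mpr hε
  rw [evolution_iff h (isCoefDer_timeDer v) hS hV hSb hVb, h.generator_eq hε, waveDer_apply,
    waveDer_apply, add_mul, add_mul, map_add, map_add, sub_eq_sub_iff_add_eq_add, ← smul_add,
    ← smul_add, add_comm, smul_right_inj hε']

/-- The evolution with respect to `s_0` is automatic. -/
theorem evolution_zero (h : IsLaxPair S V Sb Vb)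
    (hS : InGminus S.op) (hV : InGminus V.op) (hSb : NonNeg Sb.op) (hVb : NonNeg Vb.op) :
    smulOp (ε : ℂ) (mapOp dx S.op) = -comp ε (minus (opD ε S.op V.op Sb.op Vb.op 0)) S.op ∧
      smulOp (ε : ℂ) (mapOp dx Sb.op) = comp ε (plus (opD ε S.op V.op Sb.op Vb.op 0)) Sb.op := by
  refine (evolution_iff h isCoefDer_dxLin hS hV hSb hVb _).mpr ?_
  have hc : c 0 = 0 := Finset.sum_range_zero _
  have h1 : (S.der dxLin * V).op = (delOp : BOp N ε 1).op - (S * delOp * V).op := by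
    rw [der_dxLin, sub_mul, mul_assoc, h.mul_inv, mul_one, map_sub]
  have h2 : (Sb.der dxLin * Vb).op = (delOp : BOp N ε (-1)).op - (Sb * delOp * Vb).op := by
    rw [der_dxLin, sub_mul, mul_assoc, h.mul_inv', mul_one, map_sub]
  rw [h.opD_eq, h1, h2, hc, mul_zero, zero_smul, sub_zero, Nat.cast_zero, mul_zero, mul_zero,
    lamOp_zero, lamOp_zero, one_mul, one_mul, Nat.factorial_zero, Nat.cast_one, div_one, one_smul,
    smul_sub, smul_sub]
  -- The operator `∂` is the same in both rings and cancels in the difference of the commutators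
  -- with `∂`.
  change _ = (ε : ℂ) • term 1 1 0 - _ - ((ε : ℂ) • term 1 1 0 - _)
  abel

/-- The properties of dressing operators that do not involve the hierarchy. -/
structure IsPrewave (S V : BOp N ε 1) (Sb Vb : BOp N ε (-1)) : Prop where
  S_mem : InGminus S.op
  V_mem : InGminus V.op
  Sb_mem : NonNeg Sb.op
  Vb_mem : NonNeg Vb.op
  s_S : mapOp (ds 0) S.op = mapOp dx S.op
  s_Sb : mapOp (ds 0) Sb.op = mapOp dx Sb.op

/-- For formal times the evolution equations become equalities of wave derivatives. For `s_0` the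
derivative coincides with that in `x`, and the equation holds by `evolution_zero`. -/
theorem isDressing_iff (hε : ε ≠ 0) (hp : IsPrewave S V Sb Vb) :
    IsDressing ε S.op V.op Sb.op Vb.op ↔
      IsLaxPair S V Sb Vb ∧ ∀ v, (waveDer v S * V).op = (waveDer v Sb * Vb).op := by
  constructor
  · intro h
    have hl : IsLaxPair S V Sb Vb :=
      { mul_inv := BOp.ext h.S_inv.1
        inv_mul := BOp.ext h.S_inv.2
        mul_inv' := BOp.ext h.Sb_inv.1
        inv_mul' := BOp.ext h.Sb_inv.2
        lax_eq := h.lax_eq }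
    refine ⟨hl, fun v =>
      (evolution_iff_waveDer hl hε hp.S_mem hp.V_mem hp.Sb_mem hp.Vb_mem v).mp ?_⟩
    cases v with
    | t j => exact ⟨h.t_S j, h.t_Sb j⟩
    | s j => exact ⟨h.s_S (j + 1), h.s_Sb (j + 1)⟩
  · rintro ⟨hl, hv⟩
    have h0 := evolution_zero hl hp.S_mem hp.V_mem hp.Sb_mem hp.Vb_mem
    have h1 := fun v => (evolution_iff_waveDer hl hε hp.S_mem hp.V_mem hp.Sb_mem hp.Vb_mem v).mpr
      (hv v)
    exact
      { S_mem := hp.S_mem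
        Sinv_mem := hp.V_mem
        Sb_mem := hp.Sb_mem
        Sbinv_mem := hp.Vb_mem
        S_inv := ⟨congrArg BOp.op hl.mul_inv, congrArg BOp.op hl.inv_mul⟩
        Sb_inv := ⟨congrArg BOp.op hl.mul_inv', congrArg BOp.op hl.inv_mul'⟩
        lax_eq := hl.lax_eq
        t_S := fun j => (h1 (Time.t j)).1
        t_Sb := fun j => (h1 (Time.t j)).2
        s_S := fun j => match j with
          | 0 => by rw [hp.s_S]; exact h0.1
          | j + 1 => (h1 (Time.s j)).1
        s_Sb := fun j => match j with
          | 0 => by rw [hp.s_Sb]; exact h0.2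
          | j + 1 => (h1 (Time.s j)).2 }

/-! ### The bilinear identities -/

/-- Since `waveDer v S = (waveDer v S · S⁻¹) S`, and similarly for `S̄` with the same operator in
parentheses, every derivative changes the left factors of `S` and `S̄` in the same way. -/
theorem exists_waveDers_eq (hl : IsLaxPair S V Sb Vb)
    (hv : ∀ v, (waveDer v S * V).op = (waveDer v Sb * Vb).op) (L : List Time) :
    ∀ (P : BOp N ε 1) (P' : BOp N ε (-1)), P.op = P'.op →
      ∃ (Q : BOp N ε 1) (Q' : BOp N ε (-1)), Q.op = Q'.op ∧
        waveDers L (P * S) = Q * S ∧ waveDers L (P' * Sb) = Q' * Sb := by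
  induction L with
  | nil => exact fun P P' h => ⟨P, P', h, rfl, rfl⟩
  | cons v L ih =>
    intro P P' h
    have e1 : waveDer v (P * S) = (P.der (timeDer v) + P * (waveDer v S * V)) * S := by
      rw [waveDer_mul, add_mul, mul_assoc P, mul_assoc (waveDer v S), hl.inv_mul, mul_one]
    have e2 : waveDer v (P' * Sb) = (P'.der (timeDer v) + P' * (waveDer v Sb * Vb)) * Sb := by
      rw [waveDer_mul, add_mul, mul_assoc P', mul_assoc (waveDer v Sb), hl.inv_mul', mul_one]
    rw [waveDers_cons, waveDers_cons, e1, e2]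
    refine ih _ _ ?_
    rw [map_add, map_add, BOp.op_der, BOp.op_der, BOp.op_mul, BOp.op_mul P', h, hv]

theorem op_mul_fnOp_congr {X : BOp N ε 1} {X' : BOp N ε (-1)} (h : X.op = X'.op) (g : Coef N) :
    (X * fnOp g).op = (X' * fnOp g).op := by
  rw [BOp.op_mul, BOp.op_mul, h]
  rfl

theorem op_fnOp_mul_congr {X : BOp N ε 1} {X' : BOp N ε (-1)} (h : X.op = X'.op) (g : Coef N) :
    (fnOp g * X).op = (fnOp g * X').op := by
  rw [BOp.op_mul, BOp.op_mul, h]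
  rfl

theorem fnOp_mul_fnOp_of_mul_eq_one {f g : Coef N} (h : f * g = 1) :
    (fnOp f * fnOp g : BOp N ε σ) = 1 := by
  rw [fnOp_mul_fnOp, h, fnOp_one]

theorem op_mul_fnOp_cancel {X : BOp N ε 1} {X' : BOp N ε (-1)} {f g : Coef N} (hfg : f * g = 1)
    (h : (X * fnOp f).op = (X' * fnOp f).op) : X.op = X'.op := by
  have := op_mul_fnOp_congr h g
  rwa [mul_assoc, mul_assoc, fnOp_mul_fnOp_of_mul_eq_one hfg, fnOp_mul_fnOp_of_mul_eq_one hfg,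
    mul_one, mul_one] at this

theorem op_fnOp_mul_cancel {X : BOp N ε 1} {X' : BOp N ε (-1)} {f g : Coef N} (hfg : f * g = 1)
    (h : (fnOp f * X).op = (fnOp f * X').op) : X.op = X'.op := by
  have := op_fnOp_mul_congr h g
  rwa [← mul_assoc, ← mul_assoc, fnOp_mul_fnOp_of_mul_eq_one (mul_comm f g ▸ hfg),
    fnOp_mul_fnOp_of_mul_eq_one (mul_comm f g ▸ hfg), one_mul, one_mul] at this

/-- Only `r = 0` and `r = 1` are needed. For `r = 0`, an operator in non-positive powers of `Λ` with
leading coefficient `1` equals one in non-negative powers, so both are the identity. For `r = 1` the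
equation is that of the Lax operators. -/
theorem isLaxPair_of_op_eq (hp : IsPrewave S V Sb Vb)
    (h : ∀ r : ℕ, (S * lamOp (((1 : ℤˣ) : ℤ) * r) * V).op =
      (Sb * lamOp (((-1 : ℤˣ) : ℤ) * r) * Vb).op) : IsLaxPair S V Sb Vb := by
  have hS := isTri_of_inGminus hp.S_mem
  have hV := isTri_of_inGminus hp.V_mem
  have hSb := isTri_of_nonNeg hp.Sb_mem
  have hVb := isTri_of_nonNeg hp.Vb_mem
  have h0 : (S * V).op = (Sb * Vb).op := by
    have := h 0
    rwa [Nat.cast_zero, mul_zero, mul_zero, lamOp_zero, lamOp_zero, mul_one, mul_one] at this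
  have act_one_one : act (1 : (Coef N)[X]) 1 = 1 := EZTH.act_one 1
  have hz : (S * V).op 0 = 1 := by
    rw [hS.op_mul_zero hV, hp.S_mem.2.1, hp.V_mem.2.1, act_one_one]
  have e0 : (S * V).op = one := by
    funext n
    rw [one, term]
    rcases lt_trichotomy n 0 with hn | rfl | hn
    · rw [if_neg hn.ne, h0]
      have := hSb.mul hVb (-n) (by omega)
      rwa [Units.val_neg, Units.val_one, neg_mul_neg, one_mul] at this
    · rw [if_pos rfl, hz, monomial_zero_left, C_1]
    · rw [if_neg hn.ne']
      have := hS.mul hV n hn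
      rwa [Units.val_one, one_mul] at this
  have h1 : S * V = 1 := BOp.ext e0
  have h2 : Sb * Vb = 1 := BOp.ext (h0.symm.trans e0)
  have hC : ∀ P : (Coef N)[X], P.natDegree = 0 → P = C (P.coeff 0) := fun P hP =>
    eq_C_of_natDegree_eq_zero hP
  refine ⟨h1, mul_eq_one_comm_of_isTri hS hV h1 ?_, h2, mul_eq_one_comm_of_isTri hSb hVb h2 ?_, ?_⟩
  · rw [hV.op_mul_zero hS, hp.S_mem.2.1, hp.V_mem.2.1, act_one_one]
  -- The leading coefficients of `Sb` and `Vb` are functions without `∂`; they commute, so they are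
  -- inverse to each other in either order.
  · have h3 : (Sb * Vb).op 0 = 1 := by rw [← h0, hz]
    rw [hSb.op_mul_zero hVb, hC _ (hp.Sb_mem.1 0), act_C] at h3
    rw [hVb.op_mul_zero hSb, hC _ (hp.Vb_mem.1 0), act_C, ← hC _ (hp.Vb_mem.1 0),
      hC _ (hp.Sb_mem.1 0), mul_comm, h3]
  · have := h 1
    rwa [Nat.cast_one, mul_one, mul_one, Units.val_neg, Units.val_one] at this

/-- The hierarchy is equivalent to bilinear identities. -/
theorem isDressing_iff_bilinear (hε : ε ≠ 0) (hp : IsPrewave S V Sb Vb) {f f' g g' : Coef N}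
    (hf : f * f' = 1) (hg : g * g' = 1) :
    IsDressing ε S.op V.op Sb.op Vb.op ↔ ∀ (L : List Time) (r : ℕ),
      (waveDers L (fnOp f * S) * lamOp (((1 : ℤˣ) : ℤ) * r) * (V * fnOp g)).op =
        (waveDers L (fnOp f * Sb) * lamOp (((-1 : ℤˣ) : ℤ) * r) * (Vb * fnOp g)).op := by
  rw [isDressing_iff hε hp]
  constructor
  · rintro ⟨hl, hv⟩ L r
    obtain ⟨Q, Q', hQ, h1, h2⟩ := exists_waveDers_eq hl hv L (fnOp f) (fnOp f) rfl
    rw [h1, h2, ← mul_assoc, ← mul_assoc]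
    refine op_mul_fnOp_congr ?_ g
    rw [mul_assoc Q, mul_assoc Q, mul_assoc Q', mul_assoc Q', BOp.op_mul Q, BOp.op_mul Q', hQ,
      hl.op_pow_eq]
  · intro h
    have hl : IsLaxPair S V Sb Vb := by
      refine isLaxPair_of_op_eq hp fun r => ?_
      have h1 := h [] r
      change (fnOp f * S * _ * (V * fnOp g)).op = (fnOp f * Sb * _ * (Vb * fnOp g)).op at h1
      rw [← mul_assoc, ← mul_assoc] at h1
      have h2 := op_mul_fnOp_cancel hg h1
      rw [mul_assoc (fnOp f), mul_assoc (fnOp f), mul_assoc (fnOp f), mul_assoc (fnOp f)] at h2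
      exact op_fnOp_mul_cancel hf h2
    refine ⟨hl, fun v => ?_⟩
    -- One derivative and `r = 0`. The derivative of `f` contributes the same term to both sides and
    -- drops out.
    have h1 := h [v] 0
    change (waveDer v (fnOp f * S) * _ * (V * fnOp g)).op =
      (waveDer v (fnOp f * Sb) * _ * (Vb * fnOp g)).op at h1
    rw [Nat.cast_zero, mul_zero, mul_zero, lamOp_zero, lamOp_zero, mul_one, mul_one, ← mul_assoc,
      ← mul_assoc] at h1
    have h2 := op_mul_fnOp_cancel hg h1
    rw [waveDer_mul, waveDer_mul] at h2
    simp only [add_mul, mul_assoc, hl.mul_inv, hl.mul_inv', mul_one, map_add] at h2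
    exact op_fnOp_mul_cancel hf (add_left_cancel h2)

end Wave

/-! ### Dressing operators given by a tau-function -/

section Tau

variable {N : ℕ} {ε : ℝ} {σ : ℤˣ}

open Polynomial

/-! ### Operators with given symbols -/

/-- The operator `∑ a_k Λ^{-σ k}`. -/
def leftOp (a : PowerSeries (Coef N)) : BOp N ε σ :=
  BOp.mk (fun n => if (σ : ℤ) * n ≤ 0 then C (PowerSeries.coeff n.natAbs a) else 0)
    ⟨0, fun n hn => if_neg (by omega)⟩

/-- The operator `∑ Λ^{-σ k} a_k`. -/
def rightOp (a : PowerSeries (Coef N)) : BOp N ε σ :=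
  BOp.mk (fun n => if (σ : ℤ) * n ≤ 0 then C (shift ε n (PowerSeries.coeff n.natAbs a)) else 0)
    ⟨0, fun n hn => if_neg (by omega)⟩

theorem op_leftOp (a : PowerSeries (Coef N)) (n : ℤ) : (leftOp a : BOp N ε σ).op n =
    if (σ : ℤ) * n ≤ 0 then C (PowerSeries.coeff n.natAbs a) else 0 := rfl

theorem op_rightOp (a : PowerSeries (Coef N)) (n : ℤ) : (rightOp a : BOp N ε σ).op n =
    if (σ : ℤ) * n ≤ 0 then C (shift ε n (PowerSeries.coeff n.natAbs a)) else 0 := rfl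

theorem leftMinus_eq (a : PowerSeries (Coef N)) :
    leftMinus a = (leftOp a : BOp N ε 1).op := by
  funext n
  rw [leftMinus, op_leftOp, Units.val_one, one_mul]

theorem rightMinus_eq (a : PowerSeries (Coef N)) :
    rightMinus ε a = (rightOp a : BOp N ε 1).op := by
  funext n
  rw [rightMinus, op_rightOp, Units.val_one, one_mul]

theorem leftPlus_eq (a : PowerSeries (Coef N)) :
    leftPlus a = (leftOp a : BOp N ε (-1)).op := by
  funext n
  rw [leftPlus, op_leftOp, Units.val_neg, Units.val_one, neg_one_mul]
  simp only [Left.neg_nonpos_iff]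

theorem rightPlus_eq (a : PowerSeries (Coef N)) :
    rightPlus ε a = (rightOp a : BOp N ε (-1)).op := by
  funext n
  rw [rightPlus, op_rightOp, Units.val_neg, Units.val_one, neg_one_mul]
  simp only [Left.neg_nonpos_iff]

theorem natAbs_unit_mul (σ : ℤˣ) (n : ℤ) : ((σ : ℤ) * n).natAbs = n.natAbs := by
  rw [Int.natAbs_mul, Int.units_natAbs, one_mul]

/-- Left multiplication by the denominator `f` clears it from a left symbol; the numerator is a
Miwa-shifted tau-function, as in the vertex operators. -/
theorem isLeftSymb_leftOp (a : PowerSeries (Coef N)) {f f' : Coef N} (hf : f * f' = 1) :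
    IsLeftSymb (toLaurent a) (fnOp f * leftOp (a * PowerSeries.C f') : BOp N ε σ) := by
  intro n
  rw [op_fnOp_mul, op_leftOp, unit_mul_unit_mul, natAbs_unit_mul]
  split_ifs with h
  · obtain ⟨k, rfl⟩ : ∃ k : ℕ, n = -(k : ℤ) := ⟨n.natAbs, by omega⟩
    rw [neg_neg, zCoeff_toLaurent, Int.natAbs_neg, Int.natAbs_natCast, PowerSeries.coeff_mul_C,
      ← C_mul, mul_left_comm, hf, mul_one]
  · rw [zCoeff_toLaurent_of_neg _ (by omega), mul_zero, C_0]

theorem op_mul_fnOp (x : BOp N ε σ) (f : Coef N) (n : ℤ) :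
    (x * fnOp f).op n = act (x.op n) (C (shift ε n f)) := by
  rw [BOp.op_mul, fnOp, BOp.op_mk, comp_term, sub_zero, monomial_zero_left]

/-- Right symbols are cleared of denominators by right multiplication. Moving `Λ` to the other side
undoes the shift of each coefficient and leaves the common shift `Λ^{-l}`. -/
theorem isRightSymb_rightOp (l : ℤ) (a : PowerSeries (Coef N)) {f f' : Coef N} (hf : f * f' = 1) :
    IsRightSymb l (MvPowerSeries.rename Var2.snd (toLaurent (PowerSeries.map (shift ε (-l)) a)))
      (rightOp (a * PowerSeries.C f') * fnOp f : BOp N ε σ) := by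
  intro m
  rw [MvPowerSeries.rename_rename, zCoeff_rename, op_mul_fnOp, op_rightOp, mul_neg,
    unit_mul_unit_mul, Int.natAbs_neg, natAbs_unit_mul]
  split_ifs with h
  · obtain ⟨k, rfl⟩ : ∃ k : ℕ, m = (k : ℤ) := ⟨m.natAbs, by omega⟩
    rw [zCoeff_toLaurent, Int.natAbs_natCast, PowerSeries.coeff_mul_C, act_C, ← C_mul, ← map_mul,
      mul_assoc, mul_comm f', hf, mul_one, shiftPoly_C, shift_shift, symb_C, PowerSeries.coeff_map,
      add_neg_cancel_right]
    rfl
  · rw [zCoeff_toLaurent_of_neg _ (by omega), act_zero, LinearMap.zero_apply, map_zero, map_zero,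
      map_zero]

theorem pderiv_fst_rename_snd {A : Type} [CommRing A] [Algebra ℂ A] (v : Time)
    (F : MvPowerSeries Time A) :
    MvPowerSeries.pderiv A (Var2.fst v) (MvPowerSeries.rename Var2.snd F) = 0 :=
  pderiv_rename_of_notMem (⟨Var2.snd, fun _ _ h => Var2.snd.inj h⟩ : Time ↪ Var2)
    (by rintro ⟨w, h⟩; exact Var2.noConfusion h) F

theorem diag_fstDerivs_hirotaNormal (l : ℤ) (r : ℕ) (L : List Time) (τ : TauSpace N)
    {f f' g g' : Coef N} (hf : f * f' = 1) (hg : g * g' = 1) :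
    MvPowerSeries.rename diagVar (fstDerivs L (zCoeff r (hirotaNormal ε σ l τ))) =
      symb ((waveDers L (fnOp f * leftOp (firstSeries ε σ τ * PowerSeries.C f') : BOp N ε σ) *
        lamOp (σ * r) * (rightOp (secondSeries ε σ τ * PowerSeries.C g') * fnOp g)).op (-l)) := by
  rw [← zCoeff_fstDerivs, ← zCoeff_rename, hirotaNormal]
  exact zCoeff_diag_fstDerivs_hirotaForm l r L (isLeftSymb_leftOp _ hf)
    (isRightSymb_rightOp l _ hg) fun v => pderiv_fst_rename_snd v _

/-! ### The operators given by the tau-function -/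

theorem atSum_mul_inv (a : ℝ) (τ : (TauSpace N)ˣ) :
    atSum a (τ : TauSpace N) * atSum a ((τ⁻¹ : (TauSpace N)ˣ) : TauSpace N) = 1 := by
  rw [← map_mul, Units.mul_inv, map_one]

theorem coeff_miwa_atSum (s : ℤ) (a : ℝ) (f : TauSpace N) (k : ℕ) :
    PowerSeries.coeff k (miwa ε s (atSum a f)) = atSum a (PowerSeries.coeff k (miwa ε s f)) := by
  have := miwa_map (pullHom (N := N) (fun p : ℝ × ℝ => p.2 + p.1 + a) (by fun_prop)) ε s f
  change miwa ε s (atSum a f) = PowerSeries.map (atSum a) (miwa ε s f) at this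
  rw [this, PowerSeries.coeff_map]

theorem coeff_zero_miwa (s : ℤ) (f : TauSpace N) : PowerSeries.coeff 0 (miwa ε s f) = f := by
  rw [miwa, PowerSeries.coeff_mk]
  simp

theorem mapCoeff_der_atSum (a : ℝ) (v : ℝ × ℝ) (f : TauSpace N) :
    mapCoeff (der v) (atSum a f) = atSum a (mapCoeff (der (v.2 + v.1)) f) := by
  ext1 α
  refine der_pull (fun p : ℝ × ℝ => p.2 + p.1 + a) (by fun_prop) v _ (fun q => ?_) _
  have h1 : HasFDerivAt (fun q : ℝ × ℝ => q.1) (ContinuousLinearMap.fst ℝ ℝ ℝ) q := hasFDerivAt_fst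
  have h2 : HasFDerivAt (fun q : ℝ × ℝ => q.2) (ContinuousLinearMap.snd ℝ ℝ ℝ) q := hasFDerivAt_snd
  have h4 : fderiv ℝ (fun p : ℝ × ℝ => p.2 + p.1 + a) q = _ := ((h2.add h1).add_const a).fderiv
  rw [h4]
  rfl

/-- The quotients depend on `x` and `s_0` only through `s_0 + x`. -/
theorem ds_zero_coeff_tauQuot (τ : (TauSpace N)ˣ) (s : ℤ) (a b : ℝ) (k : ℕ) :
    ds 0 (PowerSeries.coeff k (tauQuot ε τ s a b)) =
      dx (PowerSeries.coeff k (tauQuot ε τ s a b)) := by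
  rw [tauQuot, PowerSeries.coeff_mul_C, coeff_miwa_atSum, ds, dx, mapCoeff_der_mul,
    mapCoeff_der_mul, mapCoeff_der_atSum, mapCoeff_der_atSum, mapCoeff_der_atSum,
    mapCoeff_der_atSum, add_zero, zero_add]

theorem coeff_zero_tauQuot (τ : (TauSpace N)ˣ) (s : ℤ) (a : ℝ) :
    PowerSeries.coeff 0 (tauQuot ε τ s a a) = 1 := by
  rw [tauQuot, PowerSeries.coeff_mul_C, coeff_miwa_atSum, coeff_zero_miwa, atSum_mul_inv]

theorem diffFree_leftOp (a : PowerSeries (Coef N)) : DiffFree (leftOp a : BOp N ε σ).op := by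
  intro n
  rw [op_leftOp]
  split_ifs
  · exact natDegree_C _
  · exact natDegree_zero

theorem diffFree_rightOp (a : PowerSeries (Coef N)) : DiffFree (rightOp a : BOp N ε σ).op := by
  intro n
  rw [op_rightOp]
  split_ifs
  · exact natDegree_C _
  · exact natDegree_zero

theorem op_leftOp_of_pos (a : PowerSeries (Coef N)) {n : ℤ} (hn : 0 < σ * n) :
    (leftOp a : BOp N ε σ).op n = 0 := if_neg (by omega)

theorem op_rightOp_of_pos (a : PowerSeries (Coef N)) {n : ℤ} (hn : 0 < σ * n) :
    (rightOp a : BOp N ε σ).op n = 0 := if_neg (by omega)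

theorem inGminus_leftOp {a : PowerSeries (Coef N)} (h : PowerSeries.coeff 0 a = 1) :
    InGminus (leftOp a : BOp N ε 1).op := by
  refine ⟨diffFree_leftOp a, ?_, fun n hn => op_leftOp_of_pos a (by rwa [Units.val_one, one_mul])⟩
  rw [op_leftOp, mul_zero, if_pos le_rfl, Int.natAbs_zero, h, C_1]

theorem inGminus_rightOp {a : PowerSeries (Coef N)} (h : PowerSeries.coeff 0 a = 1) :
    InGminus (rightOp a : BOp N ε 1).op := by
  refine ⟨diffFree_rightOp a, ?_, fun n hn => op_rightOp_of_pos a (by rwa [Units.val_one, one_mul])⟩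
  rw [op_rightOp, mul_zero, if_pos le_rfl, Int.natAbs_zero, h, map_one, C_1]

theorem nonNeg_leftOp (a : PowerSeries (Coef N)) : NonNeg (leftOp a : BOp N ε (-1)).op :=
  ⟨diffFree_leftOp a, fun n hn => op_leftOp_of_pos a (by
    rw [Units.val_neg, Units.val_one]
    omega)⟩

theorem nonNeg_rightOp (a : PowerSeries (Coef N)) : NonNeg (rightOp a : BOp N ε (-1)).op :=
  ⟨diffFree_rightOp a, fun n hn => op_rightOp_of_pos a (by
    rw [Units.val_neg, Units.val_one]
    omega)⟩

theorem mapOp_leftOp {d d' : Coef N → Coef N} (hd : d 0 = 0) (hd' : d' 0 = 0)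
    {a : PowerSeries (Coef N)} (h : ∀ k, d (PowerSeries.coeff k a) = d' (PowerSeries.coeff k a)) :
    mapOp d (leftOp a : BOp N ε σ).op = mapOp d' (leftOp a : BOp N ε σ).op := by
  funext n
  rw [mapOp, mapOp, op_leftOp]
  split_ifs
  · rw [← monomial_zero_left, sum_monomial_index _ _ (by rw [hd, map_zero]),
      sum_monomial_index _ _ (by rw [hd', map_zero]), h]
  · rw [sum_zero_index, sum_zero_index]

theorem isPrewave_tau (τ : (TauSpace N)ˣ) : IsPrewave (ε := ε)
    (leftOp (tauQuot ε τ (-1) (-ε / 2) (-ε / 2))) (rightOp (tauQuot ε τ 1 (ε / 2) (ε / 2)))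
    (leftOp (tauQuot ε τ 1 (ε / 2) (-ε / 2))) (rightOp (tauQuot ε τ (-1) (-ε / 2) (ε / 2))) where
  S_mem := inGminus_leftOp (coeff_zero_tauQuot τ _ _)
  V_mem := inGminus_rightOp (coeff_zero_tauQuot τ _ _)
  Sb_mem := nonNeg_leftOp _
  Vb_mem := nonNeg_rightOp _
  s_S := mapOp_leftOp (funext fun _ => map_zero (der ((0 : ℝ), (1 : ℝ))))
    (funext fun _ => map_zero (der ((1 : ℝ), (0 : ℝ)))) fun k => ds_zero_coeff_tauQuot τ _ _ _ k
  s_Sb := mapOp_leftOp (funext fun _ => map_zero (der ((0 : ℝ), (1 : ℝ))))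
    (funext fun _ => map_zero (der ((1 : ℝ), (0 : ℝ)))) fun k => ds_zero_coeff_tauQuot τ _ _ _ k

theorem firstSeries_mul_C (τ : (TauSpace N)ˣ) (s : ℤ) (a b : ℝ) (ha : -((s : ℝ) * (ε / 2)) = a) :
    firstSeries ε s (τ : TauSpace N) *
      PowerSeries.C (atSum b ((τ⁻¹ : (TauSpace N)ˣ) : TauSpace N)) = tauQuot ε τ (-s) a b := by
  rw [firstSeries, ha, tauQuot]

theorem secondSeries_mul_C (τ : (TauSpace N)ˣ) (s : ℤ) (a b : ℝ) (ha : (s : ℝ) * (ε / 2) = a) :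
    secondSeries ε s (τ : TauSpace N) *
      PowerSeries.C (atSum b ((τ⁻¹ : (TauSpace N)ˣ) : TauSpace N)) = tauQuot ε τ s a b := by
  rw [secondSeries, ha, tauQuot]

theorem isTauFunction_iff (τ : (TauSpace N)ˣ) : IsTauFunction ε τ ↔ IsDressing ε
    (leftOp (tauQuot ε τ (-1) (-ε / 2) (-ε / 2)) : BOp N ε 1).op
    (rightOp (tauQuot ε τ 1 (ε / 2) (ε / 2)) : BOp N ε 1).op
    (leftOp (tauQuot ε τ 1 (ε / 2) (-ε / 2)) : BOp N ε (-1)).op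
    (rightOp (tauQuot ε τ (-1) (-ε / 2) (ε / 2)) : BOp N ε (-1)).op := by
  rw [← leftMinus_eq, ← rightMinus_eq, ← leftPlus_eq, ← rightPlus_eq]
  constructor
  · rintro ⟨_, _, _, _, h, rfl, rfl, rfl, rfl⟩
    exact h
  · exact fun h => ⟨_, _, _, _, h, rfl, rfl, rfl, rfl⟩

/-- The functions `f = τ(s_0 + x - ε/2)` and `g = τ(s_0 + x + ε/2)` are common denominators of `S`,
`S̄` and of their inverses. With these the bilinear identities are the Taylor coefficients of the
Hirota equations along the diagonal. -/
theorem isTauFunction_iff_hirotaNormal (hε : ε ≠ 0) (τ : (TauSpace N)ˣ) : IsTauFunction ε τ ↔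
    ∀ (l : ℤ) (r : ℕ), zCoeff r (hirotaNormal ε 1 l (τ : TauSpace N)) =
      zCoeff r (hirotaNormal ε (-1) l (τ : TauSpace N)) := by
  have hm := atSum_mul_inv (-ε / 2) τ
  have hp := atSum_mul_inv (ε / 2) τ
  have h1 := fun l r L => diag_fstDerivs_hirotaNormal (ε := ε) (σ := 1) l r L (τ : TauSpace N) hm hp
  have h2 := fun l r L => diag_fstDerivs_hirotaNormal (ε := ε) (σ := -1) l r L (τ : TauSpace N) hm hp
  rw [firstSeries_mul_C τ _ (-ε / 2) _ (by rw [Units.val_one, Int.cast_one]; ring),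
    secondSeries_mul_C τ _ (ε / 2) _ (by rw [Units.val_one, Int.cast_one]; ring)] at h1
  rw [firstSeries_mul_C τ _ (ε / 2) _ (by
      rw [Units.val_neg, Units.val_one, Int.cast_neg, Int.cast_one]; ring),
    secondSeries_mul_C τ _ (-ε / 2) _ (by
      rw [Units.val_neg, Units.val_one, Int.cast_neg, Int.cast_one]; ring)] at h2
  rw [isTauFunction_iff, isDressing_iff_bilinear hε (isPrewave_tau τ) hm hp]
  constructor
  · intro h l r
    refine eq_iff_diag_fstDerivs.mpr fun L => ?_
    exact (h1 l r L).trans ((congrArg symb (congrFun (h L r) (-l))).trans (h2 l r L).symm)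
  · intro h L r
    funext n
    -- The coefficient of `Λ^n` in the bilinear identity is the Hirota equation with `l = -n`; the
    -- symbol determines the coefficient by `symb_injective`.
    have h3 := (h1 (-n) r L).symm.trans ((congrArg (fun F => MvPowerSeries.rename diagVar
      (fstDerivs L F)) (h (-n) r)).trans (h2 (-n) r L))
    rw [neg_neg] at h3
    exact symb_injective h3

end Tau

end EZTH

end

theorem mainTheorem1 (N : ℕ) (ε : ℝ) (hε : ε ≠ 0) (τ : (EZTH.TauSpace N)ˣ) :
    (EZTH.IsTauFunction ε τ ↔ EZTH.HirotaEquations ε (τ : EZTH.TauSpace N)) ∧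
      (EZTH.HirotaEquations ε (τ : EZTH.TauSpace N) ↔
        EZTH.HirotaRegular ε (τ : EZTH.TauSpace N)) := by
  -- Both systems of equations have the same normal form, so the second equivalence becomes trivial.
  rw [EZTH.hirotaEquations_iff ε hε, EZTH.hirotaRegular_iff ε hε]
  exact ⟨EZTH.isTauFunction_iff_hirotaNormal hε τ, Iff.rfl⟩
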